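/- **Setting.** Let $\pi_0$ (reference) and $\pi$ (target) be probability distributions on a measurable space $\mathcal X$ with strictly positive measurable densities, also written $\pi_0,\pi$, with respect to a common measure $\mathrm dx$. Put $L=\pi/\pi_0$, $V=-\log L$, $\mathcal Z(\beta)=\int L^\beta\pi_0\,\mathrm dx$ and $\pi^{(\beta)}=L^\beta\pi_0/\mathcal Z(\beta)$ for $\beta\in[0,1]$. For $\beta,\beta'\in[0,1]$ let $$s(\beta,\beta')=\mathbb E\Big[\exp\big(\min\{0,(\beta'-\beta)(V(X')-V(X))\}\big)\Big],\qquad r(\beta,\beta')=1-s(\beta,\beta'),$$ where $X\sim\pi^{(\beta)}$ and $X'\sim\pi^{(\beta')}$ are independent, and let $$\lambda(\beta)=\lim_{\delta\to0}\frac{r(\beta,\beta+\delta)}{|\delta|}\quad(\text{with }\beta+\delta\in[0,1]),\qquad \Lambda=\int_0^1\lambda(\beta)\,\mathrm d\beta .$$ For an annealing schedule $\mathcal P_N=\{0=\beta_0<\beta_1<\dots<\beta_N=1\}$ let $\|\mathcal P_N\|=\max_i(\beta_i-\beta_{i-1})$ and $E(\mathcal P_N)=\sum_{i=1}^N r(\beta_{i-1},\beta_i)/s(\beta_{i-1},\beta_i)$.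 **Parallel tempering.** For each $i$ let $K^{(\beta_i)}$ be a $\pi^{(\beta_i)}$-invariant Markov kernel on $\mathcal X$. The algorithm is a Markov chain of states $(X_n^0,\dots,X_n^N)\in\mathcal X^{N+1}$ and permutations $\mathbf I_n=(I_n^0,\dots,I_n^N)$ of $\{0,\dots,N\}$. It starts from $(X_0^0,\dots,X_0^N)\sim\prod_{i=0}^N\pi^{(\beta_i)}$ and an independent $\mathbf I_0$ of arbitrary law. At iteration $n$, swaps are proposed for all pairs $(i,i+1)$ with $i$ even, or for all those with $i$ odd. Under DEO (non-reversible PT) they are the even ones if $n$ is even and the odd ones if $n$ is odd; under SEO (reversible PT) an independent fair coin decides for each $n$. Each proposed swap is accepted, independently given the state, with probability $\exp(\min\{0,(\beta_{i+1}-\beta_i)(V(X_n^{i+1})-V(X_n^i))\})$; an accepted swap exchanges the states at positions $i$ and $i+1$ and the values $i$ and $i+1$ in $\mathbf I_n$. Then every component $i$ is moved independently by $K^{(\beta_i)}$, which gives iteration $n+1$. For machine $j\in\{0,\dots,N\}$ let $\varepsilon_n^j=1$ if $I_n^j$ has the parity of the swaps proposed at iteration $n$, and $\varepsilon_n^j=-1$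 otherwise. Let $T^j_{\downarrow,0}=\inf\{n:(I^j_n,\varepsilon^j_n)=(0,-1)\}$ and, for $k\ge1$, $$T^j_{\uparrow,k}=\inf\{n>T^j_{\downarrow,k-1}:(I^j_n,\varepsilon^j_n)=(N,1)\},\qquad T^j_{\downarrow,k}=\inf\{n>T^j_{\uparrow,k}:(I^j_n,\varepsilon^j_n)=(0,-1)\}.$$ Let $\mathcal T_n=\sum_{j=0}^N\#\{k\ge1:T^j_{\uparrow,k}\le n\}$. The round trip rate is $\tau=\lim_{n\to\infty}\mathbb E[\mathcal T_n]/n$, written $\tau_{\mathrm{SEO}}$ and $\tau_{\mathrm{DEO}}$ for the two schemes. **Assumptions.** (Efficient local exploration) For each $i$, if $X\sim\pi^{(\beta_i)}$ and $X'\mid X\sim K^{(\beta_i)}(X,\cdot)$, then $V(X')$ is independent of $X$. (Integrability) $V^3$ is integrable with respect to $\pi_0$ and $\pi$. **Theorem (asymptotic round trip rates).** The limits defining $\lambda(\beta)$ for $\beta\in[0,1]$, $\tau_{\mathrm{SEO}}$ and $\tau_{\mathrm{DEO}}$ exist, and $\lambda$ is integrable on $[0,1]$. As $\|\mathcal P_N\|\to0$,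 uniformly over all schedules, exploration kernels and laws of $\mathbf I_0$ as above: (a) $\Lambda\le E(\mathcal P_N)$ as soon as $\|\mathcal P_N\|$ is small enough, and $E(\mathcal P_N)=\Lambda+O(\|\mathcal P_N\|)$; (b) $\displaystyle\tau_{\mathrm{SEO}}\sim\frac1{2N+2\Lambda}\longrightarrow0$; (c) $\displaystyle\tau_{\mathrm{DEO}}\longrightarrow\frac1{2+2\Lambda}>0$, and $\displaystyle\tau_{\mathrm{DEO}}-\frac1{2+2\Lambda}=O(\|\mathcal P_N\|)$. -/

import Mathlib

open MeasureTheory ProbabilityTheory Filter Topology Asymptotics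

noncomputable section

/-- A reference and a target probability distribution with strictly positive densities `ref` and
`target` with respect to a common dominating measure `base`. -/
structure TemperingModel (X : Type*) [MeasurableSpace X] where
  base : Measure X
  ref : X → ℝ
  target : X → ℝ
  measurable_ref : Measurable ref
  measurable_target : Measurable target
  ref_pos : ∀ x, 0 < ref x
  target_pos : ∀ x, 0 < target x
  lintegral_ref : ∫⁻ x, ENNReal.ofReal (ref x) ∂base = 1
  lintegral_target : ∫⁻ x, ENNReal.ofReal (target x) ∂base = 1

namespace TemperingModel

variable {X : Type*} [MeasurableSpace X] (M : TemperingModel X)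

/-- The reference distribution `π₀`. -/
def refMeasure : Measure X := M.base.withDensity fun x => ENNReal.ofReal (M.ref x)

/-- The target distribution `π`. -/
def targetMeasure : Measure X := M.base.withDensity fun x => ENNReal.ofReal (M.target x)

/-- The density ratio `L = π / π₀`. -/
def L (x : X) : ℝ := M.target x / M.ref x

/-- The energy `V = - log L`. -/
def V (x : X) : ℝ := -Real.log (M.L x)

/-- The normalizing constant `𝒵(β) = ∫ L^β π₀`. -/
def Z (β : ℝ) : ℝ := ∫ x, M.L x ^ β * M.ref x ∂M.base

/-- The annealed distribution `π^(β)`, with density `L^β π₀ / 𝒵(β)`. -/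
def annealed (β : ℝ) : Measure X :=
  M.base.withDensity fun x => ENNReal.ofReal (M.L x ^ β * M.ref x / M.Z β)

/-- The swap function `s(β, β')`: the expected acceptance probability for independent states
`X^(β) ∼ π^(β)` and `X^(β') ∼ π^(β')`. -/
def swapProb (β β' : ℝ) : ℝ :=
  ∫ z : X × X, Real.exp (min 0 ((β' - β) * (M.V z.2 - M.V z.1)))
    ∂((M.annealed β).prod (M.annealed β'))

/-- The rejection function `r(β, β') = 1 - s(β, β')`. -/
def rejProb (β β' : ℝ) : ℝ := 1 - M.swapProb β β'

/-- `δ → 0` with `δ ≠ 0` and `β + δ ∈ [0, 1]`. -/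
def incrementFilter (β : ℝ) : Filter ℝ := 𝓝[{δ | δ ≠ 0 ∧ β + δ ∈ Set.Icc (0 : ℝ) 1}] 0

/-- The local communication barrier `λ(β) = lim_{δ → 0} r(β, β + δ) / |δ|`. -/
def localBarrier (β : ℝ) : ℝ :=
  limUnder (incrementFilter β) fun δ => M.rejProb β (β + δ) / |δ|

/-- The global communication barrier `Λ = ∫₀¹ λ(β) dβ`. -/
def globalBarrier : ℝ := ∫ β in (0 : ℝ)..1, M.localBarrier β

lemma measurable_V : Measurable M.V :=
  (Real.measurable_log.comp (M.measurable_target.div M.measurable_ref)).neg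

end TemperingModel

/-- Permutations of a finite set carry the discrete σ-algebra. -/
instance permMeasurableSpace (n : ℕ) : MeasurableSpace (Equiv.Perm (Fin n)) := ⊤

/-- The data of a parallel tempering algorithm with `N + 1` chains for the model `M`: an annealing
schedule `0 = β₀ < ⋯ < β_N = 1`, a `π^(β_i)`-invariant local exploration kernel for each `i`, and
the law of the initial permutation `I₀`, independent of the initial states. (The uniform law gives
the exactly stationary start; the point mass at the identity gives `I₀^j = j`.) -/
structure PTSetup {X : Type*} [MeasurableSpace X] (M : TemperingModel X) where
  N : ℕ
  β : Fin (N + 1) → ℝ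
  β_strictMono : StrictMono β
  β_zero : β 0 = 0
  β_last : β (Fin.last N) = 1
  K : Fin (N + 1) → Kernel X X
  K_markov : ∀ i, IsMarkovKernel (K i)
  K_invariant : ∀ i, (K i).Invariant (M.annealed (β i))
  initPerm : PMF (Equiv.Perm (Fin (N + 1)))

/-- The state `(x, i)` of parallel tempering: `x k` is the state of the `k`-th chain, and machine
`j` currently holds the annealing parameter with index `i j`. -/
abbrev PTState (X : Type*) (N : ℕ) : Type _ := (Fin (N + 1) → X) × Equiv.Perm (Fin (N + 1))

/-- The state together with the type of swaps proposed next (`true`: even, `false`: odd). -/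
abbrev PTFullState (X : Type*) (N : ℕ) : Type _ := PTState X N × Bool

/-- The even (`b = true`) or odd (`b = false`) proposal indicator at index `k`: whether a swap
between the chains `k` and `k + 1` is proposed. -/
abbrev ProposedAt (b : Bool) (k : ℕ) : Prop := Even k ↔ b = true

/-- Law of the type of swaps proposed at iteration `n` under SEO: a fair coin. -/
def seoProposal (_n : ℕ) : PMF Bool := PMF.uniformOfFintype Bool

/-- Law of the type of swaps proposed at iteration `n` under DEO: even swaps for even `n`, odd
swaps for odd `n`. -/
def deoProposal (n : ℕ) : PMF Bool := PMF.pure (decide (Even n))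

namespace PTSetup

variable {X : Type*} [MeasurableSpace X] {M : TemperingModel X} (A : PTSetup M)

/-- The mesh size `‖P_N‖ = sup_i (β_i - β_{i-1})`. -/
def mesh : ℝ := ⨆ i : Fin A.N, (A.β i.succ - A.β i.castSucc)

/-- The schedule inefficiency `E(P_N) = ∑_{i=1}^N r^{(i-1,i)} / s^{(i-1,i)}`. -/
def inefficiency : ℝ :=
  ∑ i : Fin A.N, M.rejProb (A.β i.castSucc) (A.β i.succ) /
    M.swapProb (A.β i.castSucc) (A.β i.succ)

/-- Efficient local exploration: if `X ∼ π^(β_i)` and `X' | X ∼ K^(β_i)(X, ·)`, then the energy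
`V(X')` is independent of `X`. -/
def EfficientLocalExploration : Prop :=
  ∀ i, IndepFun (fun z : X × X => z.1) (fun z : X × X => M.V z.2)
    (M.annealed (A.β i) ⊗ₘ A.K i)

/-- The acceptance probability `α^{(i,i+1)}`. -/
def accept (i : Fin A.N) (z : PTState X A.N) : ℝ :=
  Real.exp (min 0 ((A.β i.succ - A.β i.castSucc) * (M.V (z.1 i.succ) - M.V (z.1 i.castSucc))))

/-- The proposed state `(x^{(i,i+1)}, i^{(i,i+1)})`. -/
def swapState (i : Fin A.N) (z : PTState X A.N) : PTState X A.N :=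
  (fun k => z.1 (Equiv.swap i.castSucc i.succ k), Equiv.swap i.castSucc i.succ * z.2)

lemma measurable_accept (i : Fin A.N) : Measurable (A.accept i) := by
  have h : ∀ k : Fin (A.N + 1), Measurable fun z : PTState X A.N => M.V (z.1 k) := fun k =>
    M.measurable_V.comp ((measurable_pi_apply k).comp measurable_fst)
  exact Real.measurable_exp.comp (measurable_const.min (((h _).sub (h _)).const_mul _))

lemma measurable_swapState (i : Fin A.N) : Measurable (A.swapState i) := by
  refine Measurable.prodMk ?_ ?_
  · exact measurable_pi_lambda _ fun k => (measurable_pi_apply _).comp measurable_fst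
  · exact (measurable_from_top (f := fun σ : Equiv.Perm (Fin (A.N + 1)) =>
      Equiv.swap i.castSucc i.succ * σ)).comp measurable_snd

lemma accept_nonneg (i : Fin A.N) (z : PTState X A.N) : 0 ≤ A.accept i z := (Real.exp_pos _).le

lemma accept_le_one (i : Fin A.N) (z : PTState X A.N) : A.accept i z ≤ 1 :=
  Real.exp_le_one_iff.2 (min_le_left _ _)

/-- The swap kernel `K^{(i,i+1)}`: move to the proposed state with probability `α^{(i,i+1)}`, stay
otherwise. -/
def swapKernel (i : Fin A.N) : Kernel (PTState X A.N) (PTState X A.N) where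
  toFun z := ENNReal.ofReal (1 - A.accept i z) • Measure.dirac z +
    ENNReal.ofReal (A.accept i z) • Measure.dirac (A.swapState i z)
  measurable' := by
    refine Measure.measurable_of_measurable_coe _ fun s hs => ?_
    simp only [Measure.add_apply, Measure.smul_apply, smul_eq_mul]
    refine Measurable.add (Measurable.mul ?_ ?_) (Measurable.mul ?_ ?_)
    · exact (measurable_const.sub (A.measurable_accept i)).ennreal_ofReal
    · exact (Measure.measurable_coe hs).comp Measure.measurable_dirac
    · exact (A.measurable_accept i).ennreal_ofReal
    · exact (Measure.measurable_coe hs).comp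
        (Measure.measurable_dirac.comp (A.measurable_swapState i))

instance (i : Fin A.N) : IsMarkovKernel (A.swapKernel i) where
  isProbabilityMeasure z := by
    constructor
    change (ENNReal.ofReal (1 - A.accept i z) • Measure.dirac z +
      ENNReal.ofReal (A.accept i z) • Measure.dirac (A.swapState i z)) Set.univ = 1
    simp only [Measure.add_apply, Measure.smul_apply, smul_eq_mul, measure_univ, mul_one]
    rw [← ENNReal.ofReal_add (sub_nonneg.2 (A.accept_le_one i z)) (A.accept_nonneg i z)]
    simp

/-- The kernel `K^even` (`b = true`) or `K^odd` (`b = false`): the product of all swap kernels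
`K^{(i,i+1)}` with `i` even, respectively odd (they act on disjoint pairs of chains). -/
def commKernel (b : Bool) : Kernel (PTState X A.N) (PTState X A.N) :=
  (((List.finRange A.N).filter fun i : Fin A.N => ProposedAt b i).map fun i => A.swapKernel i).foldr
    (fun κ η => κ ∘ₖ η) Kernel.id

instance (b : Bool) : IsMarkovKernel (A.commKernel b) := by
  unfold commKernel
  induction (List.finRange A.N).filter fun i : Fin A.N => ProposedAt b i with
  | nil => exact inferInstanceAs (IsMarkovKernel (Kernel.id : Kernel (PTState X A.N) (PTState X A.N)))
  | cons i l ih =>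
    simp only [List.map_cons, List.foldr_cons]
    infer_instance

/-- The local exploration kernel: each component `x^i` moves independently by `K^(β_i)`, and the
permutation does not change. -/
def explKernel : Kernel (PTState X A.N) (PTState X A.N) where
  toFun z := (Measure.pi fun i => A.K i (z.1 i)).prod (Measure.dirac z.2)
  measurable' := by
    have := A.K_markov
    have hpi : Measurable fun z : PTState X A.N => Measure.pi fun i => A.K i (z.1 i) := by
      refine Measurable.measure_of_isPiSystem_of_isProbabilityMeasure
        generateFrom_pi.symm isPiSystem_pi ?_
      rintro _ ⟨s, hs, rfl⟩
      simp only [Measure.pi_pi]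
      refine Finset.measurable_fun_prod _ fun i _ => ?_
      exact (Kernel.measurable_coe (A.K i) (hs i (Set.mem_univ i))).comp
        ((measurable_pi_apply i).comp measurable_fst)
    refine Measurable.measure_of_isPiSystem_of_isProbabilityMeasure
      generateFrom_prod.symm isPiSystem_prod ?_
    rintro _ ⟨s, hs, t, ht, rfl⟩
    have hs' : MeasurableSet s := hs
    have ht' : MeasurableSet t := ht
    simp only [Measure.prod_prod]
    exact ((Measure.measurable_coe hs').comp hpi).mul
      ((Measure.measurable_coe ht').comp (Measure.measurable_dirac.comp measurable_snd))

instance : IsMarkovKernel A.explKernel where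
  isProbabilityMeasure z := by
    have := A.K_markov
    change IsProbabilityMeasure ((Measure.pi fun i => A.K i (z.1 i)).prod (Measure.dirac z.2))
    infer_instance

lemma measurableSet_even : MeasurableSet {z : PTFullState X A.N | z.2 = true} :=
  (measurableSet_singleton true).preimage measurable_snd

open scoped Classical in
/-- Communication with the current type of proposals, followed by local exploration. -/
def commExplKernel : Kernel (PTFullState X A.N) (PTState X A.N) :=
  Kernel.piecewise A.measurableSet_even
    ((A.explKernel ∘ₖ A.commKernel true).comap Prod.fst measurable_fst)
    ((A.explKernel ∘ₖ A.commKernel false).comap Prod.fst measurable_fst)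

instance : IsMarkovKernel A.commExplKernel := by
  unfold commExplKernel
  infer_instance

/-- One scan, from iteration `n` to `n + 1`: communication with the current type of proposals, then
local exploration, and independently the type of proposals of iteration `n + 1` is drawn from
`prop (n + 1)`. -/
def scanKernel (prop : ℕ → PMF Bool) (n : ℕ) : Kernel (PTFullState X A.N) (PTFullState X A.N) :=
  A.commExplKernel ×ₖ Kernel.const (PTFullState X A.N) (prop (n + 1)).toMeasure

instance (prop : ℕ → PMF Bool) (n : ℕ) : IsMarkovKernel (A.scanKernel prop n) := by
  unfold scanKernel
  infer_instance

/-- The initial law: stationary states `X_0 ∼ ∏_i π^(β_i)`, an independent initial permutation, and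
an independent type of proposals for iteration `0`. -/
def initLaw (prop : ℕ → PMF Bool) : Measure (PTFullState X A.N) :=
  ((Measure.pi fun i => M.annealed (A.β i)).prod A.initPerm.toMeasure).prod (prop 0).toMeasure

/-- The law of the whole trajectory of parallel tempering, a Markov chain with initial law
`initLaw` and transition kernels `scanKernel`. -/
def law (prop : ℕ → PMF Bool) : Measure (ℕ → PTFullState X A.N) :=
  Kernel.trajMeasure (X := fun _ => PTFullState X A.N) (A.initLaw prop) fun n =>
    (A.scanKernel prop n).comap (fun h => h ⟨n, Finset.mem_Iic.2 le_rfl⟩) (measurable_pi_apply _)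

end PTSetup

/-- The index `I_n^j` of the annealing parameter held by machine `j` at iteration `n`. -/
def indexProcess {X : Type*} {N : ℕ} (ω : ℕ → PTFullState X N) (j : Fin (N + 1)) (n : ℕ) :
    Fin (N + 1) := (ω n).1.2 j

/-- The direction `ε_n^j`: `1` if the proposal indicator at index `I_n^j` is on at iteration `n`,
and `-1` otherwise. -/
def direction {X : Type*} {N : ℕ} (ω : ℕ → PTFullState X N) (j : Fin (N + 1)) (n : ℕ) : ℤ :=
  if ProposedAt (ω n).2 (indexProcess ω j n) then 1 else -1

/-- `inf {n > t : p n}`, with value `⊤` if there is no such `n`. -/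
def hitAfter (t : ℕ∞) (p : ℕ → Prop) : ℕ∞ := ⨅ (n : ℕ) (_ : t < n ∧ p n), (n : ℕ∞)

/-- `downTime ω j k` is `T_{↓,k}^j`, where `T_{↓,0}^j = inf {n : (I_n^j, ε_n^j) = (0, -1)}` and
`T_{↓,k+1}^j = inf {n > T_{↑,k+1}^j : (I_n^j, ε_n^j) = (0, -1)}` with
`T_{↑,k+1}^j = inf {n > T_{↓,k}^j : (I_n^j, ε_n^j) = (N, 1)}`. -/
def downTime {X : Type*} {N : ℕ} (ω : ℕ → PTFullState X N) (j : Fin (N + 1)) : ℕ → ℕ∞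
  | 0 => ⨅ (n : ℕ) (_ : indexProcess ω j n = 0 ∧ direction ω j n = -1), (n : ℕ∞)
  | k + 1 =>
    hitAfter
      (hitAfter (downTime ω j k) fun n => indexProcess ω j n = Fin.last N ∧ direction ω j n = 1)
      fun n => indexProcess ω j n = 0 ∧ direction ω j n = -1

/-- `upTime ω j k` is `T_{↑,k+1}^j`, the time of the annealed restart number `k + 1` of machine
`j`. -/
def upTime {X : Type*} {N : ℕ} (ω : ℕ → PTFullState X N) (j : Fin (N + 1)) (k : ℕ) : ℕ∞ :=
  hitAfter (downTime ω j k) fun n => indexProcess ω j n = Fin.last N ∧ direction ω j n = 1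

/-- The total number of annealed restarts of all machines during the first `n` scans. -/
def annealedRestarts {X : Type*} {N : ℕ} (ω : ℕ → PTFullState X N) (n : ℕ) : ℕ :=
  ∑ j : Fin (N + 1), {k : ℕ | upTime ω j k ≤ n}.ncard

namespace PTSetup

variable {X : Type*} [MeasurableSpace X] {M : TemperingModel X} (A : PTSetup M)

/-- The average number of annealed restarts per scan, `𝔼[𝒯_n] / n`. -/
def meanRestarts (prop : ℕ → PMF Bool) (n : ℕ) : ℝ :=
  (∫ ω, (annealedRestarts ω n : ℝ) ∂(A.law prop)) / n

/-- The round trip rate `τ = lim_{n → ∞} 𝔼[𝒯_n] / n`. -/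
def roundTripRate (prop : ℕ → PMF Bool) : ℝ := limUnder atTop (A.meanRestarts prop)

/-- The round trip rate of reversible parallel tempering. -/
def tauSEO : ℝ := A.roundTripRate seoProposal

/-- The round trip rate of non-reversible parallel tempering. -/
def tauDEO : ℝ := A.roundTripRate deoProposal

end PTSetup

/-- The limit `‖P_N‖ → 0`, over all parallel tempering algorithms for the model `M` that satisfy
efficient local exploration (uniformly in everything but the mesh size). -/
def meshToZero {X : Type*} [MeasurableSpace X] (M : TemperingModel X) : Filter (PTSetup M) :=
  comap PTSetup.mesh (𝓝 0) ⊓ 𝓟 {A | A.EfficientLocalExploration}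

end

/-!
The round trip rates are computed exactly for every schedule: with `E` the schedule inefficiency,
`τ_DEO = 1 / (2 + 2 E)` and `τ_SEO = 1 / (2 N + 4 + 2 E)`. The asymptotic statements then follow
from `Λ ≤ E ≤ Λ + C ‖P_N‖` and `1 ≤ N ‖P_N‖`.

*Barriers.* With respect to the product of two reference measures, the rejection probability is
half the `L¹` distance of the two exponentials `e^{-aV(x)-bV(y)}` and `e^{-bV(x)-aV(y)}`, divided
by `𝒵(a) 𝒵(b)`. Expanding to second order, with remainder dominated by the integrable function
`envelope`, gives `r(a, b) = |b - a| λ(t) + O((b - a)²)` uniformly for `t` between `a` and `b`,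
where `λ(t)` is half the mean absolute energy difference of two independent draws from `π^(t)`
(`exists_abs_rejProb_sub_le`). So the limits defining `λ` exist, `λ` is continuous, and
`E ≤ Λ + C ‖P_N‖` once the mesh is small. For the lower bound, Chebyshev's association inequality,
applied to an increasing function of the minimum and a decreasing function of the maximum of two
independent energies, shows that the swap function is submultiplicative, `s(a, b) ≤ s(a, c) s(c, b)`
(`swapProb_le_mul`). Hence `-log s` is superadditive, and bisecting an interval indefinitely gives
`∫_a^b λ ≤ -log s(a, b) ≤ r(a, b) / s(a, b)`, that is `Λ ≤ E` for every schedule.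

*Reduction to a finite chain.* Local exploration redraws all energies independently of the current
state, up to null sets of the stationary law. The law of the states stays absolutely continuous with
respect to the stationary law, because exchanging coordinates preserves its null sets; so these null
sets are never charged (`StatesAC.scan_comp`). Consequently the energies are at each time
independent of the permutation, the proposal type and the past of a machine
(`energyIndep_phaseLaw`), and the index of a machine moves like a Markov chain that crosses a
proposed edge with the mean acceptance probability of that edge (`EnergyIndep.integral_scan`).

*Round trips.* The alternating hitting times are encoded in a Boolean phase, true while a machine
climbs from the bottom to the top. If a function of phase, index and proposal type decreases by one
per step on average, does not change when a climb begins and gains `m` when a climb ends, then `m`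
times the expected number of climbs up to time `n` is `n + O(1)`, whatever the initial permutation
(`IsCyclePotential.tendsto_meanRestarts`); `m` is the mean duration of a round trip. Such potentials
are given by partial sums along the schedule, with `m = 2 (N + 1) (1 + E)` for DEO and
`m = 2 (N + 1) (N + 2 + E)` for SEO, and the `N + 1` machines together have rate `(N + 1) / m`.
-/

noncomputable section

/-! ### Annealed distributions and the swap function -/

namespace TemperingModel
variable {X : Type*} [MeasurableSpace X] (M : TemperingModel X)

instance isProbabilityMeasure_refMeasure : IsProbabilityMeasure M.refMeasure := by
  constructor
  rw [refMeasure, withDensity_apply _ MeasurableSet.univ, Measure.restrict_univ, M.lintegral_ref]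

lemma L_rpow (β : ℝ) (x : X) : M.L x ^ β = Real.exp (-β * M.V x) := by
  rw [V, Real.rpow_def_of_pos (show 0 < M.L x from div_pos (M.target_pos x) (M.ref_pos x))]
  ring_nf

lemma annealed_eq_withDensity (β : ℝ) :
    M.annealed β =
      M.refMeasure.withDensity fun x => ENNReal.ofReal (Real.exp (-β * M.V x) / M.Z β) := by
  have h := M.measurable_V
  rw [annealed, refMeasure, ← withDensity_mul _ M.measurable_ref.ennreal_ofReal (by fun_prop)]
  congr 1
  funext x
  rw [Pi.mul_apply, ← ENNReal.ofReal_mul (M.ref_pos x).le, L_rpow]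
  congr 1
  ring

lemma integral_refMeasure (f : X → ℝ) :
    ∫ x, f x ∂M.refMeasure = ∫ x, M.ref x * f x ∂M.base := by
  rw [refMeasure, integral_withDensity_eq_integral_toReal_smul M.measurable_ref.ennreal_ofReal
    (by simp)]
  simp [ENNReal.toReal_ofReal (M.ref_pos _).le]

lemma Z_eq_integral (β : ℝ) : M.Z β = ∫ x, Real.exp (-β * M.V x) ∂M.refMeasure := by
  rw [integral_refMeasure, Z]
  simp_rw [L_rpow, mul_comm]

lemma targetMeasure_eq_withDensity :
    M.targetMeasure =
      M.refMeasure.withDensity fun x => ENNReal.ofReal (Real.exp (-M.V x)) := by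
  have h := M.measurable_V
  rw [targetMeasure, refMeasure, ← withDensity_mul _ M.measurable_ref.ennreal_ofReal (by fun_prop)]
  congr 1
  funext x
  rw [Pi.mul_apply, ← ENNReal.ofReal_mul (M.ref_pos x).le]
  congr 1
  have := M.L_rpow 1 x
  rw [Real.rpow_one, neg_one_mul] at this
  rw [← this, L]
  field_simp [(M.ref_pos x).ne']

lemma integrable_exp_neg_V : Integrable (fun x => Real.exp (-M.V x)) M.refMeasure := by
  have h := M.measurable_V
  refine ⟨by fun_prop, ?_⟩
  have h1 : M.targetMeasure Set.univ = 1 := by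
    rw [targetMeasure, withDensity_apply _ MeasurableSet.univ, Measure.restrict_univ,
      M.lintegral_target]
  rw [targetMeasure_eq_withDensity, withDensity_apply _ MeasurableSet.univ,
    Measure.restrict_univ] at h1
  rw [hasFiniteIntegral_iff_ofReal (ae_of_all _ fun x => (Real.exp_pos _).le), h1]
  exact ENNReal.one_lt_top

lemma exp_neg_mul_le {β : ℝ} (hβ : β ∈ Set.Icc (0 : ℝ) 1) (v : ℝ) :
    Real.exp (-β * v) ≤ 1 + Real.exp (-v) := by
  obtain ⟨h0, h1⟩ := hβ
  rcases le_total 0 v with h | h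
  · have : Real.exp (-β * v) ≤ 1 := Real.exp_le_one_iff.2 (by nlinarith)
    linarith [Real.exp_pos (-v)]
  · have : Real.exp (-β * v) ≤ Real.exp (-v) := Real.exp_le_exp.2 (by nlinarith)
    linarith

lemma integrable_exp {β : ℝ} (hβ : β ∈ Set.Icc (0 : ℝ) 1) :
    Integrable (fun x => Real.exp (-β * M.V x)) M.refMeasure := by
  have h := M.measurable_V
  refine ((integrable_const (1 : ℝ)).add M.integrable_exp_neg_V).mono' (by fun_prop) ?_
  exact ae_of_all _ fun x => by
    rw [Real.norm_of_nonneg (Real.exp_pos _).le]; exact exp_neg_mul_le hβ _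

lemma Z_pos {β : ℝ} (hβ : β ∈ Set.Icc (0 : ℝ) 1) : 0 < M.Z β := by
  rw [Z_eq_integral]
  exact integral_exp_pos (M.integrable_exp hβ)

lemma isProbabilityMeasure_annealed {β : ℝ} (hβ : β ∈ Set.Icc (0 : ℝ) 1) :
    IsProbabilityMeasure (M.annealed β) := by
  constructor
  rw [annealed_eq_withDensity, withDensity_apply _ MeasurableSet.univ, Measure.restrict_univ,
    ← ofReal_integral_eq_lintegral_ofReal ((M.integrable_exp hβ).div_const _)
      (ae_of_all _ fun x => (div_pos (Real.exp_pos _) (M.Z_pos hβ)).le), integral_div,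
    ← Z_eq_integral, div_self (M.Z_pos hβ).ne', ENNReal.ofReal_one]

/-- The dominating function `(1 + V²)(1 + e^{-V})`: it bounds `V^k e^{-βV}` for `k ≤ 2` and
`β ∈ [0, 1]`. -/
def envelope (x : X) : ℝ := (1 + M.V x ^ 2) * (1 + Real.exp (-M.V x))

lemma one_le_envelope (x : X) : 1 ≤ M.envelope x := by
  unfold envelope
  nlinarith [sq_nonneg (M.V x), Real.exp_pos (-M.V x)]

lemma integrable_envelope (hV_ref : Integrable (fun x => M.V x ^ 3) M.refMeasure)
    (hV_target : Integrable (fun x => M.V x ^ 3) M.targetMeasure) :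
    Integrable M.envelope M.refMeasure := by
  have h := M.measurable_V
  have ht : Integrable (fun x => Real.exp (-M.V x) * M.V x ^ 3) M.refMeasure := by
    rw [targetMeasure_eq_withDensity, integrable_withDensity_iff_integrable_smul' (by fun_prop)
      (by simp)] at hV_target
    simpa [ENNReal.toReal_ofReal (Real.exp_pos _).le] using hV_target
  refine ((((integrable_const (2 : ℝ)).add hV_ref.norm).add
    (M.integrable_exp_neg_V.const_mul 2)).add ht.norm).mono' (by unfold envelope; fun_prop) ?_
  refine ae_of_all _ fun x => ?_
  have he := Real.exp_pos (-M.V x)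
  have h2 : M.V x ^ 2 ≤ 1 + |M.V x| ^ 3 := by
    rw [← sq_abs]
    have := abs_nonneg (M.V x)
    nlinarith [mul_nonneg this (sq_nonneg (|M.V x| - 1)), sq_nonneg (|M.V x| - 1)]
  simp only [Pi.add_apply, Real.norm_eq_abs, abs_mul, abs_pow, abs_of_pos he]
  rw [abs_of_nonneg (zero_le_one.trans (M.one_le_envelope x)), envelope]
  nlinarith

/-- Integrals against `π^(a) ⊗ π^(b)` as weighted integrals against `π₀ ⊗ π₀`. -/
lemma integral_annealed_prod {a b : ℝ} (ha : a ∈ Set.Icc (0 : ℝ) 1) (hb : b ∈ Set.Icc (0 : ℝ) 1)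
    (f : X × X → ℝ) :
    ∫ z, f z ∂((M.annealed a).prod (M.annealed b)) =
      (∫ z, Real.exp (-a * M.V z.1 - b * M.V z.2) * f z ∂(M.refMeasure.prod M.refMeasure)) /
        (M.Z a * M.Z b) := by
  have h := M.measurable_V
  rw [annealed_eq_withDensity, annealed_eq_withDensity,
    prod_withDensity (by fun_prop) (by fun_prop),
    integral_withDensity_eq_integral_toReal_smul (by fun_prop)
      (ae_of_all _ fun z => by simp [ENNReal.mul_lt_top]), ← integral_div]
  congr 1
  funext z
  rw [ENNReal.toReal_mul, ENNReal.toReal_ofReal (div_pos (Real.exp_pos _) (M.Z_pos ha)).le,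
    ENNReal.toReal_ofReal (div_pos (Real.exp_pos _) (M.Z_pos hb)).le, sub_eq_add_neg, Real.exp_add,
    smul_eq_mul, ← neg_mul]
  field_simp

lemma integrable_exp_prod {a b : ℝ} (ha : a ∈ Set.Icc (0 : ℝ) 1) (hb : b ∈ Set.Icc (0 : ℝ) 1) :
    Integrable (fun z : X × X => Real.exp (-a * M.V z.1 - b * M.V z.2))
      (M.refMeasure.prod M.refMeasure) := by
  refine ((M.integrable_exp ha).mul_prod (M.integrable_exp hb)).congr (ae_of_all _ fun z => ?_)
  simp only [← Real.exp_add]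
  congr 1
  ring

lemma integral_exp_prod (a b : ℝ) :
    ∫ z : X × X, Real.exp (-a * M.V z.1 - b * M.V z.2) ∂(M.refMeasure.prod M.refMeasure) =
      M.Z a * M.Z b := by
  rw [Z_eq_integral, Z_eq_integral, ← integral_prod_mul]
  congr 1
  funext z
  rw [← Real.exp_add]
  congr 1
  ring

lemma swapProb_eq {a b : ℝ} (ha : a ∈ Set.Icc (0 : ℝ) 1) (hb : b ∈ Set.Icc (0 : ℝ) 1) :
    M.swapProb a b =
      (∫ z : X × X, min (Real.exp (-a * M.V z.1 - b * M.V z.2))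
        (Real.exp (-b * M.V z.1 - a * M.V z.2)) ∂(M.refMeasure.prod M.refMeasure)) /
        (M.Z a * M.Z b) := by
  rw [swapProb, M.integral_annealed_prod ha hb]
  congr 2
  funext z
  rw [← Real.exp_add, ← Real.exp_monotone.map_min, ← min_add_add_left]
  congr 2 <;> ring

/-- Half the total variation distance of `π^(a) ⊗ π^(b)` and `π^(b) ⊗ π^(a)` is the rejection
probability. -/
lemma rejProb_eq {a b : ℝ} (ha : a ∈ Set.Icc (0 : ℝ) 1) (hb : b ∈ Set.Icc (0 : ℝ) 1) :
    M.rejProb a b =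
      (∫ z : X × X, |Real.exp (-a * M.V z.1 - b * M.V z.2) -
        Real.exp (-b * M.V z.1 - a * M.V z.2)| / 2 ∂(M.refMeasure.prod M.refMeasure)) /
        (M.Z a * M.Z b) := by
  have hab := M.integrable_exp_prod ha hb
  have hba := M.integrable_exp_prod hb ha
  have hZ : 0 < M.Z a * M.Z b := mul_pos (M.Z_pos ha) (M.Z_pos hb)
  rw [rejProb, M.swapProb_eq ha hb, eq_div_iff hZ.ne', sub_mul, one_mul, div_mul_cancel₀ _ hZ.ne']
  have h1 : M.Z a * M.Z b = ∫ z : X × X, (Real.exp (-a * M.V z.1 - b * M.V z.2) +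
      Real.exp (-b * M.V z.1 - a * M.V z.2)) / 2 ∂(M.refMeasure.prod M.refMeasure) := by
    rw [integral_div, integral_add hab hba, integral_exp_prod, integral_exp_prod]
    ring
  rw [h1]
  refine (integral_sub ((hab.add hba).div_const 2) (hab.inf hba)).symm.trans ?_
  congr 1
  funext z
  simp only [Pi.add_apply, Pi.inf_apply]
  rw [inf_eq_half_smul_add_sub_abs_sub' ℝ, smul_eq_mul, abs_sub_comm]
  ring

lemma swapProb_pos {a b : ℝ} (ha : a ∈ Set.Icc (0 : ℝ) 1) (hb : b ∈ Set.Icc (0 : ℝ) 1) :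
    0 < M.swapProb a b := by
  have := M.isProbabilityMeasure_annealed ha
  have := M.isProbabilityMeasure_annealed hb
  have h := M.measurable_V
  refine integral_exp_pos ?_
  refine (integrable_const (1 : ℝ)).mono' (by fun_prop) (ae_of_all _ fun z => ?_)
  rw [Real.norm_of_nonneg (Real.exp_pos _).le]
  exact Real.exp_le_one_iff.2 (min_le_left _ _)

lemma rejProb_nonneg {a b : ℝ} (ha : a ∈ Set.Icc (0 : ℝ) 1) (hb : b ∈ Set.Icc (0 : ℝ) 1) :
    0 ≤ M.rejProb a b := by
  rw [M.rejProb_eq ha hb]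
  exact div_nonneg (integral_nonneg fun z => by positivity)
    (mul_pos (M.Z_pos ha) (M.Z_pos hb)).le

end TemperingModel

/-! ### Second-order expansion of the rejection probability -/

lemma abs_exp_sub_one_sub_le (x : ℝ) : |Real.exp x - 1 - x| ≤ x ^ 2 * (1 + Real.exp x) := by
  have h0 := Real.add_one_le_exp x
  have h1 := Real.add_one_le_exp (-x)
  have hp := Real.exp_pos x
  have h2 : Real.exp x - 1 ≤ x * Real.exp x := by
    have : Real.exp x * Real.exp (-x) = 1 := by rw [← Real.exp_add]; simp
    nlinarith
  rw [abs_of_nonneg (by linarith)]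
  rcases le_total 0 x with h | h
  · nlinarith [mul_le_mul_of_nonneg_left h2 h, sq_nonneg x]
  · nlinarith [mul_le_mul_of_nonpos_left h0 h, mul_nonneg (sq_nonneg x) hp.le]

lemma abs_exp_sub_exp_le (x y : ℝ) :
    |Real.exp x - Real.exp y| ≤ |x - y| * (Real.exp x + Real.exp y) := by
  wlog h : y ≤ x generalizing x y
  · rw [abs_sub_comm, abs_sub_comm x, add_comm]
    exact this y x (le_of_not_ge h)
  rw [abs_of_nonneg (sub_nonneg.2 (Real.exp_le_exp.2 h)), abs_of_nonneg (sub_nonneg.2 h)]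
  have h1 := Real.add_one_le_exp (y - x)
  have h2 : Real.exp x * Real.exp (y - x) = Real.exp y := by rw [← Real.exp_add]; ring_nf
  have := mul_le_mul_of_nonneg_left h1 (Real.exp_pos x).le
  nlinarith [mul_nonneg (sub_nonneg.2 h) (Real.exp_pos y).le]

namespace TemperingModel

lemma exp_prod_le {a b : ℝ} (ha : a ∈ Set.Icc (0 : ℝ) 1) (hb : b ∈ Set.Icc (0 : ℝ) 1) (u w : ℝ) :
    Real.exp (-a * u - b * w) ≤ (1 + Real.exp (-u)) * (1 + Real.exp (-w)) := by
  rw [sub_eq_add_neg, ← neg_mul, Real.exp_add]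
  have h1 := exp_neg_mul_le ha u
  have h2 := exp_neg_mul_le hb w
  gcongr

lemma mul_exp_le {a b u w q : ℝ} (ha : a ∈ Set.Icc (0 : ℝ) 1) (hb : b ∈ Set.Icc (0 : ℝ) 1)
    (hq : q ≤ (1 + u ^ 2) * (1 + w ^ 2)) :
    q * Real.exp (-a * u - b * w) ≤
      ((1 + u ^ 2) * (1 + Real.exp (-u))) * ((1 + w ^ 2) * (1 + Real.exp (-w))) := by
  have h1 := exp_prod_le ha hb u w
  calc q * Real.exp (-a * u - b * w)
      ≤ ((1 + u ^ 2) * (1 + w ^ 2)) * ((1 + Real.exp (-u)) * (1 + Real.exp (-w))) := by gcongr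
    _ = _ := by ring

/-- Second-order expansion of the integrand of the rejection probability. -/
lemma abs_exp_diff_sub_le {a b : ℝ} (ha : a ∈ Set.Icc (0 : ℝ) 1) (hb : b ∈ Set.Icc (0 : ℝ) 1)
    (u w : ℝ) :
    |(|Real.exp (-a * u - b * w) - Real.exp (-b * u - a * w)| / 2 -
        |b - a| * (|u - w| / 2 * Real.exp (-a * u - a * w)))| ≤
      (b - a) ^ 2 *
        (((1 + u ^ 2) * (1 + Real.exp (-u))) * ((1 + w ^ 2) * (1 + Real.exp (-w)))) := by
  set δ := b - a with hδ
  set E := Real.exp (-a * u - a * w) with hE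
  have hEp : 0 < E := Real.exp_pos _
  have e1 : Real.exp (-a * u - b * w) = E * Real.exp (-δ * w) := by
    rw [hE, ← Real.exp_add, hδ]; ring_nf
  have e2 : Real.exp (-b * u - a * w) = E * Real.exp (-δ * u) := by
    rw [hE, ← Real.exp_add, hδ]; ring_nf
  have h3 : |δ| * (|u - w| / 2 * E) = |E * (δ * (u - w))| / 2 := by
    rw [abs_mul, abs_mul, abs_of_pos hEp]; ring
  rw [h3, ← sub_div, abs_div, abs_two, div_le_iff₀ two_pos]
  refine (abs_abs_sub_abs_le_abs_sub _ _).trans ?_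
  have h4 : Real.exp (-a * u - b * w) - Real.exp (-b * u - a * w) - E * (δ * (u - w)) =
      E * (Real.exp (-δ * w) - 1 - (-δ * w)) - E * (Real.exp (-δ * u) - 1 - (-δ * u)) := by
    rw [e1, e2]; ring
  rw [h4]
  refine (abs_sub _ _).trans ?_
  rw [abs_mul, abs_mul, abs_of_pos hEp]
  have h5 := mul_le_mul_of_nonneg_left (abs_exp_sub_one_sub_le (-δ * w)) hEp.le
  have h6 := mul_le_mul_of_nonneg_left (abs_exp_sub_one_sub_le (-δ * u)) hEp.le
  refine (add_le_add h5 h6).trans ?_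
  have q1 : u ^ 2 + w ^ 2 ≤ (1 + u ^ 2) * (1 + w ^ 2) := by nlinarith [sq_nonneg (u * w)]
  have b1 := mul_exp_le ha ha q1
  rw [← hE] at b1
  have b4 : u ^ 2 * (E * Real.exp (-δ * u)) + w ^ 2 * (E * Real.exp (-δ * w)) ≤
      ((1 + u ^ 2) * (1 + Real.exp (-u))) * ((1 + w ^ 2) * (1 + Real.exp (-w))) := by
    rw [← e1, ← e2]
    have x1 := exp_prod_le hb ha u w
    have x2 := exp_prod_le ha hb u w
    calc _ ≤ u ^ 2 * ((1 + Real.exp (-u)) * (1 + Real.exp (-w))) +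
          w ^ 2 * ((1 + Real.exp (-u)) * (1 + Real.exp (-w))) := by gcongr
      _ = (u ^ 2 + w ^ 2) * ((1 + Real.exp (-u)) * (1 + Real.exp (-w))) := by ring
      _ ≤ ((1 + u ^ 2) * (1 + w ^ 2)) * ((1 + Real.exp (-u)) * (1 + Real.exp (-w))) := by gcongr
      _ = _ := by ring
  nlinarith [mul_le_mul_of_nonneg_left b1 (sq_nonneg δ), mul_le_mul_of_nonneg_left b4 (sq_nonneg δ)]

lemma abs_barrier_integrand_sub_le {a t : ℝ} (ha : a ∈ Set.Icc (0 : ℝ) 1)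
    (ht : t ∈ Set.Icc (0 : ℝ) 1) (u w : ℝ) :
    |(|u - w| / 2 * Real.exp (-a * u - a * w) - |u - w| / 2 * Real.exp (-t * u - t * w))| ≤
      |a - t| * (((1 + u ^ 2) * (1 + Real.exp (-u))) * ((1 + w ^ 2) * (1 + Real.exp (-w)))) := by
  rw [← mul_sub, abs_mul, abs_of_nonneg (by positivity : 0 ≤ |u - w| / 2)]
  have h1 := abs_exp_sub_exp_le (-a * u - a * w) (-t * u - t * w)
  have h2 : |(-a * u - a * w) - (-t * u - t * w)| = |a - t| * |u + w| := by
    rw [← abs_mul, ← abs_neg]; congr 1; ring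
  rw [h2] at h1
  have q1 : |u - w| * |u + w| ≤ (1 + u ^ 2) * (1 + w ^ 2) := by
    rw [← abs_mul, abs_le]
    constructor <;> nlinarith [sq_nonneg (u * w), sq_nonneg u, sq_nonneg w]
  have b1 := mul_exp_le ha ha q1
  have b2 := mul_exp_le ht ht q1
  calc _ ≤ |u - w| / 2 * (|a - t| * |u + w| * (Real.exp (-a * u - a * w) +
        Real.exp (-t * u - t * w))) := by gcongr
    _ = |a - t| * ((|u - w| * |u + w| * Real.exp (-a * u - a * w) +
        |u - w| * |u + w| * Real.exp (-t * u - t * w)) / 2) := by ring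
    _ ≤ _ := by gcongr; linarith

lemma barrier_integrand_le {a : ℝ} (ha : a ∈ Set.Icc (0 : ℝ) 1) (u w : ℝ) :
    |u - w| / 2 * Real.exp (-a * u - a * w) ≤
      ((1 + u ^ 2) * (1 + Real.exp (-u))) * ((1 + w ^ 2) * (1 + Real.exp (-w))) := by
  refine mul_exp_le ha ha ?_
  rw [div_le_iff₀ two_pos, abs_le]
  constructor <;> nlinarith [sq_nonneg (u * w), sq_nonneg (u - 1), sq_nonneg (w - 1),
    sq_nonneg (u + 1), sq_nonneg (w + 1)]

variable {X : Type*} [MeasurableSpace X] (M : TemperingModel X)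

/-- The numerator `½ ∬ |V(x) - V(y)| e^{-t (V(x) + V(y))} π₀(dx) π₀(dy)` of the local barrier. -/
def barrierNumerator (t : ℝ) : ℝ :=
  ∫ z : X × X, |M.V z.1 - M.V z.2| / 2 * Real.exp (-t * M.V z.1 - t * M.V z.2)
    ∂(M.refMeasure.prod M.refMeasure)

/-- Half the mean absolute difference of the energies of two independent draws from `π^(t)`. -/
def meanAbsDiff (t : ℝ) : ℝ := M.barrierNumerator t / M.Z t ^ 2

variable {M}

lemma abs_Z_sub_le (hD : Integrable M.envelope M.refMeasure) {a b : ℝ}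
    (ha : a ∈ Set.Icc (0 : ℝ) 1) (hb : b ∈ Set.Icc (0 : ℝ) 1) :
    |M.Z a - M.Z b| ≤ 2 * (∫ x, M.envelope x ∂M.refMeasure) * |a - b| := by
  rw [Z_eq_integral, Z_eq_integral, ← integral_sub (M.integrable_exp ha) (M.integrable_exp hb),
    ← Real.norm_eq_abs, mul_assoc, mul_comm _ |a - b|, ← mul_assoc, ← integral_const_mul]
  refine norm_integral_le_of_norm_le (hD.const_mul _) (ae_of_all _ fun x => ?_)
  rw [Real.norm_eq_abs]
  refine (abs_exp_sub_exp_le _ _).trans ?_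
  have h1 : |-a * M.V x - -b * M.V x| = |a - b| * |M.V x| := by
    rw [← abs_mul, ← abs_neg]; congr 1; ring
  rw [h1]
  have h2 : |M.V x| ≤ 1 + M.V x ^ 2 := by
    rw [← sq_abs]; nlinarith [sq_nonneg (|M.V x| - 1)]
  have h3 := exp_neg_mul_le ha (M.V x)
  have h4 := exp_neg_mul_le hb (M.V x)
  calc _ ≤ |a - b| * (1 + M.V x ^ 2) *
        ((1 + Real.exp (-M.V x)) + (1 + Real.exp (-M.V x))) := by gcongr
    _ = _ := by unfold envelope; ring

lemma Z_le (hD : Integrable M.envelope M.refMeasure) {a : ℝ} (ha : a ∈ Set.Icc (0 : ℝ) 1) :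
    M.Z a ≤ ∫ x, M.envelope x ∂M.refMeasure := by
  rw [Z_eq_integral]
  refine integral_mono (M.integrable_exp ha) hD fun x => (exp_neg_mul_le ha (M.V x)).trans ?_
  unfold envelope
  nlinarith [sq_nonneg (M.V x), Real.exp_pos (-M.V x)]

lemma exists_le_Z (hD : Integrable M.envelope M.refMeasure) :
    ∃ c, 0 < c ∧ ∀ t ∈ Set.Icc (0 : ℝ) 1, c ≤ M.Z t := by
  have hc : ContinuousOn M.Z (Set.Icc 0 1) := by
    refine (LipschitzOnWith.of_dist_le_mul
      (K := (2 * ∫ x, M.envelope x ∂M.refMeasure).toNNReal) fun a ha b hb => ?_).continuousOn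
    rw [Real.coe_toNNReal, Real.dist_eq, Real.dist_eq]
    · exact abs_Z_sub_le hD ha hb
    · exact mul_nonneg two_pos.le
        (integral_nonneg fun x => zero_le_one.trans (M.one_le_envelope x))
  obtain ⟨t, ht, hmin⟩ := isCompact_Icc.exists_isMinOn ⟨0, by simp⟩ hc
  exact ⟨M.Z t, M.Z_pos ht, fun s hs => hmin hs⟩

lemma integrable_envelope_prod (hD : Integrable M.envelope M.refMeasure) :
    Integrable (fun z : X × X => M.envelope z.1 * M.envelope z.2)
      (M.refMeasure.prod M.refMeasure) := hD.mul_prod hD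

lemma integrable_barrier_integrand (hD : Integrable M.envelope M.refMeasure) {t : ℝ}
    (ht : t ∈ Set.Icc (0 : ℝ) 1) :
    Integrable (fun z : X × X => |M.V z.1 - M.V z.2| / 2 *
      Real.exp (-t * M.V z.1 - t * M.V z.2)) (M.refMeasure.prod M.refMeasure) := by
  have h := M.measurable_V
  refine (integrable_envelope_prod hD).mono' (by fun_prop) (ae_of_all _ fun z => ?_)
  rw [Real.norm_of_nonneg (by positivity)]
  exact barrier_integrand_le ht _ _

lemma barrierNumerator_nonneg (t : ℝ) : 0 ≤ M.barrierNumerator t :=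
  integral_nonneg fun z => by positivity

lemma meanAbsDiff_nonneg (t : ℝ) : 0 ≤ M.meanAbsDiff t :=
  div_nonneg (barrierNumerator_nonneg t) (sq_nonneg _)

/-- The rejection probability is, to second order and uniformly, the increment times the barrier at
any point nearby. -/
lemma exists_abs_rejProb_sub_le (hD : Integrable M.envelope M.refMeasure) :
    ∃ C, 0 ≤ C ∧ ∀ a ∈ Set.Icc (0 : ℝ) 1, ∀ b ∈ Set.Icc (0 : ℝ) 1, ∀ t ∈ Set.Icc (0 : ℝ) 1,
      |t - a| ≤ |b - a| → |M.rejProb a b - |b - a| * M.meanAbsDiff t| ≤ C * (b - a) ^ 2 := by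
  obtain ⟨c, hc, hcZ⟩ := exists_le_Z hD
  set K₁ := ∫ x, M.envelope x ∂M.refMeasure with hK₁
  set K := ∫ z : X × X, M.envelope z.1 * M.envelope z.2 ∂(M.refMeasure.prod M.refMeasure) with hK
  have hK₁0 : 0 ≤ K₁ := integral_nonneg fun x => zero_le_one.trans (M.one_le_envelope x)
  have hK0 : 0 ≤ K := integral_nonneg fun z => mul_nonneg
    (zero_le_one.trans (M.one_le_envelope _)) (zero_le_one.trans (M.one_le_envelope _))
  have hDD := integrable_envelope_prod hD
  refine ⟨2 * K / c ^ 2 + K * (6 * K₁ ^ 2) / c ^ 4, by positivity, fun a ha b hb t ht hta => ?_⟩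
  have hab := M.integrable_exp_prod ha hb
  have hba := M.integrable_exp_prod hb ha
  rw [M.rejProb_eq ha hb]
  set J := ∫ z : X × X, |Real.exp (-a * M.V z.1 - b * M.V z.2) -
        Real.exp (-b * M.V z.1 - a * M.V z.2)| / 2 ∂(M.refMeasure.prod M.refMeasure) with hJ
  have h1 : |J - |b - a| * M.barrierNumerator a| ≤ (b - a) ^ 2 * K := by
    have hJi : Integrable (fun z : X × X => |Real.exp (-a * M.V z.1 - b * M.V z.2) -
        Real.exp (-b * M.V z.1 - a * M.V z.2)| / 2) (M.refMeasure.prod M.refMeasure) :=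
      (hab.sub hba).abs.div_const 2
    rw [hJ, barrierNumerator, ← integral_const_mul, ← integral_sub hJi
      ((integrable_barrier_integrand hD ha).const_mul _), hK, ← integral_const_mul,
      ← Real.norm_eq_abs]
    exact norm_integral_le_of_norm_le (hDD.const_mul _)
      (ae_of_all _ fun z => abs_exp_diff_sub_le ha hb _ _)
  have h2 : |M.barrierNumerator a - M.barrierNumerator t| ≤ |a - t| * K := by
    rw [barrierNumerator, barrierNumerator, ← integral_sub (integrable_barrier_integrand hD ha)
      (integrable_barrier_integrand hD ht), hK, ← integral_const_mul, ← Real.norm_eq_abs]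
    exact norm_integral_le_of_norm_le (hDD.const_mul _)
      (ae_of_all _ fun z => abs_barrier_integrand_sub_le ha ht _ _)
  have h3 : M.barrierNumerator t ≤ K :=
    integral_mono (integrable_barrier_integrand hD ht) hDD fun z => barrier_integrand_le ht _ _
  have hH0 := M.barrierNumerator_nonneg t
  have hδ : |b - a| * |b - a| = (b - a) ^ 2 := by rw [← sq, sq_abs]
  rw [abs_sub_comm] at hta
  -- the numerators agree up to second order
  have h4 : |J - |b - a| * M.barrierNumerator t| ≤ (b - a) ^ 2 * (2 * K) := by
    calc _ = |(J - |b - a| * M.barrierNumerator a) +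
          |b - a| * (M.barrierNumerator a - M.barrierNumerator t)| := by ring_nf
      _ ≤ (b - a) ^ 2 * K + |b - a| * (|b - a| * K) := by
          refine (abs_add_le _ _).trans (add_le_add h1 ?_)
          rw [abs_mul, abs_abs]
          gcongr
          exact h2.trans (by gcongr)
      _ = _ := by rw [← mul_assoc, hδ]; ring
  -- the denominators agree up to first order
  have hZa := M.Z_pos ha
  have hZb := M.Z_pos hb
  have hZt := M.Z_pos ht
  have h5 : |M.Z t ^ 2 - M.Z a * M.Z b| ≤ |b - a| * (6 * K₁ ^ 2) := by
    have hta' : |t - a| ≤ |b - a| := by rwa [abs_sub_comm]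
    have htb : |t - b| ≤ 2 * |b - a| := by
      have := abs_sub_le t a b
      rw [abs_sub_comm a b] at this
      linarith
    calc _ = |(M.Z t - M.Z a) * M.Z t + M.Z a * (M.Z t - M.Z b)| := by ring_nf
      _ ≤ (2 * K₁ * |b - a|) * K₁ + K₁ * (2 * K₁ * (2 * |b - a|)) := by
          refine (abs_add_le _ _).trans ?_
          rw [abs_mul, abs_mul, abs_of_pos hZt, abs_of_pos hZa]
          have y1 := (abs_Z_sub_le hD ht ha).trans (mul_le_mul_of_nonneg_left hta' (by positivity))
          have y2 := (abs_Z_sub_le hD ht hb).trans (mul_le_mul_of_nonneg_left htb (by positivity))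
          have y3 := Z_le hD ht
          have y4 := Z_le hD ha
          gcongr
      _ = _ := by ring
  have hZab : c ^ 2 ≤ M.Z a * M.Z b := by
    rw [sq]; exact mul_le_mul (hcZ a ha) (hcZ b hb) hc.le hZa.le
  have hZtt : c ^ 2 ≤ M.Z t ^ 2 := by gcongr; exact hcZ t ht
  have hid : J / (M.Z a * M.Z b) - |b - a| * M.meanAbsDiff t =
      (J - |b - a| * M.barrierNumerator t) / (M.Z a * M.Z b) +
      |b - a| * M.barrierNumerator t * (M.Z t ^ 2 - M.Z a * M.Z b) /
        ((M.Z a * M.Z b) * M.Z t ^ 2) := by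
    rw [meanAbsDiff]
    field_simp
    ring
  rw [hid]
  refine (abs_add_le _ _).trans ?_
  rw [abs_div, abs_div, abs_of_pos (mul_pos hZa hZb), abs_of_pos (by positivity :
    0 < M.Z a * M.Z b * M.Z t ^ 2), abs_mul, abs_mul, abs_abs, abs_of_nonneg hH0]
  calc _ ≤ (b - a) ^ 2 * (2 * K) / c ^ 2 +
          |b - a| * K * (|b - a| * (6 * K₁ ^ 2)) / (c ^ 2 * c ^ 2) := by
        gcongr
    _ = (b - a) ^ 2 * (2 * K) / c ^ 2 +
          (|b - a| * |b - a|) * K * (6 * K₁ ^ 2) / (c ^ 2 * c ^ 2) := by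
        ring
    _ = _ := by rw [hδ]; ring

lemma incrementFilter_neBot {β : ℝ} (hβ : β ∈ Set.Icc (0 : ℝ) 1) : (incrementFilter β).NeBot := by
  rw [incrementFilter, ← mem_closure_iff_nhdsWithin_neBot, Metric.mem_closure_iff]
  intro ε hε
  obtain ⟨h0, h1⟩ := hβ
  have hm : 0 < min (ε / 2) (1 / 2) := by positivity
  have hm1 := min_le_left (ε / 2) (1 / 2 : ℝ)
  have hm2 := min_le_right (ε / 2) (1 / 2 : ℝ)
  rcases le_total β (1 / 2) with h | h
  · refine ⟨min (ε / 2) (1 / 2), ⟨hm.ne', by linarith, by linarith⟩, ?_⟩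
    rw [dist_zero_left, Real.norm_of_nonneg hm.le]
    linarith
  · refine ⟨-min (ε / 2) (1 / 2), ⟨neg_ne_zero.2 hm.ne', by linarith, by linarith⟩, ?_⟩
    rw [dist_zero_left, norm_neg, Real.norm_of_nonneg hm.le]
    linarith

lemma tendsto_rejProb_div (hD : Integrable M.envelope M.refMeasure) {β : ℝ}
    (hβ : β ∈ Set.Icc (0 : ℝ) 1) :
    Tendsto (fun δ => M.rejProb β (β + δ) / |δ|) (incrementFilter β) (𝓝 (M.meanAbsDiff β)) := by
  obtain ⟨C, hC, h⟩ := exists_abs_rejProb_sub_le hD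
  have h0 : Tendsto (fun δ : ℝ => C * |δ|) (incrementFilter β) (𝓝 0) := by
    have : Tendsto (fun δ : ℝ => C * |δ|) (𝓝 0) (𝓝 (C * |0|)) := by
      exact (Continuous.tendsto (by fun_prop) 0)
    simp only [abs_zero, mul_zero] at this
    exact this.mono_left nhdsWithin_le_nhds
  rw [tendsto_iff_norm_sub_tendsto_zero]
  refine squeeze_zero' (Eventually.of_forall fun δ => norm_nonneg _) ?_ h0
  filter_upwards [self_mem_nhdsWithin] with δ hδ
  have h1 := h β hβ (β + δ) hδ.2 β hβ (by simp)
  rw [add_sub_cancel_left] at h1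
  have hp : 0 < |δ| := abs_pos.2 hδ.1
  have h2 : M.rejProb β (β + δ) / |δ| - M.meanAbsDiff β =
      (M.rejProb β (β + δ) - |δ| * M.meanAbsDiff β) / |δ| := by field_simp
  rw [h2, Real.norm_eq_abs, abs_div, abs_abs, div_le_iff₀ hp, mul_assoc, ← sq, sq_abs]
  exact h1

lemma localBarrier_eq (hD : Integrable M.envelope M.refMeasure) {β : ℝ}
    (hβ : β ∈ Set.Icc (0 : ℝ) 1) : M.localBarrier β = M.meanAbsDiff β :=
  have := incrementFilter_neBot hβ
  (tendsto_rejProb_div hD hβ).limUnder_eq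

lemma continuousOn_meanAbsDiff (hD : Integrable M.envelope M.refMeasure) :
    ContinuousOn M.meanAbsDiff (Set.Icc 0 1) := by
  obtain ⟨C, hC, h⟩ := exists_abs_rejProb_sub_le hD
  refine (LipschitzOnWith.of_dist_le_mul (K := (2 * C).toNNReal) fun a ha b hb => ?_).continuousOn
  rw [Real.coe_toNNReal _ (by positivity), Real.dist_eq, Real.dist_eq]
  rcases eq_or_ne a b with rfl | hab
  · simp
  have h1 := h a ha b hb a ha (by simp)
  have h2 := h a ha b hb b hb le_rfl
  have hp : 0 < |b - a| := abs_pos.2 (sub_ne_zero.2 hab.symm)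
  rw [abs_sub_comm a b]
  refine le_of_mul_le_mul_left ?_ hp
  calc |b - a| * |M.meanAbsDiff a - M.meanAbsDiff b|
      = |(M.rejProb a b - |b - a| * M.meanAbsDiff b) -
          (M.rejProb a b - |b - a| * M.meanAbsDiff a)| := by
        rw [sub_sub_sub_cancel_left, ← mul_sub, abs_mul, abs_abs]
    _ ≤ C * (b - a) ^ 2 + C * (b - a) ^ 2 := (abs_sub _ _).trans (add_le_add h2 h1)
    _ = |b - a| * (2 * C * |b - a|) := by rw [← sq_abs (b - a)]; ring

lemma intervalIntegrable_meanAbsDiff (hD : Integrable M.envelope M.refMeasure) {a b : ℝ}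
    (ha : a ∈ Set.Icc (0 : ℝ) 1) (hb : b ∈ Set.Icc (0 : ℝ) 1) :
    IntervalIntegrable M.meanAbsDiff volume a b :=
  ((continuousOn_meanAbsDiff hD).mono
    (Set.OrdConnected.uIcc_subset inferInstance ha hb)).intervalIntegrable

lemma exists_abs_rejProb_sub_integral_le (hD : Integrable M.envelope M.refMeasure) :
    ∃ C, 0 ≤ C ∧ ∀ a ∈ Set.Icc (0 : ℝ) 1, ∀ b ∈ Set.Icc (0 : ℝ) 1, a ≤ b →
      |M.rejProb a b - ∫ t in a..b, M.meanAbsDiff t| ≤ C * (b - a) ^ 2 := by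
  obtain ⟨C, hC, h⟩ := exists_abs_rejProb_sub_le hD
  refine ⟨C, hC, fun a ha b hb hab => ?_⟩
  rcases hab.eq_or_lt with rfl | hlt
  · have := h a ha a ha a ha le_rfl
    simpa using this
  have hp : 0 < b - a := sub_pos.2 hlt
  have h1 : M.rejProb a b - ∫ t in a..b, M.meanAbsDiff t =
      ∫ t in a..b, (M.rejProb a b / (b - a) - M.meanAbsDiff t) := by
    rw [intervalIntegral.integral_sub (by simp) (intervalIntegrable_meanAbsDiff hD ha hb),
      intervalIntegral.integral_const, smul_eq_mul, mul_div_cancel₀ _ hp.ne']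
  rw [h1, ← Real.norm_eq_abs]
  refine (intervalIntegral.norm_integral_le_of_norm_le_const (C := C * (b - a))
    fun t ht => ?_).trans_eq ?_
  · rw [Set.uIoc_of_le hab] at ht
    have htm : t ∈ Set.Icc (0 : ℝ) 1 := ⟨ha.1.trans ht.1.le, ht.2.trans hb.2⟩
    have h2 := h a ha b hb t htm (by
      rw [abs_of_pos hp, abs_of_pos (sub_pos.2 ht.1)]; linarith [ht.2])
    rw [abs_of_pos hp] at h2
    have h3 : M.rejProb a b / (b - a) - M.meanAbsDiff t =
      (M.rejProb a b - (b - a) * M.meanAbsDiff t) / (b - a) := by field_simp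
    rw [h3, Real.norm_eq_abs, abs_div, abs_of_pos hp, div_le_iff₀ hp, mul_assoc, ← sq]
    exact h2
  · rw [abs_of_pos hp]; ring

end TemperingModel

/-! ### Association, submultiplicativity and the schedule inefficiency -/

/-- Chebyshev's integral inequality: oppositely ordered functions are negatively correlated. -/
lemma integral_mul_le_mul_integral_of_opposite {X : Type*} [MeasurableSpace X] {ν : Measure X}
    [IsProbabilityMeasure ν] {f g : X → ℝ} (hf : Integrable f ν) (hg : Integrable g ν)
    (hfg : Integrable (fun x => f x * g x) ν) (h : ∀ x y, (f x - f y) * (g x - g y) ≤ 0) :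
    ∫ x, f x * g x ∂ν ≤ (∫ x, f x ∂ν) * ∫ x, g x ∂ν := by
  have i1 : Integrable (fun z : X × X => f z.1 * g z.1) (ν.prod ν) := hfg.comp_fst ν
  have i2 : Integrable (fun z : X × X => f z.2 * g z.2) (ν.prod ν) := hfg.comp_snd ν
  have i3 : Integrable (fun z : X × X => f z.1 * g z.2) (ν.prod ν) := hf.mul_prod hg
  have i4 : Integrable (fun z : X × X => g z.1 * f z.2) (ν.prod ν) := hg.mul_prod hf
  have h1 : ∫ z : X × X, (f z.1 - f z.2) * (g z.1 - g z.2) ∂(ν.prod ν) ≤ 0 :=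
    integral_nonpos fun z => h z.1 z.2
  have h2 : ∀ z : X × X, (f z.1 - f z.2) * (g z.1 - g z.2) =
      (f z.1 * g z.1 + f z.2 * g z.2) - (f z.1 * g z.2 + g z.1 * f z.2) := fun z => by ring
  have j12 : Integrable (fun z : X × X => f z.1 * g z.1 + f z.2 * g z.2) (ν.prod ν) := i1.add i2
  have j34 : Integrable (fun z : X × X => f z.1 * g z.2 + g z.1 * f z.2) (ν.prod ν) := i3.add i4
  simp_rw [h2] at h1
  rw [integral_sub j12 j34, integral_add i1 i2, integral_add i3 i4,
    integral_prod_mul, integral_prod_mul, integral_fun_fst (fun x => f x * g x),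
    integral_fun_snd (fun x => f x * g x)] at h1
  simp only [probReal_univ, one_smul] at h1
  linarith [mul_comm (∫ x, f x ∂ν) (∫ x, g x ∂ν)]

/-- The minimum and the maximum of two independent copies are associated. -/
lemma integral_exp_min_max_le {X : Type*} [MeasurableSpace X] {ν : Measure X}
    [IsProbabilityMeasure ν] {V : X → ℝ} (hV : Measurable V) {p q : ℝ} (hp : 0 ≤ p) (hq : 0 ≤ q)
    (ip : Integrable (fun x => Real.exp (p * V x)) ν)
    (iq : Integrable (fun x => Real.exp (-q * V x)) ν) :
    ∫ z : X × X, Real.exp (p * min (V z.1) (V z.2) - q * max (V z.1) (V z.2)) ∂(ν.prod ν) ≤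
      (∫ z : X × X, Real.exp (p * min (V z.1) (V z.2)) ∂(ν.prod ν)) *
        ∫ z : X × X, Real.exp (-q * max (V z.1) (V z.2)) ∂(ν.prod ν) := by
  set F : X × X → ℝ := fun z => Real.exp (p * min (V z.1) (V z.2)) with hF
  set G : X × X → ℝ := fun z => Real.exp (-q * max (V z.1) (V z.2)) with hG
  have mF : Measurable F := by fun_prop
  have mG : Measurable G := by fun_prop
  have F0 : ∀ z, 0 < F z := fun z => Real.exp_pos _
  have G0 : ∀ z, 0 < G z := fun z => Real.exp_pos _
  have F1 : ∀ z, F z ≤ Real.exp (p * V z.1) := fun z =>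
    Real.exp_le_exp.2 (mul_le_mul_of_nonneg_left (min_le_left _ _) hp)
  have F2 : ∀ z, F z ≤ Real.exp (p * V z.2) := fun z =>
    Real.exp_le_exp.2 (mul_le_mul_of_nonneg_left (min_le_right _ _) hp)
  have G1 : ∀ z, G z ≤ Real.exp (-q * V z.1) := fun z =>
    Real.exp_le_exp.2 (mul_le_mul_of_nonpos_left (le_max_left _ _) (neg_nonpos.2 hq))
  have G2 : ∀ z, G z ≤ Real.exp (-q * V z.2) := fun z =>
    Real.exp_le_exp.2 (mul_le_mul_of_nonpos_left (le_max_right _ _) (neg_nonpos.2 hq))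
  have hFG : ∀ z : X × X, Real.exp (p * min (V z.1) (V z.2) - q * max (V z.1) (V z.2)) =
      F z * G z := fun z => by rw [hF, hG, ← Real.exp_add]; ring_nf
  simp_rw [hFG]
  have iF : Integrable F (ν.prod ν) := (ip.comp_fst ν).mono' mF.aestronglyMeasurable
    (ae_of_all _ fun z => by rw [Real.norm_of_nonneg (F0 z).le]; exact F1 z)
  have iG : Integrable G (ν.prod ν) := (iq.comp_fst ν).mono' mG.aestronglyMeasurable
    (ae_of_all _ fun z => by rw [Real.norm_of_nonneg (G0 z).le]; exact G1 z)
  have iFG : Integrable (fun z => F z * G z) (ν.prod ν) :=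
    (ip.mul_prod iq).mono' (mF.mul mG).aestronglyMeasurable (ae_of_all _ fun z => by
      rw [Real.norm_of_nonneg (mul_pos (F0 z) (G0 z)).le]
      exact mul_le_mul (F1 z) (G2 z) (G0 z).le (Real.exp_pos _).le)
  -- in each of the two energies `F` is increasing and `G` is decreasing
  have key : ∀ x y y', (F (x, y) - F (x, y')) * (G (x, y) - G (x, y')) ≤ 0 := by
    intro x y y'
    rcases le_total (V y) (V y') with h | h
    · refine mul_nonpos_of_nonpos_of_nonneg (sub_nonpos.2 ?_) (sub_nonneg.2 ?_)
      · exact Real.exp_le_exp.2 (mul_le_mul_of_nonneg_left (min_le_min_left _ h) hp)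
      · exact Real.exp_le_exp.2 (mul_le_mul_of_nonpos_left (max_le_max_left _ h) (neg_nonpos.2 hq))
    · refine mul_nonpos_of_nonneg_of_nonpos (sub_nonneg.2 ?_) (sub_nonpos.2 ?_)
      · exact Real.exp_le_exp.2 (mul_le_mul_of_nonneg_left (min_le_min_left _ h) hp)
      · exact Real.exp_le_exp.2 (mul_le_mul_of_nonpos_left (max_le_max_left _ h) (neg_nonpos.2 hq))
  have sF : ∀ x, Integrable (fun y => F (x, y)) ν := fun x =>
    (integrable_const (Real.exp (p * V x))).mono'
      (mF.comp measurable_prodMk_left).aestronglyMeasurable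
      (ae_of_all _ fun y => by rw [Real.norm_of_nonneg (F0 _).le]; exact F1 (x, y))
  have sG : ∀ x, Integrable (fun y => G (x, y)) ν := fun x =>
    (integrable_const (Real.exp (-q * V x))).mono'
      (mG.comp measurable_prodMk_left).aestronglyMeasurable
      (ae_of_all _ fun y => by rw [Real.norm_of_nonneg (G0 _).le]; exact G1 (x, y))
  have sFG : ∀ x, Integrable (fun y => F (x, y) * G (x, y)) ν := fun x =>
    (integrable_const (Real.exp (p * V x) * Real.exp (-q * V x))).mono'
      ((mF.mul mG).comp measurable_prodMk_left).aestronglyMeasurable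
      (ae_of_all _ fun y => by
        rw [Real.norm_of_nonneg (mul_pos (F0 _) (G0 _)).le]
        exact mul_le_mul (F1 (x, y)) (G1 (x, y)) (G0 _).le (Real.exp_pos _).le)
  have bF : Integrable (fun x => ∫ y, F (x, y) ∂ν) ν := iF.integral_prod_left
  have bG : Integrable (fun x => ∫ y, G (x, y) ∂ν) ν := iG.integral_prod_left
  have bFG : Integrable (fun x => (∫ y, F (x, y) ∂ν) * ∫ y, G (x, y) ∂ν) ν := by
    refine (integrable_const ((∫ y, Real.exp (p * V y) ∂ν) * ∫ y, Real.exp (-q * V y) ∂ν)).mono'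
      (bF.aestronglyMeasurable.mul bG.aestronglyMeasurable) (ae_of_all _ fun x => ?_)
    have n1 : 0 ≤ ∫ y, F (x, y) ∂ν := integral_nonneg fun y => (F0 _).le
    have n2 : 0 ≤ ∫ y, G (x, y) ∂ν := integral_nonneg fun y => (G0 _).le
    rw [Real.norm_of_nonneg (mul_nonneg n1 n2)]
    exact mul_le_mul (integral_mono (sF x) ip fun y => F2 (x, y))
      (integral_mono (sG x) iq fun y => G2 (x, y)) n2
      (integral_nonneg fun y => (Real.exp_pos _).le)
  rw [integral_prod _ iFG, integral_prod _ iF, integral_prod _ iG]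
  refine (integral_mono iFG.integral_prod_left bFG fun x =>
    integral_mul_le_mul_integral_of_opposite (sF x) (sG x) (sFG x) (key x)).trans ?_
  refine integral_mul_le_mul_integral_of_opposite bF bG bFG fun x x' => ?_
  rcases le_total (V x) (V x') with h | h
  · refine mul_nonpos_of_nonpos_of_nonneg (sub_nonpos.2 ?_) (sub_nonneg.2 ?_)
    · exact integral_mono (sF _) (sF _) fun y =>
        Real.exp_le_exp.2 (mul_le_mul_of_nonneg_left (min_le_min_right _ h) hp)
    · exact integral_mono (sG _) (sG _) fun y =>
        Real.exp_le_exp.2 (mul_le_mul_of_nonpos_left (max_le_max_right _ h) (neg_nonpos.2 hq))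
  · refine mul_nonpos_of_nonneg_of_nonpos (sub_nonneg.2 ?_) (sub_nonpos.2 ?_)
    · exact integral_mono (sF _) (sF _) fun y =>
        Real.exp_le_exp.2 (mul_le_mul_of_nonneg_left (min_le_min_right _ h) hp)
    · exact integral_mono (sG _) (sG _) fun y =>
        Real.exp_le_exp.2 (mul_le_mul_of_nonpos_left (max_le_max_right _ h) (neg_nonpos.2 hq))

namespace TemperingModel
variable {X : Type*} [MeasurableSpace X] {M : TemperingModel X}

/-- The swap function as an integral against two independent draws from an intermediate
distribution. -/
lemma swapProb_mul_eq {a b c : ℝ} (ha : a ∈ Set.Icc (0 : ℝ) 1) (hb : b ∈ Set.Icc (0 : ℝ) 1)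
    (hc : c ∈ Set.Icc (0 : ℝ) 1) (hab : a ≤ b) :
    M.swapProb a b * (M.Z a * M.Z b) = M.Z c ^ 2 *
      ∫ z : X × X, Real.exp ((c - a) * min (M.V z.1) (M.V z.2) - (b - c) * max (M.V z.1) (M.V z.2))
        ∂((M.annealed c).prod (M.annealed c)) := by
  rw [M.swapProb_eq ha hb, M.integral_annealed_prod hc hc,
    div_mul_cancel₀ _ (mul_pos (M.Z_pos ha) (M.Z_pos hb)).ne', ← sq,
    mul_div_cancel₀ _ (pow_pos (M.Z_pos hc) 2).ne']
  congr 1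
  funext z
  rw [← Real.exp_add, ← Real.exp_monotone.map_min]
  congr 1
  rcases le_total (M.V z.1) (M.V z.2) with h | h
  · rw [min_eq_left h, max_eq_right h, min_eq_left]
    · ring
    · nlinarith
  · rw [min_eq_right h, max_eq_left h, min_eq_right]
    · ring
    · nlinarith

lemma integrable_exp_annealed {a c : ℝ} (ha : a ∈ Set.Icc (0 : ℝ) 1) :
    Integrable (fun x => Real.exp ((c - a) * M.V x)) (M.annealed c) := by
  have h := M.measurable_V
  rw [annealed_eq_withDensity, integrable_withDensity_iff_integrable_smul' (by fun_prop) (by simp)]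
  rcases le_or_gt (M.Z c) 0 with hZ | hZ
  · refine (integrable_zero X ℝ _).congr (ae_of_all _ fun x => ?_)
    simp [ENNReal.ofReal_of_nonpos (div_nonpos_of_nonneg_of_nonpos (Real.exp_pos _).le hZ)]
  refine ((M.integrable_exp ha).div_const (M.Z c)).congr (ae_of_all _ fun x => ?_)
  simp only [smul_eq_mul]
  rw [ENNReal.toReal_ofReal (div_pos (Real.exp_pos _) hZ).le, div_mul_eq_mul_div, ← Real.exp_add]
  ring_nf

/-- The swap function is submultiplicative. -/
lemma swapProb_le_mul {a b c : ℝ} (ha : a ∈ Set.Icc (0 : ℝ) 1) (hb : b ∈ Set.Icc (0 : ℝ) 1)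
    (hac : a ≤ c) (hcb : c ≤ b) : M.swapProb a b ≤ M.swapProb a c * M.swapProb c b := by
  have hc : c ∈ Set.Icc (0 : ℝ) 1 := ⟨ha.1.trans hac, hcb.trans hb.2⟩
  have := M.isProbabilityMeasure_annealed hc
  have e1 := M.swapProb_mul_eq ha hb hc (hac.trans hcb)
  have e2 := M.swapProb_mul_eq ha hc hc hac
  have e3 := M.swapProb_mul_eq hc hb hc hcb
  have h := integral_exp_min_max_le (ν := M.annealed c) M.measurable_V (sub_nonneg.2 hac)
    (sub_nonneg.2 hcb) (integrable_exp_annealed ha) (by simpa using integrable_exp_annealed hb)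
  simp only [sub_self, zero_mul, sub_zero, zero_sub, ← neg_mul] at e2 e3
  have hZa := M.Z_pos ha
  have hZb := M.Z_pos hb
  have hZc := M.Z_pos hc
  have hp : 0 < M.Z a * M.Z b * M.Z c ^ 2 := by positivity
  refine le_of_mul_le_mul_right ?_ hp
  calc _ = M.swapProb a b * (M.Z a * M.Z b) * M.Z c ^ 2 := by ring
    _ ≤ (M.swapProb a c * (M.Z a * M.Z c)) * (M.swapProb c b * (M.Z c * M.Z b)) := by
      have hr : ∀ x I J : ℝ, x * (I * J) * x = x * I * (x * J) := fun x I J => by ring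
      rw [e1, e2, e3]
      exact (mul_le_mul_of_nonneg_right (mul_le_mul_of_nonneg_left h (by positivity))
        (by positivity)).trans_eq (hr _ _ _)
    _ = _ := by ring

/-- Superadditivity of `-log s` and the local expansion of `r` give, by repeated bisection, a bound
with no remainder. -/
lemma integral_meanAbsDiff_le_neg_log (hD : Integrable M.envelope M.refMeasure) {a b : ℝ}
    (ha : a ∈ Set.Icc (0 : ℝ) 1) (hb : b ∈ Set.Icc (0 : ℝ) 1) (hab : a ≤ b) :
    ∫ t in a..b, M.meanAbsDiff t ≤ -Real.log (M.swapProb a b) := by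
  obtain ⟨C, hC, h⟩ := exists_abs_rejProb_sub_integral_le hD
  have key : ∀ n : ℕ, ∀ a ∈ Set.Icc (0 : ℝ) 1, ∀ b ∈ Set.Icc (0 : ℝ) 1, a ≤ b →
      ∫ t in a..b, M.meanAbsDiff t ≤
        -Real.log (M.swapProb a b) + C * (b - a) ^ 2 * (1 / 2) ^ n := by
    intro n
    induction n with
    | zero =>
      intro a ha b hb hab
      have h1 := (abs_le.1 (h a ha b hb hab)).1
      have h2 := Real.log_le_sub_one_of_pos (M.swapProb_pos ha hb)
      rw [rejProb] at h1
      simp only [pow_zero, mul_one]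
      linarith
    | succ n ih =>
      intro a ha b hb hab
      have hac : a ≤ (a + b) / 2 := by linarith
      have hcb : (a + b) / 2 ≤ b := by linarith
      have hc : (a + b) / 2 ∈ Set.Icc (0 : ℝ) 1 := ⟨ha.1.trans hac, hcb.trans hb.2⟩
      have h1 := ih a ha _ hc hac
      have h2 := ih _ hc b hb hcb
      have h3 := Real.log_le_log (M.swapProb_pos ha hb) (swapProb_le_mul ha hb hac hcb)
      rw [Real.log_mul (M.swapProb_pos ha hc).ne' (M.swapProb_pos hc hb).ne'] at h3
      rw [← intervalIntegral.integral_add_adjacent_intervals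
        (intervalIntegrable_meanAbsDiff hD ha hc) (intervalIntegrable_meanAbsDiff hD hc hb)]
      have h4 : C * ((a + b) / 2 - a) ^ 2 * (1 / 2) ^ n + C * (b - (a + b) / 2) ^ 2 * (1 / 2) ^ n =
          C * (b - a) ^ 2 * (1 / 2) ^ (n + 1) := by ring
      linarith
  have hlim : Tendsto (fun n : ℕ => -Real.log (M.swapProb a b) + C * (b - a) ^ 2 * (1 / 2) ^ n)
      atTop (𝓝 (-Real.log (M.swapProb a b) + C * (b - a) ^ 2 * 0)) :=
    tendsto_const_nhds.add ((tendsto_pow_atTop_nhds_zero_of_lt_one (by norm_num)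
      (by norm_num)).const_mul _)
  rw [mul_zero, add_zero] at hlim
  exact ge_of_tendsto' hlim fun n => key n a ha b hb hab

lemma integral_meanAbsDiff_le_rejProb_div (hD : Integrable M.envelope M.refMeasure) {a b : ℝ}
    (ha : a ∈ Set.Icc (0 : ℝ) 1) (hb : b ∈ Set.Icc (0 : ℝ) 1) (hab : a ≤ b) :
    ∫ t in a..b, M.meanAbsDiff t ≤ M.rejProb a b / M.swapProb a b := by
  have hs := M.swapProb_pos ha hb
  refine (integral_meanAbsDiff_le_neg_log hD ha hb hab).trans ?_
  rw [← Real.log_inv]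
  refine (Real.log_le_sub_one_of_pos (inv_pos.2 hs)).trans_eq ?_
  rw [rejProb]
  field_simp

lemma globalBarrier_eq (hD : Integrable M.envelope M.refMeasure) :
    M.globalBarrier = ∫ t in (0 : ℝ)..1, M.meanAbsDiff t := by
  refine intervalIntegral.integral_congr fun t ht => localBarrier_eq hD ?_
  rwa [Set.uIcc_of_le zero_le_one] at ht

lemma globalBarrier_nonneg (hD : Integrable M.envelope M.refMeasure) : 0 ≤ M.globalBarrier := by
  rw [globalBarrier_eq hD]
  exact intervalIntegral.integral_nonneg zero_le_one fun t _ => meanAbsDiff_nonneg t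

end TemperingModel

namespace PTSetup
variable {X : Type*} [MeasurableSpace X] {M : TemperingModel X} (A : PTSetup M)

lemma β_mem (i : Fin (A.N + 1)) : A.β i ∈ Set.Icc (0 : ℝ) 1 := by
  rw [← A.β_zero, ← A.β_last]
  exact ⟨A.β_strictMono.monotone (Fin.zero_le i), A.β_strictMono.monotone (Fin.le_last i)⟩

lemma β_castSucc_lt_succ (i : Fin A.N) : A.β i.castSucc < A.β i.succ :=
  A.β_strictMono Fin.castSucc_lt_succ

lemma sub_le_mesh (i : Fin A.N) : A.β i.succ - A.β i.castSucc ≤ A.mesh :=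
  le_ciSup (f := fun i : Fin A.N => A.β i.succ - A.β i.castSucc) (Set.finite_range _).bddAbove i

lemma N_pos : 0 < A.N := by
  rcases Nat.eq_zero_or_pos A.N with h | h
  · have h1 := A.β_zero
    have h2 := A.β_last
    have h3 : Fin.last A.N = 0 := by ext; simp [h]
    rw [h3, h1] at h2
    exact absurd h2 zero_ne_one
  · exact h

lemma mesh_pos : 0 < A.mesh :=
  (sub_pos.2 (A.β_castSucc_lt_succ ⟨0, A.N_pos⟩)).trans_le (A.sub_le_mesh _)

lemma sum_sub_eq_one : ∑ i : Fin A.N, (A.β i.succ - A.β i.castSucc) = 1 := by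
  have h : ∑ i : Fin A.N, (A.β i.succ - A.β i.castSucc) = A.β (Fin.last A.N) - A.β 0 := by
    have h1 := Fin.sum_univ_succ A.β
    have h2 := Fin.sum_univ_castSucc A.β
    rw [Finset.sum_sub_distrib]
    linarith
  rw [h, A.β_last, A.β_zero, sub_zero]

lemma one_le_N_mul_mesh : 1 ≤ A.N * A.mesh := by
  rw [← A.sum_sub_eq_one]
  refine (Finset.sum_le_sum fun i _ => A.sub_le_mesh i).trans_eq ?_
  simp

lemma sum_integral_eq {f : ℝ → ℝ}
    (hf : ∀ a ∈ Set.Icc (0 : ℝ) 1, ∀ b ∈ Set.Icc (0 : ℝ) 1, IntervalIntegrable f volume a b) :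
    ∑ i : Fin A.N, ∫ t in A.β i.castSucc..A.β i.succ, f t = ∫ t in (0 : ℝ)..1, f t := by
  have h1 : ∀ i : Fin A.N, ∫ t in A.β i.castSucc..A.β i.succ, f t =
      (∫ t in (0 : ℝ)..A.β i.succ, f t) - ∫ t in (0 : ℝ)..A.β i.castSucc, f t := fun i =>
    (intervalIntegral.integral_interval_sub_left (hf _ (by simp) _ (A.β_mem _))
      (hf _ (by simp) _ (A.β_mem _))).symm
  simp_rw [h1]
  have h2 := Fin.sum_univ_succ fun i => ∫ t in (0 : ℝ)..A.β i, f t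
  have h3 := Fin.sum_univ_castSucc fun i => ∫ t in (0 : ℝ)..A.β i, f t
  rw [A.β_zero] at h2
  rw [A.β_last] at h3
  rw [Finset.sum_sub_distrib]
  simp only [intervalIntegral.integral_same] at h2
  linarith

/-- The schedule inefficiency never falls below the global barrier. -/
lemma globalBarrier_le_inefficiency (hD : Integrable M.envelope M.refMeasure) :
    M.globalBarrier ≤ A.inefficiency := by
  rw [TemperingModel.globalBarrier_eq hD, ← A.sum_integral_eq fun a ha b hb =>
    TemperingModel.intervalIntegrable_meanAbsDiff hD ha hb]
  exact Finset.sum_le_sum fun i _ => TemperingModel.integral_meanAbsDiff_le_rejProb_div hD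
    (A.β_mem _) (A.β_mem _) (A.β_castSucc_lt_succ i).le

end PTSetup

lemma exists_inefficiency_le {X : Type*} [MeasurableSpace X] {M : TemperingModel X}
    (hD : Integrable M.envelope M.refMeasure) :
    ∃ C, 0 ≤ C ∧ ∃ η, 0 < η ∧ ∀ A : PTSetup M, A.mesh ≤ η →
      A.inefficiency ≤ M.globalBarrier + C * A.mesh := by
  obtain ⟨C, hC, h⟩ := TemperingModel.exists_abs_rejProb_sub_integral_le hD
  obtain ⟨B, hB⟩ := isCompact_Icc.exists_bound_of_continuousOn
    (TemperingModel.continuousOn_meanAbsDiff hD)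
  have hB0 : 0 ≤ B := (norm_nonneg _).trans (hB 0 (by simp))
  refine ⟨C + 2 * (B + C) ^ 2, by positivity, 1 / (2 * (B + C + 1)), by positivity,
    fun A hA => ?_⟩
  have hm := A.mesh_pos
  rw [TemperingModel.globalBarrier_eq hD, ← A.sum_integral_eq fun a ha b hb =>
    TemperingModel.intervalIntegrable_meanAbsDiff hD ha hb]
  have h1 : (C + 2 * (B + C) ^ 2) * A.mesh = ∑ i : Fin A.N,
      (C + 2 * (B + C) ^ 2) * A.mesh * (A.β i.succ - A.β i.castSucc) := by
    rw [← Finset.mul_sum, A.sum_sub_eq_one, mul_one]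
  rw [h1, ← Finset.sum_add_distrib]
  refine Finset.sum_le_sum fun i _ => ?_
  have ha := A.β_mem i.castSucc
  have hb := A.β_mem i.succ
  have hlt := A.β_castSucc_lt_succ i
  have hle := A.sub_le_mesh i
  have e := (abs_le.1 (h _ ha _ hb hlt.le)).2
  have hI : ∫ t in A.β i.castSucc..A.β i.succ, M.meanAbsDiff t ≤
      B * (A.β i.succ - A.β i.castSucc) := by
    refine (le_abs_self _).trans ?_
    rw [← Real.norm_eq_abs]
    refine (intervalIntegral.norm_integral_le_of_norm_le_const (C := B)
      fun t ht => hB t ?_).trans_eq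
      (by rw [abs_of_pos (sub_pos.2 hlt)])
    rw [Set.uIoc_of_le hlt.le] at ht
    exact ⟨ha.1.trans ht.1.le, ht.2.trans hb.2⟩
  set δ := A.β i.succ - A.β i.castSucc with hδ
  have hδ0 : 0 < δ := sub_pos.2 hlt
  have hδ1 : δ ≤ 1 := by linarith [ha.1, hb.2]
  have hs := M.swapProb_pos ha hb
  have hr := M.rejProb_nonneg ha hb
  set r := M.rejProb (A.β i.castSucc) (A.β i.succ) with hrdef
  have hsr : M.swapProb (A.β i.castSucc) (A.β i.succ) = 1 - r := by
    rw [hrdef, TemperingModel.rejProb]; ring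
  have hrδ : r ≤ (B + C) * δ := by
    nlinarith [mul_nonneg hC (mul_nonneg hδ0.le (sub_nonneg.2 hδ1))]
  have hr2 : r ≤ 1 / 2 := by
    refine hrδ.trans ((mul_le_mul_of_nonneg_left (hle.trans hA) (by positivity)).trans ?_)
    rw [mul_one_div, div_le_div_iff₀ (by positivity) two_pos]
    linarith
  have h2 : r / (1 - r) ≤ r + 2 * r ^ 2 := by
    rw [div_le_iff₀ (by linarith)]
    nlinarith [mul_nonneg (sq_nonneg r) (sub_nonneg.2 hr2)]
  rw [hsr]
  have h3 : r ^ 2 ≤ (B + C) ^ 2 * (A.mesh * δ) := by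
    calc r ^ 2 ≤ ((B + C) * δ) ^ 2 := by gcongr
      _ = (B + C) ^ 2 * (δ * δ) := by ring
      _ ≤ _ := by gcongr
  have h4 : C * δ ^ 2 ≤ C * (A.mesh * δ) := by rw [sq]; gcongr
  linarith [mul_comm A.mesh δ]

/-! ### Alternating hitting times and climbing phases -/

lemma le_hitAfter (t : ℕ∞) (p : ℕ → Prop) : t ≤ hitAfter t p :=
  le_iInf₂ fun _ h => h.1.le

lemma succ_le_hitAfter {t : ℕ∞} {n : ℕ} (p : ℕ → Prop) (h : (n : ℕ∞) ≤ t) :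
    ((n + 1 : ℕ) : ℕ∞) ≤ hitAfter t p :=
  le_iInf₂ fun m hm => by
    have : n < m := by exact_mod_cast h.trans_lt hm.1
    exact_mod_cast this

lemma hitAfter_le {t : ℕ∞} {n : ℕ} {p : ℕ → Prop} (h : t < n) (hp : p n) : hitAfter t p ≤ n :=
  iInf₂_le n ⟨h, hp⟩

lemma succ_le_hitAfter_of_not {t : ℕ∞} {n : ℕ} {p : ℕ → Prop} (h : (n : ℕ∞) ≤ hitAfter t p)
    (hp : ¬p n) : ((n + 1 : ℕ) : ℕ∞) ≤ hitAfter t p :=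
  le_iInf₂ fun m hm => by
    have h1 : n ≤ m := by exact_mod_cast h.trans (iInf₂_le m hm)
    have h2 : n ≠ m := fun e => hp (e ▸ hm.2)
    exact_mod_cast lt_of_le_of_ne h1 h2

open scoped Classical in
/-- Whether, after the observations up to time `n`, the last of the two events `a` (bottom) and `b`
(top) to occur is `a`, in the alternating sense: the phase starts at the first `a`, ends at the next
`b`, restarts at the next `a`, and so on. -/
def climbPhase (a b : ℕ → Prop) : ℕ → Bool
  | 0 => decide (a 0)
  | n + 1 => if climbPhase a b n then !decide (b (n + 1)) else decide (a (n + 1))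

open scoped Classical in
/-- The number of times `m ≤ n` at which a climbing phase ends. -/
def climbCount (a b : ℕ → Prop) (n : ℕ) : ℕ :=
  ∑ m ∈ Finset.range n, if climbPhase a b m = true ∧ b (m + 1) then 1 else 0

/-- The alternating hitting times are read off the climbing phases. -/
lemma ncard_hitting_le_eq_climbCount {a b : ℕ → Prop} {D U : ℕ → ℕ∞}
    (hD0 : D 0 = ⨅ (n : ℕ) (_ : a n), (n : ℕ∞)) (hU : ∀ k, U k = hitAfter (D k) b)
    (hD : ∀ k, D (k + 1) = hitAfter (U k) a) (n : ℕ) :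
    {k : ℕ | U k ≤ n}.ncard = climbCount a b n := by
  classical
  have hDle : ∀ n : ℕ, a n → D 0 ≤ n := fun n h => hD0 ▸ iInf₂_le n h
  have hD0' : ∀ n : ℕ, (n : ℕ∞) ≤ D 0 → ¬a n → ((n + 1 : ℕ) : ℕ∞) ≤ D 0 := fun n h hn => by
    rw [hD0] at h ⊢
    refine le_iInf₂ fun m hm => ?_
    have h1 : n ≤ m := by exact_mod_cast h.trans (iInf₂_le m hm)
    have h2 : n ≠ m := fun e => hn (e ▸ hm)
    exact_mod_cast lt_of_le_of_ne h1 h2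
  have hlt : ∀ {t : ℕ∞} {n : ℕ}, t ≤ n → t < ((n + 1 : ℕ) : ℕ∞) := fun h =>
    h.trans_lt (by exact_mod_cast Nat.lt_succ_self _)
  have inv : ∀ n : ℕ, (∀ k < climbCount a b n, U k ≤ n) ∧
      (climbPhase a b n = true →
        D (climbCount a b n) ≤ n ∧ ((n + 1 : ℕ) : ℕ∞) ≤ U (climbCount a b n)) ∧
      (climbPhase a b n = false → ((n + 1 : ℕ) : ℕ∞) ≤ D (climbCount a b n)) := by
    intro n
    induction n with
    | zero =>
      refine ⟨by simp [climbCount], fun h => ?_, fun h => ?_⟩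
      · have ha : a 0 := by simpa [climbPhase] using h
        refine ⟨hDle 0 ha, ?_⟩
        rw [hU]
        exact succ_le_hitAfter b (by simp)
      · have ha : ¬a 0 := by simpa [climbPhase] using h
        exact hD0' 0 (by simp) ha
    | succ n ih =>
      obtain ⟨ih1, ih2, ih3⟩ := ih
      have hnn : (n : ℕ∞) ≤ ((n + 1 : ℕ) : ℕ∞) := by exact_mod_cast Nat.le_succ n
      have hcount : climbCount a b (n + 1) = climbCount a b n +
          if climbPhase a b n = true ∧ b (n + 1) then 1 else 0 := Finset.sum_range_succ _ _
      rcases hph : climbPhase a b n with _ | _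
      · have hK : climbCount a b (n + 1) = climbCount a b n := by simp [hcount, hph]
        have hph' : climbPhase a b (n + 1) = decide (a (n + 1)) := by simp [climbPhase, hph]
        have h3 := ih3 hph
        rw [hK, hph']
        refine ⟨fun k hk => (ih1 k hk).trans hnn, fun h => ?_, fun h => ?_⟩
        · have ha : a (n + 1) := of_decide_eq_true h
          refine ⟨?_, ?_⟩
          · rcases hk : climbCount a b n with _ | k
            · exact hDle _ ha
            · rw [hD]
              exact hitAfter_le (hlt (ih1 k (by omega))) ha
          · rw [hU]
            exact succ_le_hitAfter b h3
        · have ha : ¬a (n + 1) := of_decide_eq_false h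
          rcases hk : climbCount a b n with _ | k
          · rw [hk] at h3
            exact hD0' _ h3 ha
          · rw [hk, hD] at h3
            rw [hD]
            exact succ_le_hitAfter_of_not h3 ha
      · have hph' : climbPhase a b (n + 1) = !decide (b (n + 1)) := by simp [climbPhase, hph]
        obtain ⟨h2, h2'⟩ := ih2 hph
        by_cases hb : b (n + 1)
        · have hK : climbCount a b (n + 1) = climbCount a b n + 1 := by simp [hcount, hph, hb]
          rw [hK, hph']
          refine ⟨fun k hk => ?_, fun h => by simp [hb] at h, fun _ => ?_⟩
          · rcases Nat.lt_succ_iff_lt_or_eq.1 hk with hk | rfl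
            · exact (ih1 k hk).trans hnn
            · rw [hU]
              exact hitAfter_le (hlt h2) hb
          · rw [hD]
            exact succ_le_hitAfter a h2'
        · have hK : climbCount a b (n + 1) = climbCount a b n := by simp [hcount, hb]
          rw [hK, hph']
          refine ⟨fun k hk => (ih1 k hk).trans hnn, fun _ => ⟨h2.trans hnn, ?_⟩,
            fun h => by simp [hb] at h⟩
          rw [hU] at h2' ⊢
          exact succ_le_hitAfter_of_not h2' hb
  obtain ⟨h1, h2, h3⟩ := inv n
  have hDU : ∀ k, D k ≤ U k := fun k => hU k ▸ le_hitAfter _ _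
  have hmono : Monotone U := monotone_nat_of_le_succ fun k =>
    ((le_hitAfter _ _).trans_eq (hD k).symm).trans (hDU (k + 1))
  have hK : ((n + 1 : ℕ) : ℕ∞) ≤ U (climbCount a b n) := by
    rcases hph : climbPhase a b n with _ | _
    · exact (h3 hph).trans (hDU _)
    · exact (h2 hph).2
  have hset : {k : ℕ | U k ≤ n} = (Finset.range (climbCount a b n) : Set ℕ) := by
    ext k
    simp only [Set.mem_ofPred_eq, Finset.coe_range, Set.mem_Iio]
    refine ⟨fun h => ?_, h1 k⟩
    by_contra! hk
    have h4 := (hK.trans (hmono hk)).trans h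
    have h5 : n + 1 ≤ n := by exact_mod_cast h4
    omega
  rw [hset, Set.ncard_coe_finset, Finset.card_range]

section
variable {X : Type*} {N : ℕ}

/-- Machine `j` is at the bottom: it holds the index `0` and moves downwards. -/
def atBottom (ω : ℕ → PTFullState X N) (j : Fin (N + 1)) (n : ℕ) : Prop :=
  indexProcess ω j n = 0 ∧ direction ω j n = -1

/-- Machine `j` is at the top: it holds the index `N` and moves upwards. -/
def atApex (ω : ℕ → PTFullState X N) (j : Fin (N + 1)) (n : ℕ) : Prop :=
  indexProcess ω j n = Fin.last N ∧ direction ω j n = 1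

lemma annealedRestarts_eq_sum_climbCount (ω : ℕ → PTFullState X N) (n : ℕ) :
    annealedRestarts ω n = ∑ j, climbCount (atBottom ω j) (atApex ω j) n :=
  Finset.sum_congr rfl fun j _ =>
    ncard_hitting_le_eq_climbCount (D := downTime ω j) (U := upTime ω j) rfl (fun _ => rfl)
      (fun _ => rfl) n

end

/-! ### Null sets of the stationary law and efficient local exploration -/

lemma lintegral_pi_prod {ι : Type*} [Fintype ι] {X : ι → Type*} [∀ i, MeasurableSpace (X i)]
    (μ : ∀ i, Measure (X i)) [∀ i, IsProbabilityMeasure (μ i)] {f : ∀ i, X i → ENNReal}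
    (hf : ∀ i, Measurable (f i)) :
    ∫⁻ x, ∏ i, f i (x i) ∂Measure.pi μ = ∏ i, ∫⁻ x, f i x ∂μ i := by
  refine (lintegral_prod_eq_prod_lintegral_of_indepFun Finset.univ
    (fun i (x : ∀ i, X i) => f i (x i)) (iIndepFun_pi fun i => (hf i).aemeasurable)
    fun i => (hf i).comp (measurable_pi_apply i)).trans ?_
  refine Finset.prod_congr rfl fun i _ => ?_
  rw [← lintegral_map (hf i) (measurable_pi_apply i), (measurePreserving_eval μ i).map_eq]

lemma pi_withDensity {ι : Type*} [Fintype ι] {X : ι → Type*} [∀ i, MeasurableSpace (X i)]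
    (μ : ∀ i, Measure (X i)) [∀ i, IsProbabilityMeasure (μ i)] {f : ∀ i, X i → ENNReal}
    (hf : ∀ i, Measurable (f i)) [∀ i, SigmaFinite ((μ i).withDensity (f i))] :
    Measure.pi (fun i => (μ i).withDensity (f i)) =
      (Measure.pi μ).withDensity fun x => ∏ i, f i (x i) := by
  refine Measure.pi_eq fun s hs => ?_
  rw [withDensity_apply _ (MeasurableSet.univ_pi hs),
    ← lintegral_indicator (MeasurableSet.univ_pi hs)]
  have h : ∀ x : ∀ i, X i, (Set.univ.pi s).indicator (fun x => ∏ i, f i (x i)) x =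
      ∏ i, (s i).indicator (f i) (x i) := by
    intro x
    by_cases hx : x ∈ Set.univ.pi s
    · rw [Set.indicator_of_mem hx]
      exact Finset.prod_congr rfl fun i _ =>
        (Set.indicator_of_mem (hx i (Set.mem_univ i)) (f i)).symm
    · rw [Set.indicator_of_notMem hx]
      rw [Set.mem_univ_pi] at hx
      push Not at hx
      obtain ⟨i, hi⟩ := hx
      exact (Finset.prod_eq_zero (Finset.mem_univ i) (Set.indicator_of_notMem hi _)).symm
  simp_rw [h]
  rw [lintegral_pi_prod μ fun i => (hf i).indicator (hs i)]
  refine Finset.prod_congr rfl fun i _ => ?_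
  rw [lintegral_indicator (hs i), withDensity_apply _ (hs i)]

namespace PTSetup
variable {X : Type*} [MeasurableSpace X] {M : TemperingModel X} (A : PTSetup M)

instance isProbabilityMeasure_annealed_β (i : Fin (A.N + 1)) :
    IsProbabilityMeasure (M.annealed (A.β i)) := M.isProbabilityMeasure_annealed (A.β_mem i)

instance isMarkovKernel_K (i : Fin (A.N + 1)) : IsMarkovKernel (A.K i) := A.K_markov i

/-- The stationary law `∏_i π^(β_i)` of the states of all chains. -/
def stateLaw : Measure (Fin (A.N + 1) → X) := Measure.pi fun i => M.annealed (A.β i)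

instance : IsProbabilityMeasure A.stateLaw :=
  inferInstanceAs (IsProbabilityMeasure (Measure.pi fun i => M.annealed (A.β i)))

lemma stateLaw_eq_withDensity :
    A.stateLaw = (Measure.pi fun _ : Fin (A.N + 1) => M.refMeasure).withDensity fun x =>
      ∏ i, ENNReal.ofReal (Real.exp (-A.β i * M.V (x i)) / M.Z (A.β i)) := by
  have h := M.measurable_V
  have hp : ∀ i, IsProbabilityMeasure (M.refMeasure.withDensity fun x =>
      ENNReal.ofReal (Real.exp (-A.β i * M.V x) / M.Z (A.β i))) := fun i => by
    rw [← M.annealed_eq_withDensity]; infer_instance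
  rw [stateLaw, ← pi_withDensity _ (f := fun i x =>
    ENNReal.ofReal (Real.exp (-A.β i * M.V x) / M.Z (A.β i))) (by fun_prop)]
  congr 1
  funext i
  exact M.annealed_eq_withDensity _

lemma stateLaw_ac : A.stateLaw ≪ Measure.pi fun _ : Fin (A.N + 1) => M.refMeasure := by
  rw [stateLaw_eq_withDensity]
  exact withDensity_absolutelyContinuous _ _

lemma ac_stateLaw : (Measure.pi fun _ : Fin (A.N + 1) => M.refMeasure) ≪ A.stateLaw := by
  have h := M.measurable_V
  rw [stateLaw_eq_withDensity]
  refine withDensity_absolutelyContinuous' (Measurable.aemeasurable (by fun_prop))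
    (ae_of_all _ fun x => ?_)
  refine Finset.prod_ne_zero_iff.2 fun i _ => ?_
  exact (ENNReal.ofReal_pos.2 (div_pos (Real.exp_pos _) (M.Z_pos (A.β_mem i)))).ne'

/-- Exchanging coordinates maps the stationary law to an equivalent one. -/
lemma map_perm_stateLaw_ac (e : Equiv.Perm (Fin (A.N + 1))) :
    A.stateLaw.map (fun x k => x (e k)) ≪ A.stateLaw := by
  have hm : Measurable fun (x : Fin (A.N + 1) → X) k => x (e k) :=
    measurable_pi_lambda _ fun k => measurable_pi_apply _
  refine (A.stateLaw_ac.map hm).trans ?_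
  have h := Measure.pi_map_piCongrLeft e.symm (β := fun _ => X) fun _ => M.refMeasure
  have h2 : (fun (x : Fin (A.N + 1) → X) k => x (e k)) =
      MeasurableEquiv.piCongrLeft (fun _ => X) e.symm := by
    funext x k
    have := MeasurableEquiv.piCongrLeft_apply_apply e.symm (β := fun _ => X) x (e k)
    simpa using this.symm
  rw [h2, h]
  exact A.ac_stateLaw

/-- The states `x` have a law absolutely continuous with respect to the stationary one. -/
def StatesAC (ρ : Measure (PTState X A.N)) : Prop := ρ.map Prod.fst ≪ A.stateLaw

variable {A}

lemma StatesAC.ae {ρ : Measure (PTState X A.N)} (h : A.StatesAC ρ)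
    {p : (Fin (A.N + 1) → X) → Prop} (hp : ∀ᵐ x ∂A.stateLaw, p x) : ∀ᵐ z ∂ρ, p z.1 :=
  ae_of_ae_map measurable_fst.aemeasurable (h.ae_le hp)

lemma StatesAC.of_null {ρ : Measure (PTState X A.N)}
    (h : ∀ s : Set (Fin (A.N + 1) → X), MeasurableSet s → A.stateLaw s = 0 →
      ρ (Prod.fst ⁻¹' s) = 0) : A.StatesAC ρ :=
  Measure.AbsolutelyContinuous.mk fun s hs h0 => by
    rw [Measure.map_apply measurable_fst hs]; exact h s hs h0

lemma StatesAC.swapKernel_comp {ρ : Measure (PTState X A.N)} (h : A.StatesAC ρ) (i : Fin A.N) :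
    A.StatesAC (A.swapKernel i ∘ₘ ρ) := by
  refine StatesAC.of_null fun s hs h0 => ?_
  have hs' : MeasurableSet (Prod.fst ⁻¹' s : Set (PTState X A.N)) := measurable_fst hs
  have hm : Measurable fun (x : Fin (A.N + 1) → X) k => x (Equiv.swap i.castSucc i.succ k) :=
    measurable_pi_lambda _ fun k => measurable_pi_apply _
  have h1 : ∀ᵐ x ∂A.stateLaw, x ∉ s := by rwa [ae_iff, show {x | ¬x ∉ s} = s by simp]
  have h2 : ∀ᵐ x ∂A.stateLaw, (fun k => x (Equiv.swap i.castSucc i.succ k)) ∉ s :=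
    ae_of_ae_map hm.aemeasurable ((A.map_perm_stateLaw_ac _).ae_le h1)
  rw [Measure.bind_apply hs' (A.swapKernel i).aemeasurable, lintegral_eq_zero_iff
    ((A.swapKernel i).measurable_coe hs')]
  filter_upwards [h.ae h1, h.ae h2] with z hz1 hz2
  change (ENNReal.ofReal (1 - A.accept i z) • Measure.dirac z +
    ENNReal.ofReal (A.accept i z) • Measure.dirac (A.swapState i z)) (Prod.fst ⁻¹' s) = 0
  have hz2' : A.swapState i z ∉ Prod.fst ⁻¹' s := hz2
  have hz1' : z ∉ Prod.fst ⁻¹' s := hz1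
  simp [Measure.dirac_apply' _ hs', hz1', hz2']

lemma StatesAC.commKernel_comp {ρ : Measure (PTState X A.N)} (h : A.StatesAC ρ) (b : Bool) :
    A.StatesAC (A.commKernel b ∘ₘ ρ) := by
  unfold commKernel
  induction (List.finRange A.N).filter fun i : Fin A.N => ProposedAt b i with
  | nil => simpa using h
  | cons i l ih =>
    simp only [List.map_cons, List.foldr_cons]
    rw [← Measure.comp_assoc]
    exact ih.swapKernel_comp i

variable (A)

/-- The local exploration of the states alone. -/
def coordKernel : Kernel (Fin (A.N + 1) → X) (Fin (A.N + 1) → X) where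
  toFun x := Measure.pi fun i => A.K i (x i)
  measurable' := by
    refine Measurable.measure_of_isPiSystem_of_isProbabilityMeasure
      generateFrom_pi.symm isPiSystem_pi ?_
    rintro _ ⟨s, hs, rfl⟩
    simp only [Measure.pi_pi]
    refine Finset.measurable_fun_prod _ fun i _ => ?_
    exact (Kernel.measurable_coe (A.K i) (hs i (Set.mem_univ i))).comp (measurable_pi_apply i)

lemma coordKernel_apply (x : Fin (A.N + 1) → X) :
    A.coordKernel x = Measure.pi fun i => A.K i (x i) := rfl

lemma explKernel_apply (z : PTState X A.N) :
    A.explKernel z = (A.coordKernel z.1).prod (Measure.dirac z.2) := rfl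

instance : IsMarkovKernel A.coordKernel where
  isProbabilityMeasure x := by rw [coordKernel_apply]; infer_instance

lemma coordKernel_invariant : A.coordKernel ∘ₘ A.stateLaw = A.stateLaw := by
  rw [stateLaw]
  refine (Measure.pi_eq fun s hs => ?_).symm
  rw [Measure.bind_apply (MeasurableSet.univ_pi hs) A.coordKernel.aemeasurable]
  simp_rw [coordKernel_apply, Measure.pi_pi]
  rw [lintegral_pi_prod _ fun i => (A.K i).measurable_coe (hs i)]
  refine Finset.prod_congr rfl fun i _ => ?_
  rw [← Measure.bind_apply (hs i) (A.K i).aemeasurable, (A.K_invariant i).def]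

variable {A}

lemma StatesAC.explKernel_comp {ρ : Measure (PTState X A.N)} (h : A.StatesAC ρ) :
    A.StatesAC (A.explKernel ∘ₘ ρ) := by
  refine StatesAC.of_null fun s hs h0 => ?_
  have hs' : MeasurableSet (Prod.fst ⁻¹' s : Set (PTState X A.N)) := measurable_fst hs
  have h1 : ∀ᵐ x ∂A.stateLaw, A.coordKernel x s = 0 := by
    rw [← A.coordKernel_invariant, Measure.bind_apply hs A.coordKernel.aemeasurable,
      lintegral_eq_zero_iff (A.coordKernel.measurable_coe hs)] at h0
    exact h0
  rw [Measure.bind_apply hs' A.explKernel.aemeasurable, lintegral_eq_zero_iff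
    (A.explKernel.measurable_coe hs')]
  filter_upwards [h.ae h1] with z hz
  rw [explKernel_apply, ← Set.prod_univ, Measure.prod_prod, hz, zero_mul, Pi.zero_apply]

/-- Efficient local exploration: one exploration step redraws the energy. -/
lemma EfficientLocalExploration.ae_map_V (hA : A.EfficientLocalExploration) (i : Fin (A.N + 1)) :
    ∀ᵐ x ∂M.annealed (A.β i), (A.K i x).map M.V = (M.annealed (A.β i)).map M.V := by
  have hV := M.measurable_V
  have hVm : IsProbabilityMeasure ((M.annealed (A.β i)).map M.V) :=
    Measure.isProbabilityMeasure_map hV.aemeasurable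
  have h1 : (M.annealed (A.β i) ⊗ₘ A.K i).map (fun z => M.V z.2) =
      (M.annealed (A.β i)).map M.V := by
    refine (Measure.map_map (g := M.V) (f := Prod.snd) hV measurable_snd).symm.trans ?_
    change (M.annealed (A.β i) ⊗ₘ A.K i).snd.map M.V = _
    rw [Measure.snd_compProd, (A.K_invariant i).def]
  have h2 := (indepFun_iff_map_prod_eq_prod_map_map measurable_fst.aemeasurable
    (by fun_prop)).1 (hA i)
  have h3 : (M.annealed (A.β i) ⊗ₘ A.K i).map Prod.fst = M.annealed (A.β i) := by
    change (M.annealed (A.β i) ⊗ₘ A.K i).fst = _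
    rw [Measure.fst_compProd]
  rw [h1, h3] at h2
  have h4 : M.annealed (A.β i) ⊗ₘ (A.K i).map M.V =
      M.annealed (A.β i) ⊗ₘ Kernel.const X ((M.annealed (A.β i)).map M.V) := by
    rw [Measure.compProd_const, ← h2, Measure.compProd_map hV]
    rfl
  filter_upwards [Kernel.ae_eq_of_compProd_eq h4] with x hx
  rw [Kernel.map_apply _ hV] at hx
  exact hx

variable (A)

/-- The acceptance probability as a function of the states. -/
def acceptOf (i : Fin A.N) (x : Fin (A.N + 1) → X) : ℝ :=
  Real.exp (min 0 ((A.β i.succ - A.β i.castSucc) * (M.V (x i.succ) - M.V (x i.castSucc))))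

lemma accept_eq (i : Fin A.N) (z : PTState X A.N) : A.accept i z = A.acceptOf i z.1 := rfl

@[fun_prop]
lemma measurable_acceptOf (i : Fin A.N) : Measurable (A.acceptOf i) := by
  have := M.measurable_V
  unfold acceptOf
  fun_prop

lemma acceptOf_nonneg (i : Fin A.N) (x : Fin (A.N + 1) → X) : 0 ≤ A.acceptOf i x :=
  (Real.exp_pos _).le

lemma acceptOf_le_one (i : Fin A.N) (x : Fin (A.N + 1) → X) : A.acceptOf i x ≤ 1 :=
  Real.exp_le_one_iff.2 (min_le_left _ _)

/-- The mean acceptance probability of the swap along the edge `i`. -/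
def swapRate (i : Fin A.N) : ℝ := M.swapProb (A.β i.castSucc) (A.β i.succ)

lemma integral_acceptOf_stateLaw (i : Fin A.N) :
    ∫ x, A.acceptOf i x ∂A.stateLaw = A.swapRate i := by
  have hV := M.measurable_V
  have hne : i.castSucc ≠ i.succ := Fin.castSucc_lt_succ.ne
  have hind : iIndepFun (fun (k : Fin (A.N + 1)) (x : Fin (A.N + 1) → X) => x k) A.stateLaw :=
    iIndepFun_pi (X := fun _ => id) fun _ => aemeasurable_id
  have h := (indepFun_iff_map_prod_eq_prod_map_map (measurable_pi_apply _).aemeasurable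
    (measurable_pi_apply _).aemeasurable).1 (hind.indepFun hne)
  have hev : ∀ k, A.stateLaw.map (fun x => x k) = M.annealed (A.β k) := fun k =>
    (measurePreserving_eval (fun i => M.annealed (A.β i)) k).map_eq
  rw [hev, hev] at h
  rw [swapRate, TemperingModel.swapProb, ← h, integral_map (by fun_prop)
    (Measurable.aestronglyMeasurable (by fun_prop))]
  rfl

/-- After exploration from almost every state, the mean acceptance probability does not depend on
the state any more. -/
lemma ae_integral_acceptOf {A : PTSetup M} (hA : A.EfficientLocalExploration) (i : Fin A.N) :
    ∀ᵐ x ∂A.stateLaw, ∫ y, A.acceptOf i y ∂A.coordKernel x = A.swapRate i := by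
  have hV := M.measurable_V
  have h : ∀ᵐ x ∂A.stateLaw, ∀ k, (A.K k (x k)).map M.V = (M.annealed (A.β k)).map M.V :=
    ae_all_iff.2 fun k => (measurePreserving_eval (fun i =>
      M.annealed (A.β i)) k).quasiMeasurePreserving.ae (hA.ae_map_V k)
  filter_upwards [h] with x hx
  rw [← integral_acceptOf_stateLaw]
  set F : (Fin (A.N + 1) → ℝ) → ℝ := fun v =>
    Real.exp (min 0 ((A.β i.succ - A.β i.castSucc) * (v i.succ - v i.castSucc))) with hF
  have hFm : Measurable F := by fun_prop
  have hVm : Measurable fun (y : Fin (A.N + 1) → X) k => M.V (y k) := by fun_prop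
  have key : ∀ κ : Measure (Fin (A.N + 1) → X),
      ∫ y, A.acceptOf i y ∂κ = ∫ v, F v ∂(κ.map fun y k => M.V (y k)) := fun κ => by
    rw [integral_map hVm.aemeasurable hFm.aestronglyMeasurable]
    rfl
  rw [key, key, coordKernel_apply, stateLaw, Measure.pi_map_pi fun _ => hV.aemeasurable,
    Measure.pi_map_pi fun _ => hV.aemeasurable]
  simp_rw [hx]

end PTSetup

/-! ### One scan of the algorithm -/

lemma integrable_of_abs_le {α : Type*} [MeasurableSpace α] {μ : Measure α} [IsFiniteMeasure μ]
    {f : α → ℝ} (hf : Measurable f) {C : ℝ} (hC : ∀ x, |f x| ≤ C) : Integrable f μ :=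
  Integrable.of_bound hf.aestronglyMeasurable C (ae_of_all _ fun x => by
    rw [Real.norm_eq_abs]; exact hC x)

lemma exists_abs_le_of_finite {ι : Type*} [Finite ι] (f : ι → ℝ) : ∃ C, 0 ≤ C ∧ ∀ i, |f i| ≤ C := by
  obtain ⟨C, hC⟩ := (Set.finite_range fun i => |f i|).bddAbove
  exact ⟨max C 0, le_max_right _ _, fun i => (hC ⟨i, rfl⟩).trans (le_max_left _ _)⟩

instance discretePerm (n : ℕ) : DiscreteMeasurableSpace (Equiv.Perm (Fin n)) :=
  ⟨fun _ => trivial⟩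

namespace PTSetup
variable {X : Type*} [MeasurableSpace X] {M : TemperingModel X} (A : PTSetup M)

lemma integral_swapKernel (i : Fin A.N) (z : PTState X A.N) {f : PTState X A.N → ℝ}
    (hf : Measurable f) :
    ∫ y, f y ∂A.swapKernel i z = f z + A.accept i z * (f (A.swapState i z) - f z) := by
  change ∫ y, f y ∂(ENNReal.ofReal (1 - A.accept i z) • Measure.dirac z +
    ENNReal.ofReal (A.accept i z) • Measure.dirac (A.swapState i z)) = _
  have hi : ∀ w : PTState X A.N, Integrable f (Measure.dirac w) := fun w =>
    integrable_dirac' hf.stronglyMeasurable (by simp)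
  rw [integral_add_measure ((hi _).smul_measure (by simp)) ((hi _).smul_measure (by simp)),
    integral_smul_measure, integral_smul_measure, integral_dirac' _ _ hf.stronglyMeasurable,
    integral_dirac' _ _ hf.stronglyMeasurable,
    ENNReal.toReal_ofReal (sub_nonneg.2 (A.accept_le_one i z)),
    ENNReal.toReal_ofReal (A.accept_nonneg i z)]
  simp only [smul_eq_mul]
  ring

/-- The composition of the swap kernels along a list of edges. -/
def swapsKernel (l : List (Fin A.N)) : Kernel (PTState X A.N) (PTState X A.N) :=
  (l.map fun i => A.swapKernel i).foldr (fun κ η => κ ∘ₖ η) Kernel.id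

lemma swapsKernel_cons (i : Fin A.N) (l : List (Fin A.N)) :
    A.swapsKernel (i :: l) = A.swapKernel i ∘ₖ A.swapsKernel l := rfl

instance (l : List (Fin A.N)) : IsMarkovKernel (A.swapsKernel l) := by
  induction l with
  | nil => exact inferInstanceAs (IsMarkovKernel (Kernel.id : Kernel (PTState X A.N) _))
  | cons i l ih => rw [swapsKernel_cons]; infer_instance

lemma integral_swapsKernel_of_invariant {l : List (Fin A.N)} {f : PTState X A.N → ℝ}
    (hf : Measurable f) {C : ℝ} (hC : ∀ z, |f z| ≤ C)
    (hinv : ∀ i ∈ l, ∀ z, f (A.swapState i z) = f z) (z : PTState X A.N) :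
    ∫ y, f y ∂A.swapsKernel l z = f z := by
  induction l with
  | nil =>
    change ∫ y, f y ∂(Kernel.id z) = f z
    rw [Kernel.id_apply, integral_dirac' _ _ hf.stronglyMeasurable]
  | cons i l ih =>
    rw [swapsKernel_cons, Kernel.integral_comp (integrable_of_abs_le hf hC)]
    simp_rw [A.integral_swapKernel i _ hf, hinv i List.mem_cons_self, sub_self, mul_zero, add_zero]
    exact ih fun i hi => hinv i (List.mem_cons_of_mem _ hi)

/-- Two edges are apart if they share no vertex. -/
def Apart {N : ℕ} (i k : Fin N) : Prop := (i : ℕ) + 1 < k ∨ (k : ℕ) + 1 < i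

lemma Apart.ne {N : ℕ} {i k : Fin N} (h : Apart i k) : i.castSucc ≠ k.castSucc ∧
    i.castSucc ≠ k.succ ∧ i.succ ≠ k.castSucc ∧ i.succ ≠ k.succ := by
  unfold Apart at h
  refine ⟨?_, ?_, ?_, ?_⟩ <;>
  · intro e
    have := congrArg Fin.val e
    simp at this
    omega

lemma measurable_index (j : Fin (A.N + 1)) : Measurable fun z : PTState X A.N => z.2 j :=
  (Measurable.of_discrete (f := fun σ : Equiv.Perm (Fin (A.N + 1)) => σ j)).comp measurable_snd

/-- Since the swaps act on disjoint pairs, a machine feels at most one of them, so their effects on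
its index add up. -/
lemma integral_swapsKernel_index {l : List (Fin A.N)} (hl : l.Pairwise Apart)
    (φ : Fin (A.N + 1) → ℝ) (j : Fin (A.N + 1)) (z : PTState X A.N) :
    ∫ y, φ (y.2 j) ∂A.swapsKernel l z = φ (z.2 j) + (l.map fun i => A.accept i z *
      (φ (Equiv.swap i.castSucc i.succ (z.2 j)) - φ (z.2 j))).sum := by
  obtain ⟨C, hC0, hC⟩ := exists_abs_le_of_finite φ
  have hm : ∀ ψ : Fin (A.N + 1) → ℝ, Measurable fun z : PTState X A.N => ψ (z.2 j) := fun ψ =>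
    Measurable.of_discrete.comp (A.measurable_index j)
  induction l with
  | nil =>
    change ∫ y, φ (y.2 j) ∂(Kernel.id z) = _
    rw [Kernel.id_apply, integral_dirac' _ _ (hm φ).stronglyMeasurable]
    simp
  | cons i l ih =>
    rw [List.pairwise_cons] at hl
    set ψ : Fin (A.N + 1) → ℝ := fun k => φ (Equiv.swap i.castSucc i.succ k) - φ k with hψ
    have hψC : ∀ k, |ψ k| ≤ 2 * C := fun k => by
      refine (abs_sub _ _).trans ?_
      linarith [hC k, hC (Equiv.swap i.castSucc i.succ k)]
    have hmψ : Measurable fun y : PTState X A.N => A.accept i y * ψ (y.2 j) :=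
      (A.measurable_accept i).mul (hm ψ)
    have hbψ : ∀ y : PTState X A.N, |A.accept i y * ψ (y.2 j)| ≤ 2 * C := fun y => by
      rw [abs_mul, abs_of_nonneg (A.accept_nonneg i y)]
      exact (mul_le_of_le_one_left (abs_nonneg _) (A.accept_le_one i y)).trans (hψC _)
    rw [swapsKernel_cons, Kernel.integral_comp (integrable_of_abs_le (hm φ) fun z => hC _)]
    simp_rw [A.integral_swapKernel i _ (hm φ)]
    have h1 : ∀ y : PTState X A.N, φ (y.2 j) + A.accept i y * (φ ((A.swapState i y).2 j) -
        φ (y.2 j)) = φ (y.2 j) + A.accept i y * ψ (y.2 j) := fun y => rfl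
    simp_rw [h1]
    rw [integral_add (integrable_of_abs_le (hm φ) fun z => hC _) (integrable_of_abs_le hmψ hbψ),
      ih hl.2, A.integral_swapsKernel_of_invariant hmψ hbψ, List.map_cons, List.sum_cons]
    · ring
    · -- a swap away from the edge `i` changes neither the energies nor the index on that edge
      intro k hk y
      obtain ⟨n1, n2, n3, n4⟩ := (hl.1 k hk).ne
      have ha : A.accept i (A.swapState k y) = A.accept i y := by
        simp only [accept, swapState, Equiv.swap_apply_of_ne_of_ne n1 n2,
          Equiv.swap_apply_of_ne_of_ne n3 n4]
      have hs : ψ ((A.swapState k y).2 j) = ψ (y.2 j) := by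
        change ψ (Equiv.swap k.castSucc k.succ (y.2 j)) = ψ (y.2 j)
        have h0 : ∀ v, v ≠ i.castSucc → v ≠ i.succ → ψ v = 0 := fun v h1 h2 => by
          simp only [hψ, Equiv.swap_apply_of_ne_of_ne h1 h2, sub_self]
        rcases eq_or_ne (y.2 j) k.castSucc with h1 | h1
        · rw [h1, Equiv.swap_apply_left, h0 _ n2.symm n4.symm, h0 _ n1.symm n3.symm]
        rcases eq_or_ne (y.2 j) k.succ with h2 | h2
        · rw [h2, Equiv.swap_apply_right, h0 _ n2.symm n4.symm, h0 _ n1.symm n3.symm]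
        rw [Equiv.swap_apply_of_ne_of_ne h1 h2]
      rw [ha, hs]

lemma sum_map_filter_eq {α : Type*} (l : List α) (p : α → Prop) [DecidablePred p] (f : α → ℝ) :
    ((l.filter fun a => p a).map f).sum = (l.map fun a => if p a then f a else 0).sum := by
  induction l with
  | nil => rfl
  | cons a l ih =>
    by_cases h : p a
    · simp [h, ih]
    · simp [h, ih]

lemma commKernel_eq (b : Bool) : A.commKernel b =
    A.swapsKernel ((List.finRange A.N).filter fun i : Fin A.N => ProposedAt b i) := rfl

lemma pairwise_apart (N : ℕ) (b : Bool) :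
    ((List.finRange N).filter fun i : Fin N => ProposedAt b i).Pairwise Apart := by
  refine List.Pairwise.imp_of_mem (R := (· ≠ ·)) ?_ ((List.nodup_finRange N).filter _)
  intro i k hi hk hne
  simp only [List.mem_filter, List.mem_finRange, true_and, decide_eq_true_eq] at hi hk
  have hik : (i : ℕ) ≠ k := fun h => hne (Fin.ext h)
  unfold ProposedAt at hi hk
  unfold Apart
  by_contra! h
  have h2 : (i : ℕ) + 1 = k ∨ (k : ℕ) + 1 = i := by omega
  have h3 : Even (i : ℕ) ↔ Even (k : ℕ) := hi.trans hk.symm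
  rcases h2 with h2 | h2
  · rw [← h2, Nat.even_add_one] at h3; tauto
  · rw [← h2, Nat.even_add_one] at h3; tauto

/-- The communication step moves the index of machine `j` along the proposed edges at it. -/
lemma integral_commKernel_index (b : Bool) (φ : Fin (A.N + 1) → ℝ) (j : Fin (A.N + 1))
    (z : PTState X A.N) :
    ∫ y, φ (y.2 j) ∂A.commKernel b z = φ (z.2 j) + ∑ i : Fin A.N, if ProposedAt b i then
      A.accept i z * (φ (Equiv.swap i.castSucc i.succ (z.2 j)) - φ (z.2 j)) else 0 := by
  rw [commKernel_eq, A.integral_swapsKernel_index (pairwise_apart _ _), sum_map_filter_eq,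
    Fin.sum_univ_def]

lemma integral_explKernel (z : PTState X A.N) {f : PTState X A.N → ℝ} (hf : Measurable f) :
    ∫ y, f y ∂A.explKernel z = ∫ x, f (x, z.2) ∂A.coordKernel z.1 := by
  rw [explKernel_apply, Measure.prod_dirac, integral_map (by fun_prop) hf.aestronglyMeasurable]

lemma commExplKernel_apply (z : PTFullState X A.N) :
    A.commExplKernel z = (A.explKernel ∘ₖ A.commKernel z.2) z.1 := by
  obtain ⟨y, b⟩ := z
  rw [commExplKernel, Kernel.piecewise_apply]
  cases b
  · rw [if_neg (by simp)]; rfl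
  · rw [if_pos (by rfl)]; rfl

lemma integral_scanKernel (prop : ℕ → PMF Bool) (n : ℕ) (z : PTFullState X A.N)
    {f : PTFullState X A.N → ℝ} (hf : Measurable f) {C : ℝ} (hC : ∀ z, |f z| ≤ C) :
    ∫ y, f y ∂A.scanKernel prop n z = ∑ b, (prop (n + 1) b).toReal *
      ∫ y, ∫ x, f ((x, y.2), b) ∂A.coordKernel y.1 ∂A.commKernel z.2 z.1 := by
  rw [scanKernel, Kernel.prod_apply, Kernel.const_apply,
    integral_prod_symm _ (integrable_of_abs_le hf hC), PMF.integral_eq_sum]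
  refine Finset.sum_congr rfl fun b _ => ?_
  have hfb : Measurable fun y : PTState X A.N => f (y, b) := by fun_prop
  rw [smul_eq_mul, commExplKernel_apply,
    Kernel.integral_comp (integrable_of_abs_le hfb fun _ => hC _)]
  simp_rw [A.integral_explKernel _ hfb]

/-- Averages over the labels (the permutation and the type of proposals) are not affected by
conditioning on the acceptance of a swap. -/
def EnergyIndep (ν : Measure (PTFullState X A.N)) : Prop :=
  ∀ (i : Fin A.N) (h : Equiv.Perm (Fin (A.N + 1)) → Bool → ℝ),
    ∫ z, h z.1.2 z.2 * A.acceptOf i z.1.1 ∂ν = A.swapRate i * ∫ z, h z.1.2 z.2 ∂ν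

/-- The expectation of `φ` after one step of the index process: a machine at the index `i`, with
proposals of type `b`, crosses the proposed edge at `i` with the mean acceptance probability. -/
def stepOp (p : PMF Bool) (φ : Fin (A.N + 1) → Bool → ℝ) (i : Fin (A.N + 1)) (b : Bool) : ℝ :=
  ∑ c, (p c).toReal * (φ i c + ∑ k : Fin A.N, if ProposedAt b k then
    A.swapRate k * (φ (Equiv.swap k.castSucc k.succ i) c - φ i c) else 0)

lemma measurable_label {β : Type*} [MeasurableSpace β]
    (h : Equiv.Perm (Fin (A.N + 1)) → Bool → β) :
    Measurable fun z : PTFullState X A.N => h z.1.2 z.2 :=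
  (Measurable.of_discrete (f := fun q : Equiv.Perm (Fin (A.N + 1)) × Bool => h q.1 q.2)).comp
    ((measurable_snd.comp measurable_fst).prodMk measurable_snd)

lemma exists_abs_label_le (h : Equiv.Perm (Fin (A.N + 1)) → Bool → ℝ) :
    ∃ C, 0 ≤ C ∧ ∀ σ b, |h σ b| ≤ C := by
  obtain ⟨C, h0, hC⟩ := exists_abs_le_of_finite
    fun q : Equiv.Perm (Fin (A.N + 1)) × Bool => h q.1 q.2
  exact ⟨C, h0, fun σ b => hC (σ, b)⟩

lemma integrable_label (ν : Measure (PTFullState X A.N)) [IsFiniteMeasure ν]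
    (h : Equiv.Perm (Fin (A.N + 1)) → Bool → ℝ) :
    Integrable (fun z : PTFullState X A.N => h z.1.2 z.2) ν := by
  obtain ⟨C, -, hC⟩ := A.exists_abs_label_le h
  exact integrable_of_abs_le (A.measurable_label h) fun z => hC _ _

lemma measurable_label_mul_acceptOf (i : Fin A.N) (h : Equiv.Perm (Fin (A.N + 1)) → Bool → ℝ) :
    Measurable fun z : PTFullState X A.N => h z.1.2 z.2 * A.acceptOf i z.1.1 :=
  (A.measurable_label h).mul ((A.measurable_acceptOf i).comp (measurable_fst.comp measurable_fst))

lemma abs_mul_acceptOf_le (i : Fin A.N) {C t : ℝ} (ht : |t| ≤ C) (x : Fin (A.N + 1) → X) :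
    |t * A.acceptOf i x| ≤ C := by
  rw [abs_mul, abs_of_nonneg (A.acceptOf_nonneg i x)]
  exact (mul_le_of_le_one_right (abs_nonneg _) (A.acceptOf_le_one i x)).trans ht

lemma integrable_label_mul_acceptOf (ν : Measure (PTFullState X A.N)) [IsFiniteMeasure ν]
    (i : Fin A.N) (h : Equiv.Perm (Fin (A.N + 1)) → Bool → ℝ) :
    Integrable (fun z : PTFullState X A.N => h z.1.2 z.2 * A.acceptOf i z.1.1) ν := by
  obtain ⟨C, -, hC⟩ := A.exists_abs_label_le h
  exact integrable_of_abs_le (A.measurable_label_mul_acceptOf i h) fun z =>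
    A.abs_mul_acceptOf_le i (hC _ _) _

lemma integral_measure_comp {α β : Type*} [MeasurableSpace α] [MeasurableSpace β]
    {ν : Measure α} {κ : Kernel α β} {f : β → ℝ} (hf : Integrable f (κ ∘ₘ ν)) :
    ∫ y, f y ∂(κ ∘ₘ ν) = ∫ x, ∫ y, f y ∂κ x ∂ν := by
  rw [Measure.comp_eq_comp_const_apply] at hf ⊢
  rw [Kernel.integral_comp hf, Kernel.const_apply]

/-- If the labels are independent of the energies, the index of a machine moves as a Markov chain
with the step operator `stepOp`. -/
lemma EnergyIndep.integral_scan {A : PTSetup M} {ν : Measure (PTFullState X A.N)}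
    [IsFiniteMeasure ν] (hν : A.EnergyIndep ν) (prop : ℕ → PMF Bool) (n : ℕ)
    (φ : Fin (A.N + 1) → Bool → ℝ) (j : Fin (A.N + 1)) :
    ∫ z, φ (z.1.2 j) z.2 ∂(A.scanKernel prop n ∘ₘ ν) =
      ∫ z, A.stepOp (prop (n + 1)) φ (z.1.2 j) z.2 ∂ν := by
  obtain ⟨C, hC0, hC⟩ := A.exists_abs_label_le fun σ c => φ (σ j) c
  have hm := A.measurable_label (X := X) fun σ c => φ (σ j) c
  rw [integral_measure_comp (A.integrable_label _ fun σ c => φ (σ j) c)]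
  have h1 : ∀ z : PTFullState X A.N, ∫ y, φ (y.1.2 j) y.2 ∂A.scanKernel prop n z =
      ∑ c, (prop (n + 1) c).toReal * (φ (z.1.2 j) c + ∑ k : Fin A.N, if ProposedAt z.2 k then
        (φ (Equiv.swap k.castSucc k.succ (z.1.2 j)) c - φ (z.1.2 j) c) * A.acceptOf k z.1.1
          else 0) := fun z => by
    rw [A.integral_scanKernel prop n z hm fun z => hC _ _]
    refine Finset.sum_congr rfl fun c _ => ?_
    simp only [integral_const, probReal_univ, one_smul]
    rw [A.integral_commKernel_index z.2 (fun i => φ i c) j z.1]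
    simp_rw [A.accept_eq, mul_comm (A.acceptOf _ _)]
  simp_rw [h1, stepOp]
  set g : Bool → Fin A.N → Equiv.Perm (Fin (A.N + 1)) → Bool → ℝ := fun c k σ b =>
    if ProposedAt b k then φ (Equiv.swap k.castSucc k.succ (σ j)) c - φ (σ j) c else 0 with hg
  have e1 : ∀ (c : Bool) (k : Fin A.N) (z : PTFullState X A.N), (if ProposedAt z.2 k then
      (φ (Equiv.swap k.castSucc k.succ (z.1.2 j)) c - φ (z.1.2 j) c) * A.acceptOf k z.1.1
          else 0) = g c k z.1.2 z.2 * A.acceptOf k z.1.1 := fun c k z => by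
    simp only [hg]; split_ifs <;> simp
  have e2 : ∀ (c : Bool) (k : Fin A.N) (z : PTFullState X A.N), (if ProposedAt z.2 k then
      A.swapRate k * (φ (Equiv.swap k.castSucc k.succ (z.1.2 j)) c - φ (z.1.2 j) c)
          else 0) = A.swapRate k * g c k z.1.2 z.2 := fun c k z => by
    simp only [hg]; split_ifs <;> simp
  simp_rw [e1, e2]
  have i0 : ∀ c, Integrable (fun z : PTFullState X A.N => φ (z.1.2 j) c) ν := fun c =>
    A.integrable_label ν fun σ _ => φ (σ j) c
  have i1 : ∀ c k, Integrable (fun z : PTFullState X A.N =>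
      g c k z.1.2 z.2 * A.acceptOf k z.1.1) ν := fun c k =>
    A.integrable_label_mul_acceptOf ν k (g c k)
  have i2 : ∀ c k, Integrable (fun z : PTFullState X A.N =>
      A.swapRate k * g c k z.1.2 z.2) ν := fun c k => (A.integrable_label ν (g c k)).const_mul _
  have s1 : ∀ c, Integrable (fun z : PTFullState X A.N =>
      ∑ k, g c k z.1.2 z.2 * A.acceptOf k z.1.1) ν := fun c =>
    integrable_finsetSum _ fun k _ => i1 c k
  have s2 : ∀ c, Integrable (fun z : PTFullState X A.N =>
      ∑ k, A.swapRate k * g c k z.1.2 z.2) ν := fun c =>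
    integrable_finsetSum _ fun k _ => i2 c k
  rw [integral_finsetSum _ fun c _ => ?_, integral_finsetSum _ fun c _ => ?_]
  rotate_left
  · exact ((i0 c).add (s2 c)).const_mul _
  · exact ((i0 c).add (s1 c)).const_mul _
  refine Finset.sum_congr rfl fun c _ => ?_
  rw [integral_const_mul, integral_const_mul,
    integral_add (i0 c) (s1 c), integral_add (i0 c) (s2 c),
    integral_finsetSum _ fun k _ => i1 c k, integral_finsetSum _ fun k _ => i2 c k]
  congr 2
  refine Finset.sum_congr rfl fun k _ => ?_
  rw [hν k (g c k), integral_const_mul]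

variable {A}

lemma StatesAC.scan_comp {ν : Measure (PTFullState X A.N)} (h : A.StatesAC (ν.map Prod.fst))
    (prop : ℕ → PMF Bool) (n : ℕ) :
    A.StatesAC ((A.scanKernel prop n ∘ₘ ν).map Prod.fst) := by
  refine StatesAC.of_null fun s hs h0 => ?_
  have hs' : MeasurableSet (Prod.fst ⁻¹' s : Set (PTState X A.N)) := measurable_fst hs
  have hs'' : MeasurableSet (Prod.fst ⁻¹' (Prod.fst ⁻¹' s) : Set (PTFullState X A.N)) :=
    measurable_fst hs'
  have hb : ∀ b, ∀ᵐ z ∂ν, (A.explKernel ∘ₖ A.commKernel b) z.1 (Prod.fst ⁻¹' s) = 0 := fun b => by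
    have h1 : A.StatesAC ((A.explKernel ∘ₖ A.commKernel b) ∘ₘ ν.map Prod.fst) := by
      rw [← Measure.comp_assoc]
      exact (h.commKernel_comp b).explKernel_comp
    have h2 := h1 h0
    rw [Measure.map_apply measurable_fst hs, Measure.bind_apply hs' (Kernel.aemeasurable _),
      lintegral_eq_zero_iff (Kernel.measurable_coe _ hs')] at h2
    exact ae_of_ae_map measurable_fst.aemeasurable h2
  rw [Measure.map_apply measurable_fst hs', Measure.bind_apply hs'' (Kernel.aemeasurable _),
    lintegral_eq_zero_iff (Kernel.measurable_coe _ hs'')]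
  filter_upwards [ae_all_iff.2 hb] with z hz
  rw [scanKernel, Kernel.prod_apply, ← Set.prod_univ, Measure.prod_prod, commExplKernel_apply,
    hz z.2, zero_mul, Pi.zero_apply]

/-- One scan makes the labels independent of the energies. -/
lemma energyIndep_scan_comp (hA : A.EfficientLocalExploration) {ν : Measure (PTFullState X A.N)}
    [IsFiniteMeasure ν] (h : A.StatesAC (ν.map Prod.fst)) (prop : ℕ → PMF Bool) (n : ℕ) :
    A.EnergyIndep (A.scanKernel prop n ∘ₘ ν) := by
  intro i g
  obtain ⟨C, hC0, hC⟩ := A.exists_abs_label_le g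
  rw [integral_measure_comp (A.integrable_label_mul_acceptOf _ i g),
    integral_measure_comp (A.integrable_label _ g), ← integral_const_mul]
  have hb : ∀ b, ∀ᵐ z ∂ν, ∀ᵐ y ∂A.commKernel b z.1,
      ∫ x, A.acceptOf i x ∂A.coordKernel y.1 = A.swapRate i := fun b =>
    ae_of_ae_map measurable_fst.aemeasurable
      (Measure.ae_ae_of_ae_comp ((h.commKernel_comp b).ae (ae_integral_acceptOf hA i)))
  refine integral_congr_ae ?_
  filter_upwards [ae_all_iff.2 hb] with z hz
  rw [A.integral_scanKernel prop n z (A.measurable_label_mul_acceptOf i g)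
      fun z => A.abs_mul_acceptOf_le i (hC _ _) _,
    A.integral_scanKernel prop n z (A.measurable_label g) fun z => hC _ _, Finset.mul_sum]
  refine Finset.sum_congr rfl fun c _ => ?_
  rw [mul_left_comm, ← integral_const_mul (A.swapRate i)]
  congr 1
  refine integral_congr_ae ?_
  filter_upwards [hz z.2] with y hy
  simp only [integral_const, probReal_univ, one_smul]
  rw [integral_const_mul, hy, mul_comm]

end PTSetup

/-! ### Trajectories and cyclic potentials -/

/-- The index-direction pair of a machine at the bottom, about to move up. -/
def IsBottom {N : ℕ} (i : Fin (N + 1)) (b : Bool) : Prop := i = 0 ∧ ¬ProposedAt b i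

/-- The index-direction pair of a machine at the top, about to move down. -/
def IsApex {N : ℕ} (i : Fin (N + 1)) (b : Bool) : Prop := i = Fin.last N ∧ ProposedAt b i

open scoped Classical in
/-- The update of the climbing phase upon observing index `i` and proposal type `b`. -/
def phaseStep {N : ℕ} (q : Bool) (i : Fin (N + 1)) (b : Bool) : Bool :=
  if q then !decide (IsApex i b) else decide (IsBottom i b)

lemma atBottom_iff {X : Type*} {N : ℕ} (ω : ℕ → PTFullState X N) (j : Fin (N + 1)) (n : ℕ) :
    atBottom ω j n ↔ IsBottom ((ω n).1.2 j) (ω n).2 := by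
  unfold atBottom IsBottom direction indexProcess
  by_cases h : ProposedAt (ω n).2 ((ω n).1.2 j)
  · rw [if_pos h]
    exact ⟨fun x => absurd x.2 (by decide), fun x => absurd h x.2⟩
  · rw [if_neg h]
    exact ⟨fun x => ⟨x.1, h⟩, fun x => ⟨x.1, rfl⟩⟩

lemma atApex_iff {X : Type*} {N : ℕ} (ω : ℕ → PTFullState X N) (j : Fin (N + 1)) (n : ℕ) :
    atApex ω j n ↔ IsApex ((ω n).1.2 j) (ω n).2 := by
  unfold atApex IsApex direction indexProcess
  by_cases h : ProposedAt (ω n).2 ((ω n).1.2 j)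
  · rw [if_pos h]
    exact ⟨fun x => ⟨x.1, h⟩, fun x => ⟨x.1, rfl⟩⟩
  · rw [if_neg h]
    exact ⟨fun x => absurd x.2 (by decide), fun x => absurd x.2 h⟩

/-- The climbing phase of machine `j` after the observation at time `n`. -/
def climb {X : Type*} {N : ℕ} (ω : ℕ → PTFullState X N) (j : Fin (N + 1)) : ℕ → Bool :=
  climbPhase (atBottom ω j) (atApex ω j)

lemma climb_zero {X : Type*} {N : ℕ} (ω : ℕ → PTFullState X N) (j : Fin (N + 1)) :
    climb ω j 0 = phaseStep false ((ω 0).1.2 j) (ω 0).2 := by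
  simp [climb, climbPhase, phaseStep, atBottom_iff]

lemma climb_succ {X : Type*} {N : ℕ} (ω : ℕ → PTFullState X N) (j : Fin (N + 1)) (n : ℕ) :
    climb ω j (n + 1) = phaseStep (climb ω j n) ((ω (n + 1)).1.2 j) (ω (n + 1)).2 := by
  classical
  have h1 : decide (atBottom ω j (n + 1)) = decide (IsBottom ((ω (n + 1)).1.2 j) (ω (n + 1)).2) :=
    decide_eq_decide.2 (atBottom_iff ω j (n + 1))
  have h2 : decide (atApex ω j (n + 1)) = decide (IsApex ((ω (n + 1)).1.2 j) (ω (n + 1)).2) :=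
    decide_eq_decide.2 (atApex_iff ω j (n + 1))
  simp only [climb, climbPhase, phaseStep, h1, h2]
  congr

lemma climb_congr {X : Type*} {N : ℕ} {ω ω' : ℕ → PTFullState X N} (j : Fin (N + 1)) {n : ℕ}
    (h : ∀ m ≤ n, ω m = ω' m) : climb ω j n = climb ω' j n := by
  induction n with
  | zero => rw [climb_zero, climb_zero, h 0 le_rfl]
  | succ n ih => rw [climb_succ, climb_succ, ih fun m hm => h m (hm.trans n.le_succ), h _ le_rfl]

namespace PTSetup
variable {X : Type*} [MeasurableSpace X] {M : TemperingModel X} (A : PTSetup M)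

lemma measurable_climb (j : Fin (A.N + 1)) (n : ℕ) :
    Measurable fun ω : ℕ → PTFullState X A.N => climb ω j n := by
  have hlab : ∀ m, Measurable fun ω : ℕ → PTFullState X A.N => ((ω m).1.2 j, (ω m).2) := fun m =>
    (A.measurable_label (X := X) fun σ b => (σ j, b)).comp (measurable_pi_apply m)
  induction n with
  | zero =>
    simp_rw [climb_zero]
    exact (Measurable.of_discrete (f := fun q : Fin (A.N + 1) × Bool =>
      phaseStep false q.1 q.2)).comp (hlab 0)
  | succ n ih =>
    simp_rw [climb_succ]
    exact (Measurable.of_discrete (f := fun q : Bool × Fin (A.N + 1) × Bool =>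
      phaseStep q.1 q.2.1 q.2.2)).comp (ih.prodMk (hlab (n + 1)))

instance isProbabilityMeasure_initLaw (prop : ℕ → PMF Bool) :
    IsProbabilityMeasure (A.initLaw prop) :=
  inferInstanceAs (IsProbabilityMeasure ((A.stateLaw.prod A.initPerm.toMeasure).prod
    (prop 0).toMeasure))

instance isProbabilityMeasure_law (prop : ℕ → PMF Bool) : IsProbabilityMeasure (A.law prop) := by
  unfold law
  infer_instance

lemma law_map_zero (prop : ℕ → PMF Bool) :
    (A.law prop).map (fun ω => ω 0) = A.initLaw prop := by
  have h : (A.law prop).map (Preorder.frestrictLe 0) = (A.initLaw prop).map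
      (MeasurableEquiv.piUnique fun _ : Finset.Iic 0 => PTFullState X A.N).symm := by
    rw [law, Kernel.trajMeasure, Measure.map_comp _ _ (by fun_prop),
      Kernel.traj_map_frestrictLe, Kernel.partialTraj_self, Measure.id_comp]
  have h2 : (fun ω : ℕ → PTFullState X A.N => ω 0) =
      (fun g : ∀ _ : Finset.Iic 0, PTFullState X A.N => g ⟨0, by simp⟩) ∘
        Preorder.frestrictLe 0 := rfl
  rw [h2, ← Measure.map_map (measurable_pi_apply _) (by fun_prop), h,
    Measure.map_map (measurable_pi_apply _) (by fun_prop)]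
  exact Measure.map_id

/-- The Markov property at time `n`, restricted to an event of the past. -/
lemma law_restrict_map_succ (prop : ℕ → PMF Bool) (n : ℕ) {E : Set (ℕ → PTFullState X A.N)}
    (hE : MeasurableSet E) (hpast : ∀ ω ω', (∀ m ≤ n, ω m = ω' m) → (ω ∈ E ↔ ω' ∈ E)) :
    ((A.law prop).restrict E).map (fun ω => ω (n + 1)) =
      A.scanKernel prop n ∘ₘ ((A.law prop).restrict E).map (fun ω => ω n) := by
  set ext : (∀ _ : Finset.Iic n, PTFullState X A.N) → ℕ → PTFullState X A.N :=
    fun h m => h ⟨min m n, by simp⟩ with hext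
  have hextm : Measurable ext := measurable_pi_lambda _ fun m => measurable_pi_apply _
  have hE' : MeasurableSet (ext ⁻¹' E) := hextm hE
  have hEE : Preorder.frestrictLe n ⁻¹' (ext ⁻¹' E) = E := by
    ext ω
    refine hpast _ _ fun m hm => ?_
    simp only [hext, Preorder.frestrictLe_apply, min_eq_left hm]
  have hfr : Measurable (Preorder.frestrictLe (π := fun _ => PTFullState X A.N) n) := by fun_prop
  ext s hs
  rw [Measure.map_apply (by fun_prop) hs, Measure.restrict_apply (hs.preimage (by fun_prop)),
    Measure.bind_apply hs (Kernel.aemeasurable _), lintegral_map (Kernel.measurable_coe _ hs)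
    (by fun_prop)]
  have h1 : (fun ω : ℕ → PTFullState X A.N => ω (n + 1)) ⁻¹' s ∩ E =
      (fun ω => (Preorder.frestrictLe n ω, ω (n + 1))) ⁻¹' ((ext ⁻¹' E) ×ˢ s) := by
    rw [Set.mk_preimage_prod, hEE, Set.inter_comm]
  rw [h1, ← Measure.map_apply (by fun_prop) (hE'.prod hs), law,
    ← Kernel.map_frestrictLe_trajMeasure_compProd_eq_map_trajMeasure,
    Measure.compProd_apply_prod hE' hs, setLIntegral_map hE' (Kernel.measurable_coe _ hs) hfr, hEE]
  rfl

lemma law_map_succ (prop : ℕ → PMF Bool) (n : ℕ) :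
    (A.law prop).map (fun ω => ω (n + 1)) =
      A.scanKernel prop n ∘ₘ (A.law prop).map (fun ω => ω n) := by
  simpa using A.law_restrict_map_succ prop n MeasurableSet.univ (by simp)

lemma statesAC_law (prop : ℕ → PMF Bool) (n : ℕ) :
    A.StatesAC (((A.law prop).map fun ω => ω n).map Prod.fst) := by
  induction n with
  | zero =>
    rw [law_map_zero, initLaw]
    have h1 := Measure.map_fst_prod (μ := A.stateLaw.prod A.initPerm.toMeasure)
      (ν := (prop 0).toMeasure)
    have h2 := Measure.map_fst_prod (μ := A.stateLaw) (ν := A.initPerm.toMeasure)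
    rw [measure_univ, one_smul] at h1 h2
    unfold StatesAC
    rw [← stateLaw, h1, h2]
  | succ n ih =>
    rw [law_map_succ]
    exact ih.scan_comp prop n

lemma ae_toMeasure_ne_zero (p : PMF Bool) : ∀ᵐ b ∂p.toMeasure, p b ≠ 0 := by
  rw [ae_iff_of_countable]
  intro b hb
  rwa [PMF.toMeasure_apply_singleton _ _ (measurableSet_singleton b)] at hb

/-- The proposal type at time `n` lies in the support of its law. -/
lemma ae_prop_ne_zero (prop : ℕ → PMF Bool) (n : ℕ) :
    ∀ᵐ ω ∂A.law prop, prop n (ω n).2 ≠ 0 := by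
  have hm : MeasurableSet {z : PTFullState X A.N | prop n z.2 ≠ 0} :=
    (MeasurableSet.of_discrete (s := {b | prop n b ≠ 0})).preimage measurable_snd
  refine ae_of_ae_map (f := fun ω : ℕ → PTFullState X A.N => ω n)
    (p := fun z => prop n z.2 ≠ 0) (measurable_pi_apply n).aemeasurable ?_
  cases n with
  | zero =>
    rw [law_map_zero, initLaw]
    exact Measure.quasiMeasurePreserving_snd.ae (ae_toMeasure_ne_zero (prop 0))
  | succ n =>
    rw [law_map_succ]
    refine Measure.ae_comp_of_ae_ae hm (ae_of_all _ fun z => ?_)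
    rw [scanKernel, Kernel.prod_apply, Kernel.const_apply]
    exact Measure.quasiMeasurePreserving_snd.ae (ae_toMeasure_ne_zero (prop (n + 1)))

/-- The law of the full state at time `m` on the event that machine `j` is in phase `q` at
time `n`. -/
def phaseLaw (prop : ℕ → PMF Bool) (j : Fin (A.N + 1)) (n m : ℕ) (q : Bool) :
    Measure (PTFullState X A.N) :=
  ((A.law prop).restrict {ω | climb ω j n = q}).map fun ω => ω m

instance (prop : ℕ → PMF Bool) (j : Fin (A.N + 1)) (n m : ℕ) (q : Bool) :
    IsFiniteMeasure (A.phaseLaw prop j n m q) := by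
  unfold phaseLaw
  infer_instance

lemma measurableSet_climb (j : Fin (A.N + 1)) (n : ℕ) (q : Bool) :
    MeasurableSet {ω : ℕ → PTFullState X A.N | climb ω j n = q} :=
  A.measurable_climb j n (measurableSet_singleton q)

lemma phaseLaw_succ (prop : ℕ → PMF Bool) (j : Fin (A.N + 1)) (n : ℕ) (q : Bool) :
    A.phaseLaw prop j n (n + 1) q = A.scanKernel prop n ∘ₘ A.phaseLaw prop j n n q :=
  A.law_restrict_map_succ prop n (A.measurableSet_climb j n q) fun ω ω' h => by
    rw [Set.mem_ofPred_eq, Set.mem_ofPred_eq, climb_congr j h]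

lemma statesAC_phaseLaw (prop : ℕ → PMF Bool) (j : Fin (A.N + 1)) (n : ℕ) (q : Bool) :
    A.StatesAC ((A.phaseLaw prop j n n q).map Prod.fst) :=
  (((Measure.restrict_le_self.absolutelyContinuous.map (by fun_prop)).map measurable_fst).map
    measurable_fst).trans (A.statesAC_law prop n)

/-- Splitting an expectation according to the phase. -/
lemma integral_eq_sum_phaseLaw (prop : ℕ → PMF Bool) (j : Fin (A.N + 1)) (n m : ℕ)
    {f : Bool → PTFullState X A.N → ℝ} (hf : ∀ q, Measurable (f q)) {C : ℝ}
    (hC : ∀ q z, |f q z| ≤ C) :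
    ∫ ω, f (climb ω j n) (ω m) ∂A.law prop = ∑ q, ∫ z, f q z ∂A.phaseLaw prop j n m q := by
  have hm : Measurable fun ω : ℕ → PTFullState X A.N => f (climb ω j n) (ω m) :=
    (measurable_from_prod_countable_right (f := fun p : Bool × PTFullState X A.N => f p.1 p.2)
      hf).comp ((A.measurable_climb j n).prodMk (measurable_pi_apply m))
  have hs := A.measurableSet_climb j n true
  have hc : {ω : ℕ → PTFullState X A.N | climb ω j n = true}ᶜ = {ω | climb ω j n = false} := by
    ext ω; simp
  rw [← integral_add_compl hs (integrable_of_abs_le hm fun ω => hC _ _), hc, Fintype.sum_bool]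
  congr 1
  · rw [phaseLaw, integral_map (measurable_pi_apply m).aemeasurable (hf _).aestronglyMeasurable]
    refine setIntegral_congr_fun hs fun ω hω => ?_
    rw [Set.mem_ofPred_eq] at hω
    simp only [hω]
  · rw [phaseLaw, integral_map (measurable_pi_apply m).aemeasurable (hf _).aestronglyMeasurable]
    refine setIntegral_congr_fun (A.measurableSet_climb j n false) fun ω hω => ?_
    rw [Set.mem_ofPred_eq] at hω
    simp only [hω]

lemma energyIndep_initLaw (prop : ℕ → PMF Bool) : A.EnergyIndep (A.initLaw prop) := by
  intro i h
  have e : A.initLaw prop =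
    (A.stateLaw.prod A.initPerm.toMeasure).prod (prop 0).toMeasure := rfl
  rw [e, integral_prod_symm _ (A.integrable_label_mul_acceptOf _ i h),
    integral_prod_symm _ (A.integrable_label _ h), ← integral_const_mul]
  congr 1
  funext b
  have h1 := integral_prod_mul (μ := A.stateLaw) (ν := A.initPerm.toMeasure) (A.acceptOf i)
    fun σ => h σ b
  have h2 := integral_fun_snd (μ := A.stateLaw) (ν := A.initPerm.toMeasure) fun σ => h σ b
  rw [probReal_univ, one_smul] at h2
  simp only
  rw [h2, ← A.integral_acceptOf_stateLaw i, ← h1]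
  simp_rw [mul_comm]

/-- The energies at time `n` are independent of the present labels and of the past phases. -/
lemma energyIndep_phaseLaw {A : PTSetup M} (hA : A.EfficientLocalExploration)
    (prop : ℕ → PMF Bool) (j : Fin (A.N + 1)) (n : ℕ) (q : Bool) :
    A.EnergyIndep (A.phaseLaw prop j n n q) := by
  intro i h
  cases n with
  | zero =>
    set g : Equiv.Perm (Fin (A.N + 1)) → Bool → ℝ := fun σ b =>
      if phaseStep false (σ j) b = q then h σ b else 0 with hg
    have hT : MeasurableSet {z : PTFullState X A.N | phaseStep false (z.1.2 j) z.2 = q} :=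
      A.measurable_label (fun σ b => phaseStep false (σ j) b) (measurableSet_singleton q)
    have e : A.phaseLaw prop j 0 0 q = (A.initLaw prop).restrict
        {z | phaseStep false (z.1.2 j) z.2 = q} := by
      rw [← law_map_zero, Measure.restrict_map (by fun_prop) hT, phaseLaw]
      simp_rw [climb_zero]
      rfl
    have h1 := A.energyIndep_initLaw prop i g
    rw [e, ← integral_indicator hT, ← integral_indicator hT]
    convert h1 using 2
    · funext z
      simp only [hg, Set.indicator_apply, Set.mem_ofPred_eq]
      split_ifs <;> simp
    · congr 1
      funext z
      simp only [hg, Set.indicator_apply, Set.mem_ofPred_eq]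
  | succ n =>
    set g : Bool → Equiv.Perm (Fin (A.N + 1)) → Bool → ℝ := fun q' σ b =>
      if phaseStep q' (σ j) b = q then h σ b else 0 with hg
    have hs := A.measurableSet_climb (X := X) j (n + 1) q
    obtain ⟨C, hC0, hC⟩ := A.exists_abs_label_le h
    have hgC : ∀ q' σ b, |g q' σ b| ≤ C := fun q' σ b => by
      simp only [hg]
      split_ifs
      · exact hC σ b
      · simpa using hC0
    have e1 : ∫ z, h z.1.2 z.2 * A.acceptOf i z.1.1 ∂A.phaseLaw prop j (n + 1) (n + 1) q =
        ∑ q', ∫ z, g q' z.1.2 z.2 * A.acceptOf i z.1.1 ∂A.phaseLaw prop j n (n + 1) q' := by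
      rw [phaseLaw, integral_map (measurable_pi_apply (n + 1)).aemeasurable
        (A.measurable_label_mul_acceptOf i h).aestronglyMeasurable, ← integral_indicator hs,
        ← A.integral_eq_sum_phaseLaw prop j n (n + 1)
          (f := fun q' z => g q' z.1.2 z.2 * A.acceptOf i z.1.1)
          (fun q' => A.measurable_label_mul_acceptOf i (g q'))
          fun q' z => A.abs_mul_acceptOf_le i (hgC _ _ _) _]
      congr 1
      funext ω
      simp only [hg, Set.indicator_apply, Set.mem_ofPred_eq, climb_succ]
      split_ifs <;> simp
    have e2 : ∫ z, h z.1.2 z.2 ∂A.phaseLaw prop j (n + 1) (n + 1) q =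
        ∑ q', ∫ z, g q' z.1.2 z.2 ∂A.phaseLaw prop j n (n + 1) q' := by
      rw [phaseLaw, integral_map (measurable_pi_apply (n + 1)).aemeasurable
        (A.measurable_label h).aestronglyMeasurable,
        ← integral_indicator hs, ← A.integral_eq_sum_phaseLaw prop j n (n + 1)
          (f := fun q' z => g q' z.1.2 z.2) (fun q' => A.measurable_label (g q'))
          fun q' z => hgC _ _ _]
      congr 1
      funext ω
      simp only [hg, Set.indicator_apply, Set.mem_ofPred_eq, climb_succ]
    rw [e1, e2, Finset.mul_sum]
    refine Finset.sum_congr rfl fun q' _ => ?_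
    rw [phaseLaw_succ]
    exact energyIndep_scan_comp hA (A.statesAC_phaseLaw prop j n q') prop n i (g q')

/-- One step of the pair of phase and index: given the phase at time `n`, the index and proposal
type at time `n + 1` are drawn by `stepOp`. -/
lemma integral_step {A : PTSetup M} (hA : A.EfficientLocalExploration) (prop : ℕ → PMF Bool)
    (j : Fin (A.N + 1)) (n : ℕ) (Ψ : Bool → Fin (A.N + 1) → Bool → ℝ) :
    ∫ ω, Ψ (climb ω j n) ((ω (n + 1)).1.2 j) (ω (n + 1)).2 ∂A.law prop =
      ∫ ω, A.stepOp (prop (n + 1)) (Ψ (climb ω j n)) ((ω n).1.2 j) (ω n).2 ∂A.law prop := by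
  obtain ⟨C, hC0, hC⟩ := exists_abs_le_of_finite
    fun p : Bool × Fin (A.N + 1) × Bool => Ψ p.1 p.2.1 p.2.2
  obtain ⟨D, hD0, hD⟩ := exists_abs_le_of_finite
    fun p : Bool × Fin (A.N + 1) × Bool => A.stepOp (prop (n + 1)) (Ψ p.1) p.2.1 p.2.2
  rw [A.integral_eq_sum_phaseLaw prop j n (n + 1) (f := fun q z => Ψ q (z.1.2 j) z.2)
      (fun q => A.measurable_label fun σ b => Ψ q (σ j) b) fun q z => hC (q, _, _),
    A.integral_eq_sum_phaseLaw prop j n n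
      (f := fun q z => A.stepOp (prop (n + 1)) (Ψ q) (z.1.2 j) z.2)
      (fun q => A.measurable_label fun σ b => A.stepOp (prop (n + 1)) (Ψ q) (σ j) b)
      fun q z => hD (q, _, _)]
  refine Finset.sum_congr rfl fun q _ => ?_
  rw [phaseLaw_succ]
  exact (energyIndep_phaseLaw hA prop j n q).integral_scan prop n (Ψ q) j

/-- A cyclic potential with period `m`: outside the end of the current phase it decreases by one on
average in every step; it is unchanged when a climbing phase begins, and goes up by `m` when one
ends. -/
structure IsCyclePotential (prop : ℕ → PMF Bool) (F : Bool → Fin (A.N + 1) → Bool → ℝ) (m : ℝ) :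
    Prop where
  step_climb : ∀ n i b, prop n b ≠ 0 → ¬IsApex i b →
    A.stepOp (prop (n + 1)) (F true) i b = F true i b - 1
  step_descend : ∀ n i b, prop n b ≠ 0 → ¬IsBottom i b →
    A.stepOp (prop (n + 1)) (F false) i b = F false i b - 1
  apex : ∀ i b, IsApex i b → F false i b = F true i b + m
  bottom : ∀ i b, IsBottom i b → F true i b = F false i b

lemma not_isBottom_and_isApex {N : ℕ} {i : Fin (N + 1)} {b : Bool} (h : IsBottom i b) :
    ¬IsApex i b := fun h' => h.2 h'.2

open scoped Classical in
/-- `m` times the expected number of completed climbs, up to the bounded potential, is the time. -/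
lemma IsCyclePotential.integral_climbCount {A : PTSetup M} (hA : A.EfficientLocalExploration)
    {prop : ℕ → PMF Bool} {F : Bool → Fin (A.N + 1) → Bool → ℝ} {m : ℝ}
    (hF : A.IsCyclePotential prop F m) (j : Fin (A.N + 1)) (n : ℕ) :
    Integrable (fun ω => (climbCount (atBottom ω j) (atApex ω j) n : ℝ)) (A.law prop) ∧
    m * ∫ ω, (climbCount (atBottom ω j) (atApex ω j) n : ℝ) ∂A.law prop = n +
      (∫ ω, F (climb ω j n) ((ω n).1.2 j) (ω n).2 ∂A.law prop) -
        ∫ ω, F (climb ω j 0) ((ω 0).1.2 j) (ω 0).2 ∂A.law prop := by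
  have hmeas : ∀ (f : Bool → Fin (A.N + 1) → Bool → ℝ) (k l : ℕ),
      Integrable (fun ω => f (climb ω j k) ((ω l).1.2 j) (ω l).2) (A.law prop) := fun f k l => by
    obtain ⟨C, hC0, hC⟩ := exists_abs_le_of_finite
      fun p : Bool × Fin (A.N + 1) × Bool => f p.1 p.2.1 p.2.2
    refine integrable_of_abs_le (C := C) ?_ fun ω => hC (_, _, _)
    exact (Measurable.of_discrete (f := fun q : Bool × Fin (A.N + 1) × Bool =>
      f q.1 q.2.1 q.2.2)).comp ((A.measurable_climb j k).prodMk
        ((A.measurable_label (X := X) fun σ b => (σ j, b)).comp (measurable_pi_apply l)))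
  induction n with
  | zero => simp [climbCount]
  | succ n ih =>
    obtain ⟨ih1, ih2⟩ := ih
    set G : Bool → Fin (A.N + 1) → Bool → ℝ := fun q i b =>
      if q = true ∧ IsApex i b then 1 else 0 with hG
    have hcount : ∀ ω : ℕ → PTFullState X A.N,
        (climbCount (atBottom ω j) (atApex ω j) (n + 1) : ℝ) =
        climbCount (atBottom ω j) (atApex ω j) n +
          G (climb ω j n) ((ω (n + 1)).1.2 j) (ω (n + 1)).2 := fun ω => by
      rw [climbCount, Finset.sum_range_succ, Nat.cast_add, ← climbCount]
      congr 1
      simp only [hG, ← atApex_iff]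
      push_cast
      rfl
    simp_rw [hcount]
    refine ⟨ih1.add (hmeas G n (n + 1)), ?_⟩
    -- the update of the phase changes the potential only at the end of a climb
    have hupd : ∀ q i b, F (phaseStep q i b) i b = F q i b + m * G q i b := fun q i b => by
      cases q
      · by_cases hb : IsBottom i b
        · simp [phaseStep, hG, hb, hF.bottom i b hb]
        · simp [phaseStep, hG, hb]
      · by_cases ha : IsApex i b
        · simp [phaseStep, hG, ha, hF.apex i b ha]
        · simp [phaseStep, hG, ha]
    -- the phase in force is never one that the present state ends
    have hnt : ∀ k (ω : ℕ → PTFullState X A.N), ∃ q, climb ω j k =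
        phaseStep q ((ω k).1.2 j) (ω k).2 := fun k ω => by
      cases k with
      | zero => exact ⟨_, climb_zero ω j⟩
      | succ k => exact ⟨_, climb_succ ω j k⟩
    have hstep : ∀ᵐ ω ∂A.law prop,
        A.stepOp (prop (n + 1)) (F (climb ω j n)) ((ω n).1.2 j) (ω n).2 =
          F (climb ω j n) ((ω n).1.2 j) (ω n).2 - 1 := by
      filter_upwards [A.ae_prop_ne_zero prop n] with ω hω
      obtain ⟨q, hq⟩ := hnt n ω
      rcases hc : climb ω j n with _ | _
      · refine hF.step_descend n _ _ hω fun hb => ?_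
        rw [hc] at hq
        cases q
        · simp [phaseStep, hb] at hq
        · simp [phaseStep, not_isBottom_and_isApex hb] at hq
      · refine hF.step_climb n _ _ hω fun ha => ?_
        have hb : ¬IsBottom ((ω n).1.2 j) (ω n).2 := fun hb => not_isBottom_and_isApex hb ha
        rw [hc] at hq
        cases q
        · simp [phaseStep, hb] at hq
        · simp [phaseStep, ha] at hq
    have e1 := integral_step hA prop j n F
    rw [integral_congr_ae hstep, integral_sub (hmeas F n n) (integrable_const _)] at e1
    simp only [integral_const, probReal_univ, one_smul] at e1
    have e2 : ∫ ω, F (climb ω j (n + 1)) ((ω (n + 1)).1.2 j) (ω (n + 1)).2 ∂A.law prop =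
        (∫ ω, F (climb ω j n) ((ω (n + 1)).1.2 j) (ω (n + 1)).2 ∂A.law prop) +
          m * ∫ ω, G (climb ω j n) ((ω (n + 1)).1.2 j) (ω (n + 1)).2 ∂A.law prop := by
      simp_rw [climb_succ, hupd]
      rw [integral_add (hmeas F n (n + 1)) ((hmeas G n (n + 1)).const_mul m), integral_const_mul]
    rw [integral_add ih1 (hmeas G n (n + 1)), mul_add, ih2, e2, e1]
    push_cast
    ring

/-- A cyclic potential determines the round trip rate. -/
lemma IsCyclePotential.tendsto_meanRestarts {A : PTSetup M} (hA : A.EfficientLocalExploration)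
    {prop : ℕ → PMF Bool} {F : Bool → Fin (A.N + 1) → Bool → ℝ} {m : ℝ}
    (hF : A.IsCyclePotential prop F m) (hm : m ≠ 0) :
    (∀ n, Integrable (fun ω => (annealedRestarts ω n : ℝ)) (A.law prop)) ∧
    Tendsto (A.meanRestarts prop) atTop (𝓝 ((A.N + 1) / m)) := by
  have hr : ∀ (ω : ℕ → PTFullState X A.N) n, (annealedRestarts ω n : ℝ) =
      ∑ j, (climbCount (atBottom ω j) (atApex ω j) n : ℝ) := fun ω n => by
    rw [annealedRestarts_eq_sum_climbCount]; push_cast; rfl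
  refine ⟨fun n => ?_, ?_⟩
  · simp_rw [hr]
    exact integrable_finsetSum _ fun j _ => (hF.integral_climbCount hA j n).1
  obtain ⟨C, hC0, hC⟩ := exists_abs_le_of_finite
    fun p : Bool × Fin (A.N + 1) × Bool => F p.1 p.2.1 p.2.2
  have hb : ∀ j n, |∫ ω, F (climb ω j n) ((ω n).1.2 j) (ω n).2 ∂A.law prop| ≤ C := fun j n => by
    rw [← Real.norm_eq_abs]
    refine (norm_integral_le_of_norm_le_const (C := C) (ae_of_all _ fun ω => ?_)).trans_eq
      (by simp)
    rw [Real.norm_eq_abs]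
    exact hC (_, _, _)
  set R : ℕ → ℝ := fun n => ∑ j : Fin (A.N + 1),
    ((∫ ω, F (climb ω j n) ((ω n).1.2 j) (ω n).2 ∂A.law prop) -
        ∫ ω, F (climb ω j 0) ((ω 0).1.2 j) (ω 0).2 ∂A.law prop) with hR
  have hRb : ∀ n, |R n| ≤ (A.N + 1) * (2 * C) := fun n => by
    refine (Finset.abs_sum_le_sum_abs _ _).trans ?_
    refine (Finset.sum_le_sum (g := fun _ => 2 * C) fun j _ => ?_).trans_eq (by simp)
    refine (abs_sub _ _).trans ?_
    linarith [hb j n, hb j 0]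
  have key : ∀ n, ∫ ω, (annealedRestarts ω n : ℝ) ∂A.law prop = ((A.N + 1) * n + R n) / m := by
    intro n
    simp_rw [hr]
    rw [integral_finsetSum _ fun j _ => (hF.integral_climbCount hA j n).1, eq_div_iff hm,
      Finset.sum_mul]
    have h1 : ∀ j, (∫ ω, (climbCount (atBottom ω j) (atApex ω j) n : ℝ) ∂A.law prop) * m =
        n + ((∫ ω, F (climb ω j n) ((ω n).1.2 j) (ω n).2 ∂A.law prop) -
        ∫ ω, F (climb ω j 0) ((ω 0).1.2 j) (ω 0).2 ∂A.law prop) := fun j => by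
      rw [mul_comm, (hF.integral_climbCount hA j n).2]; ring
    simp_rw [h1]
    rw [Finset.sum_add_distrib]
    simp [hR]
  have hlim : Tendsto (fun n : ℕ => R n / n) atTop (𝓝 0) := by
    refine squeeze_zero_norm (a := fun n : ℕ => (A.N + 1) * (2 * C) / (n : ℝ)) (fun n => ?_)
      (tendsto_const_div_atTop_nhds_zero_nat _)
    rw [Real.norm_eq_abs, abs_div, Nat.abs_cast]
    exact div_le_div_of_nonneg_right (hRb n) (Nat.cast_nonneg n)
  have hlim2 : Tendsto (fun n : ℕ => ((A.N : ℝ) + 1) / m + R n / n / m) atTop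
      (𝓝 (((A.N : ℝ) + 1) / m + 0 / m)) := tendsto_const_nhds.add (hlim.div_const m)
  rw [zero_div, add_zero] at hlim2
  refine hlim2.congr' ?_
  filter_upwards [eventually_gt_atTop 0] with n hn
  have hn' : (n : ℝ) ≠ 0 := Nat.cast_ne_zero.2 hn.ne'
  rw [meanRestarts, key]
  field_simp

end PTSetup

/-! ### Exact round trip rates -/

lemma proposedAt_not {b : Bool} {k : ℕ} : ProposedAt (!b) k ↔ ¬ProposedAt b k := by
  unfold ProposedAt
  cases b <;> by_cases h : Even k <;> simp [h]

lemma proposedAt_succ {b : Bool} {k : ℕ} : ProposedAt b (k + 1) ↔ ¬ProposedAt b k := by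
  unfold ProposedAt
  rw [Nat.even_add_one]
  tauto

namespace PTSetup
variable {X : Type*} [MeasurableSpace X] {M : TemperingModel X} (A : PTSetup M)

/-- The mean of `φ i` over the proposal type. -/
def propMean (p : PMF Bool) (φ : Fin (A.N + 1) → Bool → ℝ) (i : Fin (A.N + 1)) : ℝ :=
  ∑ c, (p c).toReal * φ i c

lemma stepOp_eq_propMean (p : PMF Bool) (φ : Fin (A.N + 1) → Bool → ℝ) (i : Fin (A.N + 1))
    (b : Bool) : A.stepOp p φ i b = A.propMean p φ i + ∑ k : Fin A.N, if ProposedAt b k then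
      A.swapRate k * (A.propMean p φ (Equiv.swap k.castSucc k.succ i) - A.propMean p φ i)
      else 0 := by
  simp only [stepOp, propMean, mul_add, Finset.sum_add_distrib, Finset.mul_sum]
  congr 1
  rw [Finset.sum_comm]
  refine Finset.sum_congr rfl fun k _ => ?_
  split_ifs
  · rw [← Finset.sum_sub_distrib, Finset.mul_sum]
    exact Finset.sum_congr rfl fun c _ => by ring
  · simp

lemma stepOp_castSucc (p : PMF Bool) (φ : Fin (A.N + 1) → Bool → ℝ) {k : Fin A.N} {b : Bool}
    (hb : ProposedAt b k) : A.stepOp p φ k.castSucc b = A.propMean p φ k.castSucc +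
      A.swapRate k * (A.propMean p φ k.succ - A.propMean p φ k.castSucc) := by
  rw [stepOp_eq_propMean, Finset.sum_eq_single k, if_pos hb, Equiv.swap_apply_left]
  · intro l _ hl
    split_ifs with h
    · rw [Equiv.swap_apply_of_ne_of_ne (fun h' => hl (Fin.castSucc_injective _ h').symm), sub_self,
        mul_zero]
      intro h'
      have : (k : ℕ) = l + 1 := by simpa using congrArg Fin.val h'
      rw [this, proposedAt_succ] at hb
      exact hb h
    · rfl
  · simp

lemma stepOp_succ (p : PMF Bool) (φ : Fin (A.N + 1) → Bool → ℝ) {k : Fin A.N} {b : Bool}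
    (hb : ProposedAt b k) : A.stepOp p φ k.succ b = A.propMean p φ k.succ +
      A.swapRate k * (A.propMean p φ k.castSucc - A.propMean p φ k.succ) := by
  rw [stepOp_eq_propMean, Finset.sum_eq_single k, if_pos hb, Equiv.swap_apply_right]
  · intro l _ hl
    split_ifs with h
    · rw [Equiv.swap_apply_of_ne_of_ne _ (fun h' => hl (Fin.succ_injective _ h').symm), sub_self,
        mul_zero]
      intro h'
      have : (k : ℕ) + 1 = l := by simpa using congrArg Fin.val h'
      rw [← this, proposedAt_succ] at h
      exact h hb
    · rfl
  · simp

lemma stepOp_zero (p : PMF Bool) (φ : Fin (A.N + 1) → Bool → ℝ) {b : Bool}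
    (hb : ¬ProposedAt b 0) : A.stepOp p φ 0 b = A.propMean p φ 0 := by
  rw [stepOp_eq_propMean, add_eq_left]
  refine Finset.sum_eq_zero fun l _ => ?_
  split_ifs with h
  · rw [Equiv.swap_apply_of_ne_of_ne _ (Fin.succ_ne_zero l).symm, sub_self, mul_zero]
    intro h'
    have : 0 = (l : ℕ) := by simpa using congrArg Fin.val h'
    rw [← this] at h
    exact hb h
  · rfl

lemma stepOp_last (p : PMF Bool) (φ : Fin (A.N + 1) → Bool → ℝ) {b : Bool}
    (hb : ProposedAt b A.N) :
    A.stepOp p φ (Fin.last A.N) b = A.propMean p φ (Fin.last A.N) := by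
  rw [stepOp_eq_propMean, add_eq_left]
  refine Finset.sum_eq_zero fun l _ => ?_
  split_ifs with h
  · rw [Equiv.swap_apply_of_ne_of_ne (Fin.castSucc_lt_last l).ne', sub_self, mul_zero]
    intro h'
    have : A.N = (l : ℕ) + 1 := by simpa using congrArg Fin.val h'
    rw [this, proposedAt_succ] at hb
    exact hb h
  · rfl

/-- The function of an index and a proposal type with the values `v` when the direction is up (the
proposal type has the parity of the index) and `w` when it is down. -/
def byDirection {N : ℕ} (v w : Fin (N + 1) → ℝ) (i : Fin (N + 1)) (b : Bool) : ℝ :=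
  if ProposedAt b i then v i else w i

/-- The equation `stepOp φ = φ - 1` for `φ = byDirection v w`, away from the apex, reduces to a
recursion along the schedule: `ψ` and `ψ'` are the means of `φ` over the next proposal type at the
indices that have, or do not have, the parity of the present one. -/
lemma stepOp_byDirection_climb {p : PMF Bool} {v w ψ ψ' : Fin (A.N + 1) → ℝ} {b : Bool}
    (hψ : ∀ i, A.propMean p (byDirection v w) i = if ProposedAt b i then ψ i else ψ' i)
    (hup : ∀ k : Fin A.N, ψ k.castSucc + A.swapRate k * (ψ' k.succ - ψ k.castSucc) =
      v k.castSucc - 1)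
    (hdown : ∀ k : Fin A.N, ψ' k.succ + A.swapRate k * (ψ k.castSucc - ψ' k.succ) =
      w k.succ - 1)
    (h0 : ψ' 0 = w 0 - 1) {i : Fin (A.N + 1)} (hi : ¬IsApex i b) :
    A.stepOp p (byDirection v w) i b = byDirection v w i b - 1 := by
  by_cases hb : ProposedAt b i
  · obtain ⟨k, rfl⟩ := Fin.exists_castSucc_eq.2 fun h => hi ⟨h, hb⟩
    have hb' : ¬ProposedAt b k.succ := by
      rw [Fin.val_succ, proposedAt_succ]; exact not_not.2 hb
    rw [A.stepOp_castSucc p _ hb, hψ, hψ, if_pos hb, if_neg hb', byDirection, if_pos hb, hup]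
  · rw [byDirection, if_neg hb]
    rcases Fin.eq_zero_or_eq_succ i with rfl | ⟨k, rfl⟩
    · rw [A.stepOp_zero p _ hb, hψ, if_neg hb, h0]
    · have hk : ProposedAt b k := by
        rw [Fin.val_succ, proposedAt_succ] at hb; exact not_not.1 hb
      have hk' : ProposedAt b k.castSucc := hk
      rw [A.stepOp_succ p _ hk, hψ, hψ, if_pos hk', if_neg hb, hdown]

/-- The counterpart of `stepOp_byDirection_climb` away from the bottom. -/
lemma stepOp_byDirection_descend {p : PMF Bool} {v w ψ ψ' : Fin (A.N + 1) → ℝ} {b : Bool}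
    (hψ : ∀ i, A.propMean p (byDirection v w) i = if ProposedAt b i then ψ i else ψ' i)
    (hup : ∀ k : Fin A.N, ψ k.castSucc + A.swapRate k * (ψ' k.succ - ψ k.castSucc) =
      v k.castSucc - 1)
    (hdown : ∀ k : Fin A.N, ψ' k.succ + A.swapRate k * (ψ k.castSucc - ψ' k.succ) =
      w k.succ - 1)
    (hN : ψ (Fin.last A.N) = v (Fin.last A.N) - 1) {i : Fin (A.N + 1)} (hi : ¬IsBottom i b) :
    A.stepOp p (byDirection v w) i b = byDirection v w i b - 1 := by
  by_cases hb : ProposedAt b i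
  · rw [byDirection, if_pos hb]
    rcases Fin.eq_castSucc_or_eq_last i with ⟨k, rfl⟩ | rfl
    · have hb' : ¬ProposedAt b k.succ := by
        rw [Fin.val_succ, proposedAt_succ]; exact not_not.2 hb
      rw [A.stepOp_castSucc p _ hb, hψ, hψ, if_pos hb, if_neg hb', hup]
    · rw [A.stepOp_last p _ hb, hψ, if_pos hb, hN]
  · rw [byDirection, if_neg hb]
    obtain ⟨k, rfl⟩ := Fin.exists_succ_eq.2 fun h => hi ⟨h, hb⟩
    have hk : ProposedAt b k := by
      rw [Fin.val_succ, proposedAt_succ] at hb; exact not_not.1 hb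
    have hk' : ProposedAt b k.castSucc := hk
    rw [A.stepOp_succ p _ hk, hψ, hψ, if_pos hk', if_neg hb, hdown]

/-- Cyclic potentials from solutions of the recursions along the schedule: `v`, `w` are the values
in a climbing phase, with direction up and down, and `v'`, `w'` those outside of one. -/
lemma isCyclePotential_byDirection {prop : ℕ → PMF Bool} {v w v' w' : Fin (A.N + 1) → ℝ}
    (hc : ∀ n i b, prop n b ≠ 0 → ¬IsApex i b →
      A.stepOp (prop (n + 1)) (byDirection v w) i b = byDirection v w i b - 1)
    (hd : ∀ n i b, prop n b ≠ 0 → ¬IsBottom i b →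
      A.stepOp (prop (n + 1)) (byDirection v' w') i b = byDirection v' w' i b - 1)
    (hN : v (Fin.last A.N) = 0) (h0 : w' 0 = w 0) :
    A.IsCyclePotential prop (fun q => if q then byDirection v w else byDirection v' w')
      (v' (Fin.last A.N)) where
  step_climb := by simpa using hc
  step_descend := by simpa using hd
  apex := by
    rintro i b ⟨rfl, hb⟩
    change byDirection v' w' _ b = byDirection v w _ b + v' _
    rw [byDirection, byDirection, if_pos hb, if_pos hb, hN, zero_add]
  bottom := by
    rintro i b ⟨rfl, hb⟩
    change byDirection v w _ b = byDirection v' w' _ b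
    rw [byDirection, byDirection, if_neg hb, if_neg hb, h0]

lemma partialSum_last (c : Fin A.N → ℝ) : Fin.partialSum c (Fin.last A.N) = ∑ k, c k := by
  rw [Fin.partialSum, List.take_of_length_le (by simp), List.sum_ofFn]

/-- The odds of rejection of the swap `(k, k + 1)`. -/
def rejOdds (k : Fin A.N) : ℝ :=
  M.rejProb (A.β k.castSucc) (A.β k.succ) / M.swapProb (A.β k.castSucc) (A.β k.succ)

lemma swapRate_pos (k : Fin A.N) : 0 < A.swapRate k :=
  M.swapProb_pos (A.β_mem _) (A.β_mem _)

lemma swapRate_mul_one_add_rejOdds (k : Fin A.N) : A.swapRate k * (1 + A.rejOdds k) = 1 := by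
  have h := (A.swapRate_pos k).ne'
  unfold swapRate at h ⊢
  unfold rejOdds TemperingModel.rejProb
  field_simp
  ring

lemma inefficiency_eq : A.inefficiency = ∑ k, A.rejOdds k := rfl

lemma inefficiency_nonneg : 0 ≤ A.inefficiency :=
  Finset.sum_nonneg fun k _ => div_nonneg (M.rejProb_nonneg (A.β_mem _) (A.β_mem _))
    (A.swapRate_pos k).le

lemma propMean_pure (c : Bool) (φ : Fin (A.N + 1) → Bool → ℝ) (i : Fin (A.N + 1)) :
    A.propMean (PMF.pure c) φ i = φ i c := by
  cases c <;> simp [propMean, PMF.pure_apply]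

lemma propMean_uniform (φ : Fin (A.N + 1) → Bool → ℝ) (i : Fin (A.N + 1)) :
    A.propMean (PMF.uniformOfFintype Bool) φ i = (φ i true + φ i false) / 2 := by
  simp [propMean, PMF.uniformOfFintype_apply]
  ring

lemma byDirection_not {N : ℕ} (v w : Fin (N + 1) → ℝ) (i : Fin (N + 1)) (b : Bool) :
    byDirection v w i (!b) = if ProposedAt b i then w i else v i := by
  simp only [byDirection, proposedAt_not]
  split_ifs <;> simp_all

lemma byDirection_add {N : ℕ} (v w : Fin (N + 1) → ℝ) (i : Fin (N + 1)) :
    byDirection v w i true + byDirection v w i false = v i + w i := by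
  rw [← Bool.not_true, byDirection_not, byDirection]
  split_ifs
  · rfl
  · exact add_comm _ _

/-- Under the deterministic alternation a round trip of one machine takes on average
`2 (N + 1) (1 + E)` scans. -/
lemma exists_isCyclePotential_deo : ∃ F, A.IsCyclePotential deoProposal F
    (2 * (A.N + 1) * (1 + A.inefficiency)) := by
  set P := Fin.partialSum fun k : Fin A.N => 1 + 2 * ((k : ℝ) + 1) * A.rejOdds k with hP
  set P' := Fin.partialSum fun k : Fin A.N => 1 + 2 * ((A.N : ℝ) - k) * A.rejOdds k with hP'
  have hPs : ∀ k : Fin A.N, P k.succ = P k.castSucc + (1 + 2 * ((k : ℝ) + 1) * A.rejOdds k) :=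
    Fin.partialSum_succ _
  have hPs' : ∀ k : Fin A.N, P' k.succ = P' k.castSucc + (1 + 2 * ((A.N : ℝ) - k) * A.rejOdds k) :=
    Fin.partialSum_succ _
  set v : Fin (A.N + 1) → ℝ := fun i => P (Fin.last A.N) - P i with hv
  set w : Fin (A.N + 1) → ℝ := fun i => v i + 2 * (i : ℝ) + 1 with hw
  set w' : Fin (A.N + 1) → ℝ := fun i => w 0 + P' i with hw'
  set v' : Fin (A.N + 1) → ℝ := fun i => w' i + 2 * ((A.N : ℝ) - i) + 1 with hv'
  have hm : v' (Fin.last A.N) = 2 * (A.N + 1) * (1 + A.inefficiency) := by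
    simp only [hv', hw', hw, hv, hP, hP', Fin.partialSum_zero, partialSum_last, Fin.val_last,
      Fin.val_zero, inefficiency_eq, Nat.cast_zero]
    have h : ∑ k : Fin A.N, (1 + 2 * ((k : ℝ) + 1) * A.rejOdds k) +
        ∑ k : Fin A.N, (1 + 2 * ((A.N : ℝ) - k) * A.rejOdds k) =
        2 * A.N + 2 * (A.N + 1) * ∑ k, A.rejOdds k := by
      rw [← Finset.sum_add_distrib, Finset.mul_sum]
      have h1 : 2 * (A.N : ℝ) = ∑ _k : Fin A.N, (2 : ℝ) := by simp [mul_comm]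
      rw [h1, ← Finset.sum_add_distrib]
      exact Finset.sum_congr rfl fun k _ => by ring
    linear_combination h
  -- the next proposal type is the opposite of the present one
  have hnext : ∀ n b (φ : Fin (A.N + 1) → Bool → ℝ) i, deoProposal n b ≠ 0 →
      A.propMean (deoProposal (n + 1)) φ i = φ i (!b) := fun n b φ i hb => by
    have : b = decide (Even n) := by
      by_contra h
      exact hb (by simp [deoProposal, PMF.pure_apply, h])
    rw [deoProposal, propMean_pure, this]
    congr 1
    by_cases h : Even n <;> simp [h, Nat.even_add_one]
  rw [← hm]
  refine ⟨_, A.isCyclePotential_byDirection (v := v) (w := w) (v' := v') (w' := w')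
    (fun n i b hb hi => A.stepOp_byDirection_climb (ψ := w) (ψ' := v) (fun i => ?_) (fun k => ?_)
      (fun k => ?_) ?_ hi)
    (fun n i b hb hi => A.stepOp_byDirection_descend (ψ := w') (ψ' := v') (fun i => ?_)
      (fun k => ?_) (fun k => ?_) ?_ hi) ?_ ?_⟩
  · rw [hnext n b _ _ hb, byDirection_not]
  · simp only [hw, hv, hPs, Fin.val_castSucc]
    linear_combination (-2 * ((k : ℝ) + 1)) * A.swapRate_mul_one_add_rejOdds k
  · simp only [hw, hv, hPs, Fin.val_castSucc, Fin.val_succ]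
    push_cast
    linear_combination (2 * ((k : ℝ) + 1)) * A.swapRate_mul_one_add_rejOdds k
  · simp [hw]
  · rw [hnext n b _ _ hb, byDirection_not]
  · simp only [hv', hw', hPs', Fin.val_castSucc, Fin.val_succ]
    push_cast
    linear_combination (2 * ((A.N : ℝ) - k)) * A.swapRate_mul_one_add_rejOdds k
  · simp only [hv', hw', hPs', Fin.val_succ]
    push_cast
    linear_combination (-2 * ((A.N : ℝ) - k)) * A.swapRate_mul_one_add_rejOdds k
  · simp [hv']
  · simp [hv]
  · simp [hw', hP']

/-- Under independent fair coins a round trip of one machine takes on average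
`2 (N + 1) (N + 2 + E)` scans. -/
lemma exists_isCyclePotential_seo : ∃ F, A.IsCyclePotential seoProposal F
    (2 * (A.N + 1) * (A.N + 2 + A.inefficiency)) := by
  set P := Fin.partialSum fun k : Fin A.N => 2 * ((k : ℝ) + 1) * (1 + A.rejOdds k) with hP
  set P' := Fin.partialSum fun k : Fin A.N => 2 * ((A.N : ℝ) - k) * (1 + A.rejOdds k) with hP'
  have hPs : ∀ k : Fin A.N, P k.succ = P k.castSucc + 2 * ((k : ℝ) + 1) * (1 + A.rejOdds k) :=
    Fin.partialSum_succ _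
  have hPs' : ∀ k : Fin A.N, P' k.succ = P' k.castSucc + 2 * ((A.N : ℝ) - k) * (1 + A.rejOdds k) :=
    Fin.partialSum_succ _
  set ψ : Fin (A.N + 1) → ℝ := fun i => 2 * A.N + 1 + (P (Fin.last A.N) - P i) with hψ
  set v : Fin (A.N + 1) → ℝ := fun i => ψ i - (2 * (i : ℝ) + 1) with hv
  set w : Fin (A.N + 1) → ℝ := fun i => ψ i + (2 * (i : ℝ) + 1) with hw
  set ψ' : Fin (A.N + 1) → ℝ := fun i => w 0 + (2 * A.N + 1 + P' i) with hψ'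
  set v' : Fin (A.N + 1) → ℝ := fun i => ψ' i + (2 * ((A.N : ℝ) - i) + 1) with hv'
  set w' : Fin (A.N + 1) → ℝ := fun i => ψ' i - (2 * ((A.N : ℝ) - i) + 1) with hw'
  have hm : v' (Fin.last A.N) = 2 * (A.N + 1) * (A.N + 2 + A.inefficiency) := by
    simp only [hv', hψ', hw, hψ, hP, hP', Fin.partialSum_zero, partialSum_last, Fin.val_last,
      Fin.val_zero, inefficiency_eq, Nat.cast_zero]
    have h : ∑ k : Fin A.N, 2 * ((k : ℝ) + 1) * (1 + A.rejOdds k) +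
        ∑ k : Fin A.N, 2 * ((A.N : ℝ) - k) * (1 + A.rejOdds k) =
        2 * (A.N + 1) * (A.N + ∑ k, A.rejOdds k) := by
      have h1 : (A.N : ℝ) = ∑ _k : Fin A.N, (1 : ℝ) := by simp
      conv_rhs => rw [h1, ← Finset.sum_add_distrib, Finset.mul_sum, ← h1]
      rw [← Finset.sum_add_distrib]
      exact Finset.sum_congr rfl fun k _ => by ring
    linear_combination h
  have hnext : ∀ n (φ : Fin (A.N + 1) → Bool → ℝ) i,
      A.propMean (seoProposal (n + 1)) φ i = (φ i true + φ i false) / 2 :=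
    fun n φ i => A.propMean_uniform φ i
  rw [← hm]
  refine ⟨_, A.isCyclePotential_byDirection (v := v) (w := w) (v' := v') (w' := w')
    (fun n i b hb hi => A.stepOp_byDirection_climb (ψ := ψ) (ψ' := ψ) (fun i => ?_) (fun k => ?_)
      (fun k => ?_) ?_ hi)
    (fun n i b hb hi => A.stepOp_byDirection_descend (ψ := ψ') (ψ' := ψ') (fun i => ?_)
      (fun k => ?_) (fun k => ?_) ?_ hi) ?_ ?_⟩
  · rw [hnext, byDirection_add, ite_self]
    ring
  · simp only [hv, hψ, hPs, Fin.val_castSucc]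
    linear_combination (-2 * ((k : ℝ) + 1)) * A.swapRate_mul_one_add_rejOdds k
  · simp only [hw, hψ, hPs, Fin.val_succ]
    push_cast
    linear_combination (2 * ((k : ℝ) + 1)) * A.swapRate_mul_one_add_rejOdds k
  · simp [hw]
  · rw [hnext, byDirection_add, ite_self]
    ring
  · simp only [hv', hψ', hPs', Fin.val_castSucc]
    linear_combination (2 * ((A.N : ℝ) - k)) * A.swapRate_mul_one_add_rejOdds k
  · simp only [hw', hψ', hPs', Fin.val_succ]
    push_cast
    linear_combination (-2 * ((A.N : ℝ) - k)) * A.swapRate_mul_one_add_rejOdds k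
  · simp [hv']
  · simp [hv, hψ]
  · simp [hw', hψ', hP']

variable {A}

/-- For every schedule the round trip rate of DEO is exactly `1 / (2 + 2 E)`. -/
lemma tendsto_meanRestarts_deo (hA : A.EfficientLocalExploration) :
    (∀ n, Integrable (fun ω => (annealedRestarts ω n : ℝ)) (A.law deoProposal)) ∧
    Tendsto (A.meanRestarts deoProposal) atTop (𝓝 (1 / (2 + 2 * A.inefficiency))) := by
  obtain ⟨F, hF⟩ := A.exists_isCyclePotential_deo
  have h0 := A.inefficiency_nonneg
  have h := hF.tendsto_meanRestarts hA (by positivity)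
  refine ⟨h.1, ?_⟩
  convert h.2 using 2
  field_simp

/-- For every schedule the round trip rate of SEO is exactly `1 / (2 N + 4 + 2 E)`. -/
lemma tendsto_meanRestarts_seo (hA : A.EfficientLocalExploration) :
    (∀ n, Integrable (fun ω => (annealedRestarts ω n : ℝ)) (A.law seoProposal)) ∧
    Tendsto (A.meanRestarts seoProposal) atTop
      (𝓝 (1 / (2 * A.N + 4 + 2 * A.inefficiency))) := by
  obtain ⟨F, hF⟩ := A.exists_isCyclePotential_seo
  have h0 := A.inefficiency_nonneg
  have h := hF.tendsto_meanRestarts hA (by positivity)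
  refine ⟨h.1, ?_⟩
  convert h.2 using 2
  field_simp
  ring

lemma tauDEO_eq (hA : A.EfficientLocalExploration) : A.tauDEO = 1 / (2 + 2 * A.inefficiency) :=
  (tendsto_meanRestarts_deo hA).2.limUnder_eq

lemma tauSEO_eq (hA : A.EfficientLocalExploration) :
    A.tauSEO = 1 / (2 * A.N + 4 + 2 * A.inefficiency) :=
  (tendsto_meanRestarts_seo hA).2.limUnder_eq

end PTSetup

/-! ### Asymptotics as the mesh tends to zero -/

section

variable {X : Type*} [MeasurableSpace X] {M : TemperingModel X}

lemma eventually_mesh_le {η : ℝ} (hη : 0 < η) : ∀ᶠ A in meshToZero M, A.mesh ≤ η :=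
  (tendsto_comap.mono_left inf_le_left).eventually (eventually_le_nhds hη)

lemma eventually_efficientLocalExploration :
    ∀ᶠ A in meshToZero M, A.EfficientLocalExploration :=
  mem_inf_of_right (mem_principal_self _)

lemma tendsto_mesh : Tendsto (fun A : PTSetup M => A.mesh) (meshToZero M) (𝓝 0) :=
  tendsto_comap.mono_left inf_le_left

/-- The inefficiency exceeds the global barrier by at most a multiple of the mesh. -/
lemma isBigO_inefficiency_sub (hD : Integrable M.envelope M.refMeasure) :
    (fun A : PTSetup M => A.inefficiency - M.globalBarrier) =O[meshToZero M]
      (fun A => A.mesh) := by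
  obtain ⟨C, hC, η, hη, h⟩ := exists_inefficiency_le hD
  refine IsBigO.of_bound C ?_
  filter_upwards [eventually_mesh_le hη] with A hA
  have h1 := A.globalBarrier_le_inefficiency hD
  rw [Real.norm_of_nonneg (sub_nonneg.2 h1), Real.norm_of_nonneg A.mesh_pos.le]
  linarith [h A hA]

lemma one_div_N_le_mesh (A : PTSetup M) : 1 / (A.N : ℝ) ≤ A.mesh := by
  have hN : (0 : ℝ) < A.N := Nat.cast_pos.2 A.N_pos
  rw [div_le_iff₀ hN, mul_comm]
  exact A.one_le_N_mul_mesh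

lemma tendsto_N_atTop : Tendsto (fun A : PTSetup M => (A.N : ℝ)) (meshToZero M) atTop := by
  have h : Tendsto (fun A : PTSetup M => (A.N : ℝ)⁻¹) (meshToZero M) (𝓝[>] 0) := by
    refine tendsto_nhdsWithin_iff.2 ⟨squeeze_zero (fun A => by positivity)
      (fun A => by simpa using one_div_N_le_mesh A) tendsto_mesh, Eventually.of_forall fun A => ?_⟩
    exact inv_pos.2 (Nat.cast_pos.2 A.N_pos : (0 : ℝ) < A.N)
  simpa [Function.comp_def] using tendsto_inv_nhdsGT_zero.comp h

end

end

theorem mainTheorem5 {X : Type*} [MeasurableSpace X] (M : TemperingModel X)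
    (hV_ref : Integrable (fun x => M.V x ^ 3) M.refMeasure)
    (hV_target : Integrable (fun x => M.V x ^ 3) M.targetMeasure) :
    -- the local and global barriers and the round trip rates are well defined
    ((∀ β ∈ Set.Icc (0 : ℝ) 1,
        Tendsto (fun δ => M.rejProb β (β + δ) / |δ|) (TemperingModel.incrementFilter β)
          (𝓝 (M.localBarrier β))) ∧
      IntervalIntegrable M.localBarrier volume 0 1 ∧
      ∀ A : PTSetup M, A.EfficientLocalExploration →
        (∀ n, Integrable (fun ω => (annealedRestarts ω n : ℝ)) (A.law seoProposal)) ∧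
        (∀ n, Integrable (fun ω => (annealedRestarts ω n : ℝ)) (A.law deoProposal)) ∧
        Tendsto (A.meanRestarts seoProposal) atTop (𝓝 A.tauSEO) ∧
        Tendsto (A.meanRestarts deoProposal) atTop (𝓝 A.tauDEO)) ∧
    -- (a)
    ((∀ᶠ A in meshToZero M, M.globalBarrier ≤ A.inefficiency) ∧
      (fun A : PTSetup M => A.inefficiency - M.globalBarrier) =O[meshToZero M]
        (fun A => A.mesh)) ∧
    -- (b)
    ((fun A : PTSetup M => A.tauSEO) ~[meshToZero M]
        (fun A => 1 / (2 * (A.N : ℝ) + 2 * M.globalBarrier)) ∧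
      Tendsto (fun A : PTSetup M => A.tauSEO) (meshToZero M) (𝓝 0)) ∧
    -- (c)
    (Tendsto (fun A : PTSetup M => A.tauDEO) (meshToZero M)
        (𝓝 (1 / (2 + 2 * M.globalBarrier))) ∧
      0 < 1 / (2 + 2 * M.globalBarrier) ∧
      (fun A : PTSetup M => A.tauDEO - 1 / (2 + 2 * M.globalBarrier)) =O[meshToZero M]
        (fun A => A.mesh)) := by
  have hD := M.integrable_envelope hV_ref hV_target
  have hΛ := TemperingModel.globalBarrier_nonneg hD
  have hΛE := fun A : PTSetup M => A.globalBarrier_le_inefficiency hD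
  have hO := isBigO_inefficiency_sub hD
  have hE : Tendsto (fun A : PTSetup M => A.inefficiency) (meshToZero M) (𝓝 M.globalBarrier) := by
    simpa using (hO.trans_tendsto tendsto_mesh).add_const M.globalBarrier
  have hDEO : (fun A : PTSetup M => A.tauDEO) =ᶠ[meshToZero M]
      fun A => 1 / (2 + 2 * A.inefficiency) :=
    eventually_efficientLocalExploration.mono fun A hA => PTSetup.tauDEO_eq hA
  have hSEO : (fun A : PTSetup M => A.tauSEO) =ᶠ[meshToZero M]
      fun A => 1 / (2 * A.N + 4 + 2 * A.inefficiency) :=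
    eventually_efficientLocalExploration.mono fun A hA => PTSetup.tauSEO_eq hA
  have hlimSEO : Tendsto (fun A : PTSetup M => 2 * (A.N : ℝ) + 4 + 2 * A.inefficiency)
      (meshToZero M) atTop :=
    tendsto_atTop_mono (fun A => by
      linarith [A.inefficiency_nonneg, (Nat.cast_nonneg A.N : (0 : ℝ) ≤ A.N)])
      tendsto_N_atTop
  -- `x ↦ 1 / (2 + 2 x)` is a contraction on the nonnegative reals
  have hsub : ∀ A : PTSetup M, 1 / (2 + 2 * A.inefficiency) - 1 / (2 + 2 * M.globalBarrier) =
      -(A.inefficiency - M.globalBarrier) /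
        (2 * (1 + A.inefficiency) * (1 + M.globalBarrier)) := fun A => by
    have := A.inefficiency_nonneg
    field_simp
    ring
  refine ⟨⟨fun β hβ => ?_, ?_, fun A hA => ⟨(PTSetup.tendsto_meanRestarts_seo hA).1,
    (PTSetup.tendsto_meanRestarts_deo hA).1, ?_, ?_⟩⟩, ⟨Eventually.of_forall hΛE, hO⟩,
    ⟨?_, ?_⟩, ?_, by positivity, ?_⟩
  · rw [TemperingModel.localBarrier_eq hD hβ]
    exact TemperingModel.tendsto_rejProb_div hD hβ
  · refine (TemperingModel.intervalIntegrable_meanAbsDiff hD (a := 0) (b := 1) (by simp)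
      (by simp)).congr fun β hβ => ?_
    rw [Set.uIoc_of_le zero_le_one] at hβ
    exact (TemperingModel.localBarrier_eq hD (Set.Ioc_subset_Icc_self hβ)).symm
  · rw [PTSetup.tauSEO_eq hA]
    exact (PTSetup.tendsto_meanRestarts_seo hA).2
  · rw [PTSetup.tauDEO_eq hA]
    exact (PTSetup.tendsto_meanRestarts_deo hA).2
  · refine IsEquivalent.congr_left ?_ hSEO.symm
    -- the denominators differ by a bounded amount and tend to infinity
    have h1 : (fun A : PTSetup M => 2 * (A.N : ℝ) + 4 + 2 * A.inefficiency) ~[meshToZero M]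
        fun A => 2 * (A.N : ℝ) + 2 * M.globalBarrier := by
      refine IsLittleO.isEquivalent ?_
      have h2 : (fun A : PTSetup M => 4 + 2 * (A.inefficiency - M.globalBarrier))
          =O[meshToZero M] fun _ => (1 : ℝ) :=
        (((hE.sub_const M.globalBarrier).const_mul 2).const_add 4).isBigO_one ℝ
      have h3 : Tendsto (fun A : PTSetup M => 2 * (A.N : ℝ) + 2 * M.globalBarrier) (meshToZero M)
          atTop :=
        tendsto_atTop_mono (fun A => by linarith [(Nat.cast_nonneg A.N : (0 : ℝ) ≤ A.N)])
          tendsto_N_atTop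
      refine (h2.trans_isLittleO (isLittleO_const_left.2 (Or.inr ?_))).congr_left fun A => ?_
      · exact tendsto_norm_atTop_atTop.comp h3
      · simp only [Pi.sub_apply]
        ring
    simpa [Pi.inv_def] using h1.inv
  · refine Tendsto.congr' hSEO.symm ?_
    simpa [Pi.inv_def] using hlimSEO.inv_tendsto_atTop
  · refine Tendsto.congr' hDEO.symm ?_
    exact tendsto_const_nhds.div ((hE.const_mul 2).const_add 2) (by positivity)
  · refine (IsBigO.congr' ?_ (hDEO.symm.sub EventuallyEq.rfl) EventuallyEq.rfl)
    refine IsBigO.trans (IsBigO.of_bound 1 (Eventually.of_forall fun A => ?_)) hO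
    have h0 := A.inefficiency_nonneg
    change ‖1 / (2 + 2 * A.inefficiency) - 1 / (2 + 2 * M.globalBarrier)‖ ≤ _
    rw [hsub, norm_div, norm_neg, one_mul]
    refine div_le_self (norm_nonneg _) ?_
    rw [Real.norm_of_nonneg (by positivity)]
    nlinarith [mul_nonneg h0 hΛ]
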